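/- **Model.** In the congested $n$-clique, $n$ nodes work in synchronous rounds; in each round every node can send to every other node a distinct message of $O(\log n)$ bits and perform unlimited local computation. Initially each node knows only its own batch of $n$ points of the Euclidean plane; the coordinates are real numbers represented by bit strings of length $O(\log n)$ (in any fixed representation), and the $n^2$ input points are distinct. Let $S$ be the set of all $n^2$ input points, $n\ge 2$. **The procedure NewConvexHull$(S)$.** Points are ordered by $x$-coordinate, ties broken by $y$-coordinate; "left/right of" refers to this order. The vertices of the upper (lower) hull of a finite set are its points that lie strictly above (below) every segment between a point of the set to the left and a point of the set to the right of them. The *bridge* of two upper (lower) hulls, one to the left of the other, is their common supporting line that has no point of either hull above (below) it; its endpoints are the leftmost vertex of the left hull and the rightmost vertex of the right hull that lie on it. 1. Sort $S$, so that the $i$-th node receives the $i$-th batch of $n$ consecutive points. Each node sends its first and last point to all nodes. All nodes determine the first point $p_{\min}$ and the last point $p_{\max}$ of $S$; each node splits its batch into its upper-hull subsequence (the points above or on the segment $p_{\min}p_{\max}$) and its lower-hull subsequence (the points below or on it), and sends the first and last points of both to all nodes. 2. Upper hull. (a) Each node $\ell$ computes the upper hull $H_\ell$ of its upper-hull subsequence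 locally. (b) In parallel for all pairs $\ell<m$ with $H_\ell,H_m\neq\emptyset$, the bridge of $H_\ell$ and $H_m$ is computed by the recursive procedure Bridge, which works on contiguous fragments of $H_\ell$ and $H_m$: if one fragment has at most two vertices, or if the line through the medians of the two fragments is a supporting line of both, then the bridge is found, and all points of the upper-hull subsequences of $\ell$ and $m$ strictly between its endpoints are marked; otherwise Bridge is called recursively after removal of all vertices of one of the fragments on one side of its median, where none of the removed vertices is an endpoint of the bridge. (c) If a node $\ell$ has a single unmarked point $p$, and $p$ is an endpoint of the bridges of $H_\ell$ with some $H_k$ and with some $H_m$, $k<\ell<m$, that form an angle of at most $180$ degrees above $p$, then $p$ is marked. (d) Each node keeps the unmarked vertices of $H_\ell$. 3. Lower hull: symmetric. 4. The vertices kept, the upper hull from left to right and then the lower hull from right to left without $p_{\min}$ and $p_{\max}$, are moved to consecutive nodes in batches of $n$ (the last non-empty batch may be smaller). **Theorem.** (i) For all $n\geq 2$ and every set $S$ of $n^2$ points in the plane distributed to $n$ nodes in batches of $n$, every execution of NewConvexHull$(S)$, whatever admissible removals are made in Bridge, terminates after $O(\log n)$ steps, where one level of the recursion of all parallel calls of Bridge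 counts as one step; and it ends with the vertices of the convex hull of $S$ held in clockwise order in consecutive nodes in batches of $n$ (the last non-empty batch may be smaller). (ii) NewConvexHull can be carried out in $O(\log n)$ rounds on the congested $n$-clique: for every constant $c$ there are constants $B,C$ such that for all $n\ge 2$ and every representation of coordinates by at most $c\lfloor\log_2 n\rfloor$ bits there is a deterministic protocol with messages of $B\lfloor\log_2 n\rfloor$ bits which, on every input as above, goes in at most $C\lfloor\log_2 n\rfloor$ rounds through a complete execution of NewConvexHull (that is, at successive times the state of each node determines what that node holds in the successive configurations of the execution) and outputs the vertices of the convex hull of $S$ in clockwise order in consecutive nodes in batches of $n$ (the last non-empty batch may be smaller). -/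

import Mathlib

/-! ### The congested clique -/

/-- A deterministic synchronous protocol on the congested clique with nodes `Fin n` and `b`-bit
messages. Node `i` starts from its own input only. In every round each node sends to every node a
message of its choice and then updates its state from the messages it received. Local computation
is unlimited, so the local functions are arbitrary. -/
structure CliqueProtocol (n b : ℕ) (In Out : Type) where
  State : Type
  init : Fin n → In → State
  /-- `send i σ j` is the message from node `i`, in state `σ`, to node `j`. -/
  send : Fin n → State → Fin n → BitVec b
  /-- `recv i σ msg` is the new state of node `i`, where `msg j` came from node `j`. -/
  recv : Fin n → State → (Fin n → BitVec b) → State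
  output : Fin n → State → Out

/-- The state of every node after a given number of rounds. -/
def CliqueProtocol.exec {n b : ℕ} {In Out : Type} (P : CliqueProtocol n b In Out)
    (inp : Fin n → In) : ℕ → Fin n → P.State
  | 0 => fun i => P.init i (inp i)
  | t + 1 => fun i => P.recv i (P.exec inp t i) (fun j => P.send j (P.exec inp t j) i)

noncomputable section

/-! ### Planar geometry -/

/-- Points of the plane. -/
abbrev Pt : Type := ℝ × ℝ

/-- The orientation determinant: positive if `p` lies to the left of the directed line from `a`
to `b`, negative if it lies to the right, zero if it lies on the line. -/
def orient (a b p : Pt) : ℝ := (b.1 - a.1) * (p.2 - a.2) - (b.2 - a.2) * (p.1 - a.1)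

/-- The order by `x`-coordinates, ties being broken by `y`-coordinates. -/
def lexLT (p q : Pt) : Prop := p.1 < q.1 ∨ (p.1 = q.1 ∧ p.2 < q.2)

/-- The reflexive version of `lexLT`. -/
def lexLE (p q : Pt) : Prop := p.1 < q.1 ∨ (p.1 = q.1 ∧ p.2 ≤ q.2)

open Classical in
/-- Sorting by `lexLE`. -/
def sortPts (L : List Pt) : List Pt := L.mergeSort (fun p q => decide (lexLE p q))

/-- `V` lists the vertices of a convex polygon in clockwise order: any three of them, taken in the
order of the list, make a right turn. -/
def IsClockwise (V : List Pt) : Prop := V.Triplewise (fun a b c => orient a b c < 0)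

/-- The nodes hold, in batches of `n` (the last non-empty one may be smaller) in consecutive nodes
and in clockwise order, exactly the vertices of the convex hull of `S`. -/
def HoldsConvexHull {n : ℕ} (S : Set Pt) (out : Fin n → List Pt) : Prop :=
  ∃ V : List Pt, V.Nodup ∧ {v | v ∈ V} = Set.extremePoints ℝ (convexHull ℝ S) ∧ IsClockwise V ∧
    (List.ofFn out).flatten = V ∧ ∀ i : Fin n, out i = (V.drop (i * n)).take n

/-- The two halves of a convex hull; every step of the procedure is defined for both of them. -/
inductive Side where
  | upper
  | lower

instance : DecidableEq Side := Classical.decEq Side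

/-- For `a` before `b` in sorted order: how far `p` lies outside of the line through `a` and `b`,
that is above it for the upper hull and below it for the lower hull (up to a positive factor). -/
def Side.out : Side → Pt → Pt → Pt → ℝ
  | .upper, a, b, p => orient a b p
  | .lower, a, b, p => -orient a b p

open Classical in
/-- The vertices of the upper (lower) hull of a sorted list of points: those points that lie
strictly above (below) each segment between an earlier and a later point. -/
def hullChain (s : Side) (U : List Pt) : List Pt :=
  U.filter (fun v => decide (∀ a ∈ U, ∀ b ∈ U, lexLT a v → lexLT v b → 0 < s.out a b v))

/-- The line through `a` and `b` is a supporting line of both chains `F` and `G`: no vertex of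
them lies outside of it. (It is used for `a` on `F` and `b` on `G`.) -/
def Supports (s : Side) (F G : List Pt) (a b : Pt) : Prop :=
  (∀ p ∈ F, s.out a b p ≤ 0) ∧ (∀ p ∈ G, s.out a b p ≤ 0)

/-- The bridge between the chain `F` and the chain `G` to the right of it is the common supporting
line through the vertex `a` of `F` and the vertex `b` of `G`. If the line touches a chain in more
than one vertex, then the outermost one is the endpoint. -/
def IsBridge (s : Side) (F G : List Pt) (a b : Pt) : Prop :=
  a ∈ F ∧ b ∈ G ∧ Supports s F G a b ∧
    (∀ p ∈ F, s.out a b p = 0 → lexLE a p) ∧ (∀ p ∈ G, s.out a b p = 0 → lexLE p b)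

/-- The median vertex of a (non-empty) chain. -/
def medianPt (F : List Pt) : Pt := F.getD (F.length / 2) 0

/-- What remains of a chain when the vertices to the left of the median are removed. -/
def dropLeft (F : List Pt) : List Pt := F.drop (F.length / 2)

/-- What remains of a chain when the vertices to the right of the median are removed. -/
def dropRight (F : List Pt) : List Pt := F.take (F.length / 2 + 1)

/-! ### The procedure `NewConvexHull` -/

/-- One level of the recursion of `Bridge`, called with the fragments `F` and `G` (`F` to the
left). It either finds the bridge (`some (a, b)`), or it replaces the fragments by `F'` and `G'`,
having removed the vertices on one side of one of the two medians, none of which is an endpoint of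
the bridge. -/
inductive BridgeStep (s : Side) (F G : List Pt) :
    List Pt → List Pt → Option (Pt × Pt) → Prop
  /-- One of the fragments has at most two vertices. -/
  | small (a b : Pt) : F.length ≤ 2 ∨ G.length ≤ 2 → IsBridge s F G a b →
      BridgeStep s F G F G (some (a, b))
  /-- The line through the medians is the bridge. -/
  | median (a b : Pt) : 3 ≤ F.length → 3 ≤ G.length →
      Supports s F G (medianPt F) (medianPt G) → IsBridge s F G a b →
      BridgeStep s F G F G (some (a, b))
  /-- Pruning. -/
  | prune (F' G' : List Pt) : 3 ≤ F.length → 3 ≤ G.length →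
      ¬ Supports s F G (medianPt F) (medianPt G) →
      ((F' = dropLeft F ∨ F' = dropRight F) ∧ G' = G ∨
        F' = F ∧ (G' = dropLeft G ∨ G' = dropRight G)) →
      (∀ a b, IsBridge s F G a b → a ∈ F' ∧ b ∈ G') →
      BridgeStep s F G F' G' none

/-- What a node holds concerning one of the two halves of the hull. -/
structure SideMem (n : ℕ) where
  /-- the part of the own batch in the upper-hull (lower-hull) subsequence -/
  sub : List Pt := []
  /-- the first and the last point in the subsequence of every node -/
  subEnds : Fin n → Option Pt × Option Pt := fun _ => (none, none)
  /-- the local upper (lower) hull -/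
  hull : List Pt := []
  /-- `frag m` is the current fragment of the own hull in the call of `Bridge` with node `m` -/
  frag : Fin n → List Pt := fun _ => []
  /-- `bridge m` is the bridge with the hull of node `m`, as soon as it is found
  (left endpoint first) -/
  bridge : Fin n → Option (Pt × Pt) := fun _ => none
  /-- the own points that are marked as not qualifying -/
  marked : Set Pt := ∅
  /-- the own vertices of the global upper (lower) hull, as found by the procedure -/
  piece : List Pt := []

/-- What a node holds. -/
structure Mem (n : ℕ) where
  batch : List Pt := []
  /-- the first and the last point of the sorted batch of every node -/
  ends : Fin n → Option Pt × Option Pt := fun _ => (none, none)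
  pmin : Option Pt := none
  pmax : Option Pt := none
  side : Side → SideMem n := fun _ => {}
  output : List Pt := []

/-- The next thing to do. -/
inductive Stage where
  | sort
  | sendEnds
  | split
  | sendSubEnds
  | localHull (s : Side)
  | bridges (s : Side)
  | angles (s : Side)
  | prune (s : Side)
  | collect
  | done

/-- After the upper hull comes the lower hull, after the lower hull the collection of the output. -/
def Side.after : Side → Stage
  | .upper => .localHull .lower
  | .lower => .collect

/-- A global configuration of the procedure. -/
structure Config (n : ℕ) where
  stage : Stage
  mem : Fin n → Mem n

/-- The initial configuration: node `i` holds the points `S i 0, …, S i (n - 1)`. -/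
def Config.initial {n : ℕ} (S : Fin n → Fin n → Pt) : Config n :=
  ⟨.sort, fun i => { batch := List.ofFn (S i) }⟩

/-- Replacing what a node holds concerning the side `s`. -/
def Mem.setSide {n : ℕ} (m : Mem n) (s : Side) (x : SideMem n) : Mem n :=
  { m with side := Function.update m.side s x }

/-- The concatenation of the lists held by the nodes, in the order of the nodes. -/
def gather {n : ℕ} (f : Fin n → List Pt) : List Pt := (List.ofFn f).flatten

/-- The `i`-th consecutive batch of `n` elements of a list. -/
def chunk {n : ℕ} (L : List Pt) (i : Fin n) : List Pt := (L.drop (i * n)).take n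

/-- The extreme points of all nodes, as a sorted list. -/
def Mem.allEnds {n : ℕ} (m : Mem n) : List Pt :=
  sortPts (gather (fun j => (m.ends j).1.toList ++ (m.ends j).2.toList))

open Classical in
/-- The points of the batch that lie on the segment from `pmin` to `pmax` or on the side `s`
of it. -/
def Mem.splitBatch {n : ℕ} (m : Mem n) (pmin pmax : Option Pt) (s : Side) : List Pt :=
  m.batch.filter (fun q => decide (∀ a ∈ pmin, ∀ b ∈ pmax, 0 ≤ s.out a b q))

/-- The call of `Bridge` for the nodes `l` and `m` is still to be worked on. (Nodes with an empty
hull take part in no call.) -/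
def ActiveCall {n : ℕ} (s : Side) (M : Fin n → Mem n) (l m : Fin n) : Prop :=
  ((M l).side s).hull ≠ [] ∧ ((M m).side s).hull ≠ [] ∧ ((M l).side s).bridge m = none

/-- The marked points of node `l` after a level of the calls of `Bridge`, where `R` are the bridges
known to `l`: those of its points that lie strictly between the endpoints of a bridge are marked. -/
def markBelow {n : ℕ} (x : SideMem n) (R : Fin n → Option (Pt × Pt)) : Set Pt :=
  x.marked ∪ {v | v ∈ x.sub ∧ ∃ m a b, R m = some (a, b) ∧ lexLT a v ∧ lexLT v b}

/-- The points that node `l` marks in the angle test: its only unmarked point `p`, if `p` is an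
endpoint both of a bridge to a node further left and of a bridge to a node further right, and the
angle between these bridges on the outer side is at most 180 degrees. -/
def angleMarked {n : ℕ} (x : SideMem n) (s : Side) (l : Fin n) : Set Pt :=
  {p | p ∈ x.sub ∧ p ∉ x.marked ∧ (∀ q ∈ x.sub, q ∉ x.marked → q = p) ∧
    ∃ k m : Fin n, k < l ∧ l < m ∧ ∃ a b,
      x.bridge k = some (a, p) ∧ x.bridge m = some (p, b) ∧ s.out a b p ≤ 0}

open Classical in
/-- The unmarked vertices of the local hull. -/
def unmarkedHull {n : ℕ} (x : SideMem n) : List Pt :=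
  x.hull.filter (fun v => decide (v ∉ x.marked))

open Classical in
/-- The upper hull from left to right, followed by the lower hull from right to left without the
two extreme points, which belong to the upper hull. -/
def hullSequence {n : ℕ} (M : Fin n → Mem n) (pmin pmax : Option Pt) : List Pt :=
  gather (fun j => ((M j).side .upper).piece) ++
    (gather (fun j => ((M j).side .lower).piece)).reverse.filter
      (fun v => decide (v ∉ pmin ∧ v ∉ pmax))

/-- The steps of the procedure `NewConvexHull`. -/
inductive Step {n : ℕ} : Config n → Config n → Prop
  /-- Sort, so that each node receives `n` consecutive points. -/
  | sort (M : Fin n → Mem n) :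
      Step ⟨.sort, M⟩ ⟨.sendEnds, fun i =>
        { M i with batch := chunk (sortPts (gather (fun j => (M j).batch))) i }⟩
  /-- Each node sends its first and last point to all nodes. -/
  | sendEnds (M : Fin n → Mem n) :
      Step ⟨.sendEnds, M⟩ ⟨.split, fun i =>
        { M i with ends := fun j => ((M j).batch.head?, (M j).batch.getLast?) }⟩
  /-- Each node determines the extreme points and splits its batch. -/
  | split (M : Fin n → Mem n) :
      Step ⟨.split, M⟩ ⟨.sendSubEnds, fun i =>
        { M i with
          pmin := (M i).allEnds.head?
          pmax := (M i).allEnds.getLast?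
          side := fun s => { (M i).side s with
            sub := (M i).splitBatch (M i).allEnds.head? (M i).allEnds.getLast? s } }⟩
  /-- Each node sends the first and last points of its subsequences to all nodes. -/
  | sendSubEnds (M : Fin n → Mem n) :
      Step ⟨.sendSubEnds, M⟩ ⟨.localHull .upper, fun i =>
        { M i with side := fun s => { (M i).side s with
            subEnds := fun j => (((M j).side s).sub.head?, ((M j).side s).sub.getLast?) } }⟩
  /-- Each node computes its local hull; all calls of `Bridge` start from the whole local hulls. -/
  | localHull (s : Side) (M : Fin n → Mem n) :
      Step ⟨.localHull s, M⟩ ⟨.bridges s, fun i => (M i).setSide s { (M i).side s with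
            hull := hullChain s ((M i).side s).sub
            frag := fun _ => hullChain s ((M i).side s).sub }⟩
  /-- One level of the recursion of all active calls of `Bridge`, in parallel. -/
  | bridgeLevel (s : Side) (M : Fin n → Mem n) (F : Fin n → Fin n → List Pt)
      (R : Fin n → Fin n → Option (Pt × Pt)) :
      (∃ l m, l < m ∧ ActiveCall s M l m) →
      (∀ l m, l < m → ActiveCall s M l m →
        BridgeStep s (((M l).side s).frag m) (((M m).side s).frag l) (F l m) (F m l) (R l m)) →
      (∀ l m, l < m → ¬ ActiveCall s M l m → F l m = ((M l).side s).frag m ∧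
        F m l = ((M m).side s).frag l ∧ R l m = ((M l).side s).bridge m) →
      (∀ l m, R m l = R l m) →
      (∀ l, F l l = ((M l).side s).frag l ∧ R l l = ((M l).side s).bridge l) →
      Step ⟨.bridges s, M⟩ ⟨.bridges s, fun i => (M i).setSide s { (M i).side s with
            frag := F i
            bridge := R i
            marked := markBelow ((M i).side s) (R i) }⟩
  /-- All bridges have been found. -/
  | bridgesDone (s : Side) (M : Fin n → Mem n) :
      (∀ l m, l < m → ¬ ActiveCall s M l m) →
      Step ⟨.bridges s, M⟩ ⟨.angles s, M⟩
  /-- The angle test. -/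
  | angles (s : Side) (M : Fin n → Mem n) :
      Step ⟨.angles s, M⟩ ⟨.prune s, fun i => (M i).setSide s { (M i).side s with
            marked := ((M i).side s).marked ∪ angleMarked ((M i).side s) s i }⟩
  /-- Each node keeps only the unmarked vertices of its local hull. -/
  | prune (s : Side) (M : Fin n → Mem n) :
      Step ⟨.prune s, M⟩ ⟨s.after, fun i => (M i).setSide s { (M i).side s with
            piece := unmarkedHull ((M i).side s) }⟩
  /-- The vertices found are moved to consecutive nodes in batches of `n`. -/
  | collect (M : Fin n → Mem n) :
      Step ⟨.collect, M⟩ ⟨.done, fun i =>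
        { M i with output := chunk (hullSequence M (M i).pmin (M i).pmax) i }⟩

/-- `c 0, …, c K` is an execution of `K` steps of the procedure on the input `S`. -/
def IsRun {n : ℕ} (S : Fin n → Fin n → Pt) (K : ℕ) (c : ℕ → Config n) : Prop :=
  c 0 = Config.initial S ∧ ∀ k < K, Step (c k) (c (k + 1))

/-! ### Inputs, and the procedure on the congested clique -/

/-- The points denoted by the inputs of the nodes, when an `L`-bit string `w` is the representation
of the real number `val w`. -/
def points {n L : ℕ} (val : BitVec L → ℝ) (inp : Fin n → Fin n → BitVec L × BitVec L) :
    Fin n → Fin n → Pt :=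
  fun i j => (val (inp i j).1, val (inp i j).2)

/-- The set of all input points. -/
def pointSet {n : ℕ} (S : Fin n → Fin n → Pt) : Set Pt := {p | ∃ i j, S i j = p}

/-- The `n ^ 2` input points are distinct. -/
def DistinctPoints {n : ℕ} (S : Fin n → Fin n → Pt) : Prop :=
  Function.Injective (fun q : Fin n × Fin n => S q.1 q.2)

/-- In its first `T` rounds on the input `inp` the protocol `P` carries out the procedure on the
point set `S`: there are a complete run of the procedure and times
`0 = t 0 ≤ t 1 ≤ … ≤ t K = T` such that after `t k` rounds, for each `k ≤ K`, what node `i` holds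
in the `k`-th configuration of the run can be read off the state of node `i` by `mem i`. -/
def CarriesOut {n b : ℕ} {In Out : Type} (P : CliqueProtocol n b In Out)
    (mem : Fin n → P.State → Mem n) (T : ℕ) (inp : Fin n → In) (S : Fin n → Fin n → Pt) : Prop :=
  ∃ (K : ℕ) (c : ℕ → Config n) (t : ℕ → ℕ),
    IsRun S K c ∧ (c K).stage = .done ∧ Monotone t ∧ t 0 = 0 ∧ t K = T ∧
    ∀ k ≤ K, ∀ i, mem i (P.exec inp (t k) i) = (c k).mem i

end

/-! Every statement about the geometry is made for the functional `Side.out`, so that both halves of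
the hull are treated at once. Points with equal `x`-coordinates need no special care: on a finite set
the lexicographic order is the order by a slightly tilted coordinate (`exists_tilt`), and `out`
satisfies linear relations whose coefficients are differences of tilted coordinates.

*Why the vertices kept are the right ones.* A bridge exists and is unique (`exists_isBridge`,
`IsBridge.unique`). A point that lies on or inside of a segment between other points lies on or inside
of an edge of the global hull, namely the bridge between the points to the left and to the right of it
(`exists_isEdge`). If an endpoint of this edge belongs to the node of the point, the edge is a bridge of
two local hulls, and the point is marked because of it. Otherwise the bridges of the local hull with
those of the nodes of the two endpoints leave at most one point unmarked, and this one is marked in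
the angle test (`bridges_under_edge`). So the unmarked vertices of the local hulls are the vertices of
the upper and of the lower hull (`gather_pieceOf`), these are the extreme points
(`extremePoints_eq_hullChains`), and they are collected in clockwise order (`hullCycle_isClockwise`).

*Why every execution is short and correct.* `RunInv` is an invariant of all executions. The fragments of
an active call contain the endpoints of the bridge of the local hulls, so whatever is found is this
bridge, and each level halves a fragment, so there are at most `2 * Nat.size n + 1` levels
(`CallsInv.level`). Progress is always possible by halving the left fragment (`RunInv.exists_step`).

*Why few rounds suffice.* Communication is described by what the nodes know: `Reach b K r K'` says how
`r` rounds with `b`-bit messages refine the relations between the inputs that a node cannot tell apart,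
and every such refinement comes from a protocol, whose states are sets of possible inputs
(`worldsProtocol_exec`). The nodes first learn all that they need, in `O(log n)` rounds (`reach_agree`):
* Lists of at most `n` points per node are concatenated, and the result distributed, in three rounds:
  the point with the position `pos` travels via node `pos % n` to node `pos / n` (`route_gather`).
  Sorting is radix sort by the ranks of the points among all representable points, one bit at a time.
* For all pairs of nodes in parallel, the left node finds its endpoint of the bridge by a binary search:
  the right node answers the median by a point of the tangent from it to its own hull, which tells the
  left node on which side of the median the endpoint is (`lexLT_endpoint_iff`).
* In the canonical execution only left fragments are halved, and always so that the endpoint found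
  before is kept. The two nodes of a call exchange their medians and test their own chains against the
  line through them, level by level (`reach_callState`).

Then what a node holds in any configuration of the canonical execution is determined by what it knows
(`canonicalRun_eq_of_agree`), and the protocol goes through this execution with one step per round. -/

noncomputable section

/-! ### Orientation and the lexicographic order -/

theorem lexLT_irrefl (p : Pt) : ¬ lexLT p p := by
  rintro (h | ⟨_, h⟩) <;> exact lt_irrefl _ h

theorem lexLT.trans {p q r : Pt} (h : lexLT p q) (h' : lexLT q r) : lexLT p r := by
  unfold lexLT at *
  rcases h with h | ⟨h1, h2⟩ <;> rcases h' with h' | ⟨h1', h2'⟩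
  · left; linarith
  · left; linarith
  · left; linarith
  · right; constructor <;> linarith

theorem lexLT.asymm {p q : Pt} (h : lexLT p q) (h' : lexLT q p) : False :=
  lexLT_irrefl p (h.trans h')

theorem lexLT.ne {p q : Pt} (h : lexLT p q) : p ≠ q := by
  rintro rfl; exact lexLT_irrefl _ h

theorem lexLE_iff {p q : Pt} : lexLE p q ↔ lexLT p q ∨ p = q := by
  unfold lexLE lexLT
  rw [Prod.ext_iff]
  constructor
  · rintro (h | ⟨h1, h2⟩)
    · exact .inl (.inl h)
    · rcases h2.lt_or_eq with h2 | h2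
      · exact .inl (.inr ⟨h1, h2⟩)
      · exact .inr ⟨h1, h2⟩
  · rintro ((h | ⟨h1, h2⟩) | ⟨h1, h2⟩)
    · exact .inl h
    · exact .inr ⟨h1, h2.le⟩
    · exact .inr ⟨h1, h2.le⟩

theorem lexLT_trichotomy (p q : Pt) : lexLT p q ∨ p = q ∨ lexLT q p := by
  unfold lexLT
  rcases lt_trichotomy p.1 q.1 with h | h | h
  · exact .inl (.inl h)
  · rcases lt_trichotomy p.2 q.2 with h' | h' | h'
    · exact .inl (.inr ⟨h, h'⟩)
    · exact .inr (.inl (Prod.ext h h'))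
    · exact .inr (.inr (.inr ⟨h.symm, h'⟩))
  · exact .inr (.inr (.inl h))

theorem not_lexLT {p q : Pt} : ¬ lexLT p q ↔ lexLE q p := by
  rw [lexLE_iff]
  constructor
  · intro h
    rcases lexLT_trichotomy p q with h' | h' | h'
    · exact absurd h' h
    · exact .inr h'.symm
    · exact .inl h'
  · rintro (h | rfl) h'
    · exact h.asymm h'
    · exact lexLT_irrefl _ h'

theorem not_lexLE {p q : Pt} : ¬ lexLE p q ↔ lexLT q p := by
  rw [← not_lexLT, not_not]

theorem lexLE_refl (p : Pt) : lexLE p p := lexLE_iff.2 (.inr rfl)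

theorem lexLE.antisymm {p q : Pt} (h : lexLE p q) (h' : lexLE q p) : p = q := by
  rcases lexLE_iff.1 h with h | h
  · exact absurd h (not_lexLT.2 h')
  · exact h

theorem lexLE.trans {p q r : Pt} (h : lexLE p q) (h' : lexLE q r) : lexLE p r := by
  rw [lexLE_iff] at *
  rcases h with h | rfl
  · rcases h' with h' | rfl
    · exact .inl (h.trans h')
    · exact .inl h
  · exact h'

theorem lexLE.trans_lt {p q r : Pt} (h : lexLE p q) (h' : lexLT q r) : lexLT p r := by
  rcases lexLE_iff.1 h with h | rfl
  · exact h.trans h'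
  · exact h'

theorem lexLT.trans_le {p q r : Pt} (h : lexLT p q) (h' : lexLE q r) : lexLT p r := by
  rcases lexLE_iff.1 h' with h' | rfl
  · exact h.trans h'
  · exact h

theorem lexLE_total (p q : Pt) : lexLE p q ∨ lexLE q p := by
  rcases lexLT_trichotomy p q with h | h | h
  · exact .inl (lexLE_iff.2 (.inl h))
  · exact .inl (lexLE_iff.2 (.inr h))
  · exact .inr (lexLE_iff.2 (.inl h))

/-- On a finite set the lexicographic order is the order by a slightly tilted coordinate. As
`orient` is invariant under the corresponding shear, points with equal `x`-coordinates need no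
separate treatment. -/
theorem exists_tilt {A : Set Pt} (hA : A.Finite) :
    ∃ ε : ℝ, ∀ p ∈ A, ∀ q ∈ A, lexLT p q → p.1 + ε * p.2 < q.1 + ε * q.2 := by
  have key : ∀ᶠ ε : ℝ in nhdsWithin 0 (Set.Ioi 0), ∀ p ∈ A, ∀ q ∈ A, lexLT p q →
      p.1 + ε * p.2 < q.1 + ε * q.2 := by
    rw [Filter.eventually_all_finite hA]
    intro p _
    rw [Filter.eventually_all_finite hA]
    intro q _
    by_cases h : lexLT p q
    · rcases h with h | ⟨h1, h2⟩
      · have hc : Filter.Tendsto (fun ε : ℝ => q.1 + ε * q.2 - (p.1 + ε * p.2))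
            (nhdsWithin 0 (Set.Ioi 0)) (nhds (q.1 + 0 * q.2 - (p.1 + 0 * p.2))) := by
          apply Filter.Tendsto.mono_left _ nhdsWithin_le_nhds
          exact Continuous.tendsto (by fun_prop) 0
        have := hc.eventually (lt_mem_nhds (a := 0) (by linarith))
        filter_upwards [this] with ε hε _
        linarith
      · filter_upwards [self_mem_nhdsWithin] with ε hε _
        have : ε * p.2 < ε * q.2 := mul_lt_mul_of_pos_left h2 hε
        linarith
    · exact Filter.Eventually.of_forall fun _ h' => absurd h' h
  exact key.exists

theorem out_rot (s : Side) (a b c : Pt) : s.out a b c = s.out b c a := by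
  cases s <;> simp only [Side.out, orient] <;> ring

theorem out_swap (s : Side) (a b c : Pt) : s.out b a c = - s.out a b c := by
  cases s <;> simp only [Side.out, orient] <;> ring

theorem out_self_left (s : Side) (a b : Pt) : s.out a b a = 0 := by
  cases s <;> simp only [Side.out, orient] <;> ring

theorem out_self_right (s : Side) (a b : Pt) : s.out a b b = 0 := by
  cases s <;> simp only [Side.out, orient] <;> ring

/-- The linear relations between the orientations of the triples of four or five points. As in
`exists_tilt`, the coordinate along which the points are ordered may be tilted by any `ε`. -/
theorem out_four (s : Side) (a b c d : Pt) :
    s.out b c d - s.out a c d + s.out a b d - s.out a b c = 0 := by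
  cases s <;> simp only [Side.out, orient] <;> ring

theorem out_four_weighted (s : Side) (ε : ℝ) (a b c d : Pt) :
    (a.1 + ε * a.2) * s.out b c d - (b.1 + ε * b.2) * s.out a c d
      + (c.1 + ε * c.2) * s.out a b d - (d.1 + ε * d.2) * s.out a b c = 0 := by
  cases s <;> simp only [Side.out, orient] <;> ring

theorem out_five_weighted (s : Side) (ε : ℝ) (a b c d v : Pt) :
    ((d.1 + ε * d.2) - (c.1 + ε * c.2)) * s.out a b v =
      ((d.1 + ε * d.2) - (v.1 + ε * v.2)) * s.out a b c
      + ((v.1 + ε * v.2) - (c.1 + ε * c.2)) * s.out a b d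
      + ((b.1 + ε * b.2) - (a.1 + ε * a.2)) * s.out c d v := by
  cases s <;> simp only [Side.out, orient] <;> ring

/-- Comparison of a line `a b` with a segment `c d` over a point `v` between `c` and `d`. The
positive coefficients `α`, `β`, `γ`, `δ` are differences of tilted coordinates. -/
theorem out_segment (s : Side) {a b c d v : Pt} (hab : lexLT a b) (hcv : lexLT c v)
    (hvd : lexLT v d) : ∃ α β γ δ : ℝ, 0 < α ∧ 0 < β ∧ 0 < γ ∧ 0 < δ ∧
      δ * s.out a b v = α * s.out a b c + β * s.out a b d + γ * s.out c d v := by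
  obtain ⟨ε, hε⟩ := exists_tilt (A := {a, b, c, d, v}) (Set.toFinite _)
  exact ⟨_, _, _, _, sub_pos.2 (hε v (by simp) d (by simp) hvd),
    sub_pos.2 (hε c (by simp) v (by simp) hcv), sub_pos.2 (hε a (by simp) b (by simp) hab),
    sub_pos.2 (hε c (by simp) d (by simp) (hcv.trans hvd)), out_five_weighted s ε a b c d v⟩

theorem out_segment_nonpos (s : Side) {a b c d v : Pt} (hab : lexLT a b) (hcv : lexLT c v)
    (hvd : lexLT v d) (hc : s.out a b c ≤ 0) (hd : s.out a b d ≤ 0) (hv : s.out c d v ≤ 0) :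
    s.out a b v ≤ 0 := by
  obtain ⟨α, β, γ, δ, hα, hβ, hγ, hδ, h⟩ := out_segment s hab hcv hvd
  have := mul_nonpos_of_nonneg_of_nonpos hα.le hc
  have := mul_nonpos_of_nonneg_of_nonpos hβ.le hd
  have := mul_nonpos_of_nonneg_of_nonpos hγ.le hv
  by_contra! h0
  have := mul_pos hδ h0
  linarith

theorem out_segment_neg (s : Side) {a b c d v : Pt} (hab : lexLT a b) (hcv : lexLT c v)
    (hvd : lexLT v d) (hc : s.out a b c ≤ 0) (hd : s.out a b d ≤ 0) (hv : s.out c d v ≤ 0)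
    (hlt : s.out a b c < 0 ∨ s.out a b d < 0 ∨ s.out c d v < 0) :
    s.out a b v < 0 := by
  obtain ⟨α, β, γ, δ, hα, hβ, hγ, hδ, h⟩ := out_segment s hab hcv hvd
  have h1 := mul_nonpos_of_nonneg_of_nonpos hα.le hc
  have h2 := mul_nonpos_of_nonneg_of_nonpos hβ.le hd
  have h3 := mul_nonpos_of_nonneg_of_nonpos hγ.le hv
  by_contra! h0
  have := mul_nonneg hδ.le h0
  rcases hlt with h' | h' | h'
  · have := mul_neg_of_pos_of_neg hα h'
    linarith
  · have := mul_neg_of_pos_of_neg hβ h'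
    linarith
  · have := mul_neg_of_pos_of_neg hγ h'
    linarith

/-- A point of a line `a b` lies strictly outside of a segment `c d` below it. -/
theorem out_pos_of_segment_below (s : Side) {a b c d v : Pt} (hab : lexLT a b) (hcv : lexLT c v)
    (hvd : lexLT v d) (hc : s.out a b c ≤ 0) (hd : s.out a b d ≤ 0)
    (hlt : s.out a b c < 0 ∨ s.out a b d < 0) (hv : s.out a b v = 0) : 0 < s.out c d v := by
  by_contra! h
  exact (out_segment_neg s hab hcv hvd hc hd h (by tauto)).ne hv

/-- Slopes of the rays from `p` to points to the right of it are compared transitively. -/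
theorem out_trans_left (s : Side) {p a b c : Pt} (ha : lexLT p a) (hb : lexLT p b)
    (hc : lexLT p c) (h1 : s.out p a b ≤ 0) (h2 : s.out p b c ≤ 0) :
    s.out p a c ≤ 0 ∧ ((s.out p a b < 0 ∨ s.out p b c < 0) → s.out p a c < 0) := by
  obtain ⟨ε, hε⟩ := exists_tilt (A := {p, a, b, c}) (Set.toFinite _)
  have ha := hε p (by simp) a (by simp) ha
  have hb := hε p (by simp) b (by simp) hb
  have hc := hε p (by simp) c (by simp) hc
  have e1 := out_four_weighted s ε p a b c
  have e2 := out_four s p a b c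
  have key : ((b.1 + ε * b.2) - (p.1 + ε * p.2)) * s.out p a c =
      ((a.1 + ε * a.2) - (p.1 + ε * p.2)) * s.out p b c +
      ((c.1 + ε * c.2) - (p.1 + ε * p.2)) * s.out p a b := by
    linear_combination e1 - (p.1 + ε * p.2) * e2
  have m1 := mul_nonpos_of_nonneg_of_nonpos (sub_pos.2 ha).le h2
  have m2 := mul_nonpos_of_nonneg_of_nonpos (sub_pos.2 hc).le h1
  constructor
  · by_contra! h
    have := mul_pos (sub_pos.2 hb) h
    linarith
  · intro hlt
    by_contra! h
    have := mul_nonneg (sub_pos.2 hb).le h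
    rcases hlt with h' | h'
    · have := mul_neg_of_pos_of_neg (sub_pos.2 hc) h'
      linarith
    · have := mul_neg_of_pos_of_neg (sub_pos.2 ha) h'
      linarith

/-- A chain that turns inwards at `p` and continues inwards stays below the first line. -/
theorem out_extend (s : Side) {a p b c : Pt} (hap : lexLT a p) (hpb : lexLT p b)
    (hpc : lexLT p c) (h1 : s.out a p b < 0) (h2 : s.out p b c ≤ 0) : s.out a p c < 0 := by
  obtain ⟨ε, hε⟩ := exists_tilt (A := {a, p, b, c}) (Set.toFinite _)
  have hap := hε a (by simp) p (by simp) hap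
  have hpb := hε p (by simp) b (by simp) hpb
  have hpc := hε p (by simp) c (by simp) hpc
  have e1 := out_four_weighted s ε a p b c
  have e2 := out_four s a p b c
  have key : ((b.1 + ε * b.2) - (p.1 + ε * p.2)) * s.out a p c =
      ((p.1 + ε * p.2) - (a.1 + ε * a.2)) * s.out p b c +
      ((c.1 + ε * c.2) - (p.1 + ε * p.2)) * s.out a p b := by
    linear_combination e1 - (p.1 + ε * p.2) * e2
  have m1 := mul_nonpos_of_nonneg_of_nonpos (sub_pos.2 hap).le h2
  have m2 := mul_neg_of_pos_of_neg (sub_pos.2 hpc) h1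
  by_contra! h
  have := mul_nonneg (sub_pos.2 hpb).le h
  linarith

/-- Two consecutive strict turns. -/
theorem out_pos_of_two_turns (s : Side) {a p q b : Pt} (hap : lexLT a p) (hpq : lexLT p q)
    (hqb : lexLT q b) (h1 : 0 < s.out a q p) (h2 : 0 < s.out p b q) : 0 < s.out a b p := by
  by_contra! h
  have h3 : s.out p q b < 0 := by rw [out_rot, out_rot, out_swap] at h2; linarith [out_rot s b p q]
  have h4 : s.out a p q < 0 := by
    have := out_rot s a p q; have := out_rot s p q a; have := out_swap s q a p
    have := out_rot s a q p; have := out_swap s a q p; linarith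
  have := out_extend s hap hpq (hpq.trans hqb) h4 h3.le
  have := out_rot s a p b; have := out_rot s p b a
  have := out_swap s a b p
  linarith

/-! ### Bridges -/

/-- Over a vertical line that separates the two chains, either of two bridges passes on or below the
other. Hence they lie on one line, and the choice of the endpoints identifies them. -/
theorem IsBridge.unique {s : Side} {F G : List Pt} (hFG : ∀ p ∈ F, ∀ q ∈ G, lexLT p q)
    {a b a' b' : Pt} (h : IsBridge s F G a b) (h' : IsBridge s F G a' b') : a = a' ∧ b = b' := by
  obtain ⟨ha, hb, ⟨hF, hG⟩, hl, hr⟩ := h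
  obtain ⟨ha', hb', ⟨hF', hG'⟩, hl', hr'⟩ := h'
  obtain ⟨ε, hε⟩ := exists_tilt (A := {a, b, a', b'}) (Set.toFinite _)
  have w1 := hε a (by simp) b (by simp) (hFG _ ha _ hb)
  have w2 := hε a (by simp) b' (by simp) (hFG _ ha _ hb')
  have w3 := hε a' (by simp) b (by simp) (hFG _ ha' _ hb)
  have w4 := hε a' (by simp) b' (by simp) (hFG _ ha' _ hb')
  -- a vertical line that separates the two left endpoints from the two right ones
  obtain ⟨W, hW1, hW2⟩ : ∃ W, max (a.1 + ε * a.2) (a'.1 + ε * a'.2) < W ∧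
      W < min (b.1 + ε * b.2) (b'.1 + ε * b'.2) :=
    exists_between (by simp only [max_lt_iff, lt_min_iff]; tauto)
  rw [max_lt_iff] at hW1
  rw [lt_min_iff] at hW2
  have A := hF _ ha'
  have B := hG _ hb'
  have C := hF' _ ha
  have D := hG' _ hb
  have e1 := out_four_weighted s ε a a' b b'
  have e2 := out_four s a a' b b'
  rw [show s.out a' b b' = - s.out a' b' b by
      rw [← out_swap, out_rot, out_rot],
    show s.out a a' b' = s.out a' b' a by rw [out_rot],
    show s.out a a' b = - s.out a b a' by rw [← out_swap, out_rot, out_rot]] at e1 e2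
  have m1 := mul_nonpos_of_nonneg_of_nonpos (sub_pos.2 hW2.1).le C
  have m2 := mul_nonpos_of_nonneg_of_nonpos (sub_pos.2 hW2.2).le A
  have m3 := mul_nonpos_of_nonneg_of_nonpos (sub_pos.2 hW1.1).le D
  have m4 := mul_nonpos_of_nonneg_of_nonpos (sub_pos.2 hW1.2).le B
  have key : ((b.1 + ε * b.2) - W) * s.out a' b' a + ((b'.1 + ε * b'.2) - W) * s.out a b a' +
      (W - (a.1 + ε * a.2)) * s.out a' b' b + (W - (a'.1 + ε * a'.2)) * s.out a b b' = 0 := by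
    linear_combination e1 - W * e2
  have zA : s.out a b a' = 0 := by
    by_contra h0
    have := mul_neg_of_pos_of_neg (sub_pos.2 hW2.2) (lt_of_le_of_ne A h0)
    linarith
  have zB : s.out a b b' = 0 := by
    by_contra h0
    have := mul_neg_of_pos_of_neg (sub_pos.2 hW1.2) (lt_of_le_of_ne B h0)
    linarith
  have zC : s.out a' b' a = 0 := by
    by_contra h0
    have := mul_neg_of_pos_of_neg (sub_pos.2 hW2.1) (lt_of_le_of_ne C h0)
    linarith
  have zD : s.out a' b' b = 0 := by
    by_contra h0
    have := mul_neg_of_pos_of_neg (sub_pos.2 hW1.1) (lt_of_le_of_ne D h0)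
    linarith
  exact ⟨(hl _ ha' zA).antisymm (hl' _ ha zC), (hr' _ hb zD).antisymm (hr _ hb' zB)⟩

/-- Among all segments from `F` to `G`, one that is outermost over a vertical line separating `F`
from `G` lies on a common supporting line; the longest of these is the bridge. -/
theorem exists_isBridge (s : Side) {F G : List Pt} (hFG : ∀ p ∈ F, ∀ q ∈ G, lexLT p q)
    (hF : F ≠ []) (hG : G ≠ []) : ∃ a b, IsBridge s F G a b := by
  classical
  obtain ⟨ε, hε⟩ := exists_tilt (A := {p | p ∈ F} ∪ {p | p ∈ G})
    (F.finite_toSet.union G.finite_toSet)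
  set w : Pt → ℝ := fun p => p.1 + ε * p.2 with hw
  have wFG : ∀ p ∈ F, ∀ q ∈ G, w p < w q := fun p hp q hq =>
    hε p (.inl hp) q (.inr hq) (hFG p hp q hq)
  obtain ⟨pF, hpF⟩ := List.exists_mem_of_ne_nil F hF
  obtain ⟨pG, hpG⟩ := List.exists_mem_of_ne_nil G hG
  obtain ⟨W, hWF, hWG⟩ : ∃ W, (∀ p ∈ F, w p < W) ∧ ∀ p ∈ G, W < w p := by
    obtain ⟨x, hx, hx'⟩ := F.toFinset.exists_max_image w ⟨pF, by simpa⟩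
    obtain ⟨y, hy, hy'⟩ := G.toFinset.exists_min_image w ⟨pG, by simpa⟩
    simp only [List.mem_toFinset] at hx hx' hy hy'
    obtain ⟨W, h1, h2⟩ := exists_between (wFG x hx y hy)
    exact ⟨W, fun p hp => (hx' p hp).trans_lt h1, fun p hp => h2.trans_le (hy' p hp)⟩
  set σ : ℝ := match s with | .upper => 1 | .lower => -1 with hσ
  -- up to the sign `σ`, the height over the tilted coordinate `W` of the segment `z`
  set h : Pt × Pt → ℝ := fun z =>
    σ * (z.1.2 * (w z.2 - W) + z.2.2 * (W - w z.1)) / (w z.2 - w z.1) with hh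
  obtain ⟨⟨a, b⟩, hab, hmax⟩ := (F.toFinset ×ˢ G.toFinset).exists_max_image
    (fun z => toLex (h z, w z.2 - w z.1)) ⟨(pF, pG), by simp [hpF, hpG]⟩
  simp only [Finset.mem_product, List.mem_toFinset, Prod.Lex.toLex_le_toLex] at hab hmax
  obtain ⟨ha, hb⟩ := hab
  replace hmax := fun p q (hpq : p ∈ F ∧ q ∈ G) => hmax (p, q) hpq
  have hleft : ∀ p ∈ F, (w b - w p) * (w b - w a) * (h (p, b) - h (a, b)) =
      (w b - W) * s.out a b p := by
    intro p hp
    have h1 : w b - w p ≠ 0 := (sub_pos.2 (wFG p hp b hb)).ne'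
    have h2 : w b - w a ≠ 0 := (sub_pos.2 (wFG a ha b hb)).ne'
    simp only [hh]
    field_simp
    cases s <;> simp only [Side.out, orient, hw, hσ] <;> ring
  have hright : ∀ q ∈ G, (w q - w a) * (w b - w a) * (h (a, q) - h (a, b)) =
      (W - w a) * s.out a b q := by
    intro p hp
    have h1 : w p - w a ≠ 0 := (sub_pos.2 (wFG a ha p hp)).ne'
    have h2 : w b - w a ≠ 0 := (sub_pos.2 (wFG a ha b hb)).ne'
    simp only [hh]
    field_simp
    cases s <;> simp only [Side.out, orient, hw, hσ] <;> ring
  have cl : ∀ p ∈ F, 0 < (w b - w p) * (w b - w a) := fun p hp =>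
    mul_pos (sub_pos.2 (wFG p hp b hb)) (sub_pos.2 (wFG a ha b hb))
  have cr : ∀ q ∈ G, 0 < (w q - w a) * (w b - w a) := fun q hq =>
    mul_pos (sub_pos.2 (wFG a ha q hq)) (sub_pos.2 (wFG a ha b hb))
  have bl := sub_pos.2 (hWG b hb)
  have br := sub_pos.2 (hWF a ha)
  refine ⟨a, b, ha, hb, ⟨fun p hp => ?_, fun q hq => ?_⟩, fun p hp h0 => ?_, fun q hq h0 => ?_⟩
  · have : h (p, b) ≤ h (a, b) := by
      rcases hmax p b ⟨hp, hb⟩ with h | h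
      · exact h.le
      · exact h.1.le
    have := mul_nonpos_of_nonneg_of_nonpos (cl p hp).le (sub_nonpos.2 this)
    rw [hleft p hp] at this
    by_contra! h0
    linarith [mul_pos bl h0]
  · have : h (a, q) ≤ h (a, b) := by
      rcases hmax a q ⟨ha, hq⟩ with h | h
      · exact h.le
      · exact h.1.le
    have := mul_nonpos_of_nonneg_of_nonpos (cr q hq).le (sub_nonpos.2 this)
    rw [hright q hq] at this
    by_contra! h0
    linarith [mul_pos br h0]
  · have e := hleft p hp
    rw [h0, mul_zero, mul_eq_zero_iff_left (cl p hp).ne'] at e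
    rw [← not_lexLT]
    intro hlt
    have hlt := hε p (.inl hp) a (.inl ha) hlt
    rcases hmax p b ⟨hp, hb⟩ with h | h
    · exact absurd e (sub_neg.2 h).ne
    · have := h.2
      simp only [hw] at this
      linarith
  · have e := hright q hq
    rw [h0, mul_zero, mul_eq_zero_iff_left (cr q hq).ne'] at e
    rw [← not_lexLT]
    intro hlt
    have hlt := hε b (.inr hb) q (.inr hq) hlt
    rcases hmax a q ⟨ha, hq⟩ with h | h
    · exact absurd e (sub_neg.2 h).ne
    · have := h.2
      simp only [hw] at this
      linarith

theorem IsBridge.mono {s : Side} {F G F' G' : List Pt} {a b : Pt} (h : IsBridge s F G a b)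
    (hF : F' ⊆ F) (hG : G' ⊆ G) (ha : a ∈ F') (hb : b ∈ G') : IsBridge s F' G' a b :=
  ⟨ha, hb, ⟨fun p hp => h.2.2.1.1 p (hF hp), fun p hp => h.2.2.1.2 p (hG hp)⟩,
    fun p hp => h.2.2.2.1 p (hF hp), fun p hp => h.2.2.2.2 p (hG hp)⟩

/-! ### Hull edges -/

theorem mem_hullChain {s : Side} {U : List Pt} {v : Pt} : v ∈ hullChain s U ↔
    v ∈ U ∧ ∀ a ∈ U, ∀ b ∈ U, lexLT a v → lexLT v b → 0 < s.out a b v := by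
  simp [hullChain]

theorem hullChain_subset (s : Side) (U : List Pt) : hullChain s U ⊆ U := fun _ h =>
  (mem_hullChain.1 h).1

theorem hullChain_anti {s : Side} {U V : List Pt} (h : V ⊆ U) {v : Pt} (hv : v ∈ V)
    (hvU : v ∈ hullChain s U) : v ∈ hullChain s V :=
  mem_hullChain.2 ⟨hv, fun a ha b hb => (mem_hullChain.1 hvU).2 a (h ha) b (h hb)⟩

/-- The points `a` and `b` of `U` are the outermost points of `U` on a supporting line of `U`. -/
def IsEdge (s : Side) (U : List Pt) (a b : Pt) : Prop :=
  a ∈ U ∧ b ∈ U ∧ ∀ p ∈ U, s.out a b p ≤ 0 ∧ (s.out a b p = 0 → lexLE a p ∧ lexLE p b)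

/-- A point that lies on or below a segment of points of `U` lies on or below an edge, namely the
bridge between the points to the left of it and the points to the right of it. -/
theorem exists_isEdge {s : Side} {U : List Pt} {v a' b' : Pt} (ha' : a' ∈ U) (hb' : b' ∈ U)
    (hav : lexLT a' v) (hvb : lexLT v b') (hv : s.out a' b' v ≤ 0) :
    ∃ a b, IsEdge s U a b ∧ lexLT a v ∧ lexLT v b ∧ s.out a b v ≤ 0 := by
  classical
  obtain ⟨a, b, ha, hb, ⟨hF, hG⟩, hl, hr⟩ := exists_isBridge s
    (F := U.filter (fun p => lexLT p v)) (G := U.filter (fun p => lexLT v p))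
    (by
      intro p hp q hq
      simp only [List.mem_filter, decide_eq_true_eq] at hp hq
      exact hp.2.trans hq.2)
    (List.ne_nil_of_mem (a := a') (by simp [ha', hav]))
    (List.ne_nil_of_mem (a := b') (by simp [hb', hvb]))
  simp only [List.mem_filter, decide_eq_true_eq, and_imp] at ha hb hF hG hl hr
  have hab := ha.2.trans hb.2
  have hv' : s.out a b v ≤ 0 :=
    out_segment_nonpos s hab hav hvb (hF _ ha' hav) (hG _ hb' hvb) hv
  refine ⟨a, b, ⟨ha.1, hb.1, fun p hp => ?_⟩, ha.2, hb.2, hv'⟩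
  rcases lexLT_trichotomy p v with h | rfl | h
  · exact ⟨hF p hp h, fun h0 => ⟨hl p hp h h0, lexLE_iff.2 (.inl (h.trans hb.2))⟩⟩
  · exact ⟨hv', fun _ => ⟨lexLE_iff.2 (.inl ha.2), lexLE_iff.2 (.inl hb.2)⟩⟩
  · exact ⟨hG p hp h, fun h0 => ⟨lexLE_iff.2 (.inl (ha.2.trans h)), hr p hp h h0⟩⟩

theorem IsEdge.left_mem {s : Side} {U V : List Pt} {a b : Pt} (h : IsEdge s U a b)
    (hab : lexLT a b) (hVU : V ⊆ U) (ha : a ∈ V) : a ∈ hullChain s V := by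
  refine mem_hullChain.2 ⟨ha, fun c hc d hd hca had => ?_⟩
  obtain ⟨h1, h2⟩ := h.2.2 c (hVU hc)
  refine out_pos_of_segment_below s hab hca had h1 (h.2.2 d (hVU hd)).1 (.inl ?_)
    (out_self_left s a b)
  exact lt_of_le_of_ne h1 fun h0 => not_lexLT.2 (h2 h0).1 hca

theorem IsEdge.right_mem {s : Side} {U V : List Pt} {a b : Pt} (h : IsEdge s U a b)
    (hab : lexLT a b) (hVU : V ⊆ U) (hb : b ∈ V) : b ∈ hullChain s V := by
  refine mem_hullChain.2 ⟨hb, fun c hc d hd hcb hbd => ?_⟩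
  obtain ⟨h1, h2⟩ := h.2.2 d (hVU hd)
  refine out_pos_of_segment_below s hab hcb hbd (h.2.2 c (hVU hc)).1 h1 (.inr ?_)
    (out_self_right s a b)
  exact lt_of_le_of_ne h1 fun h0 => not_lexLT.2 (h2 h0).2 hbd

/-! ### The marking rules find the hull -/

theorem gather_mem {n : ℕ} {f : Fin n → List Pt} {p : Pt} : p ∈ gather f ↔ ∃ i, p ∈ f i := by
  simp [gather, List.mem_flatten, List.mem_ofFn]

theorem gather_pairwise {n : ℕ} {f : Fin n → List Pt} {R : Pt → Pt → Prop} :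
    (gather f).Pairwise R ↔ (∀ i, (f i).Pairwise R) ∧
      ∀ i j, i < j → ∀ p ∈ f i, ∀ q ∈ f j, R p q := by
  rw [gather, List.pairwise_flatten, List.pairwise_ofFn]
  simp [List.mem_ofFn]

theorem gather_filter {n : ℕ} (f : Fin n → List Pt) (P : Pt → Bool) :
    (gather f).filter P = gather (fun i => (f i).filter P) := by
  simp [gather, List.filter_flatten, List.map_ofFn, Function.comp_def]

open Classical in
/-- The bridge of two chains, if there is one. -/
def bridgeOf (s : Side) (F G : List Pt) : Option (Pt × Pt) :=
  if h : ∃ z : Pt × Pt, IsBridge s F G z.1 z.2 then some h.choose else none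

theorem bridgeOf_some {s : Side} {F G : List Pt} {a b : Pt} (h : bridgeOf s F G = some (a, b)) :
    IsBridge s F G a b := by
  unfold bridgeOf at h
  split at h
  · rename_i h'
    have := h'.choose_spec
    rw [Option.some.inj h] at this
    exact this
  · cases h

theorem bridgeOf_eq {s : Side} {F G : List Pt} (hFG : ∀ p ∈ F, ∀ q ∈ G, lexLT p q) {a b : Pt}
    (h : IsBridge s F G a b) : bridgeOf s F G = some (a, b) := by
  have h' : ∃ z : Pt × Pt, IsBridge s F G z.1 z.2 := ⟨(a, b), h⟩
  obtain ⟨h1, h2⟩ := h'.choose_spec.unique hFG h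
  unfold bridgeOf
  rw [dif_pos h', Option.some_inj]
  exact Prod.ext h1 h2

theorem bridgeOf_isSome {s : Side} {F G : List Pt} (hFG : ∀ p ∈ F, ∀ q ∈ G, lexLT p q)
    (hF : F ≠ []) (hG : G ≠ []) : ∃ a b, bridgeOf s F G = some (a, b) ∧ IsBridge s F G a b := by
  obtain ⟨a, b, h⟩ := exists_isBridge s hFG hF hG
  exact ⟨a, b, bridgeOf_eq hFG h, h⟩

theorem bridgeOf_none {s : Side} {F G : List Pt} (h : F = [] ∨ G = []) : bridgeOf s F G = none := by
  unfold bridgeOf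
  rw [dif_neg]
  rintro ⟨z, h1, h2, -⟩
  rcases h with rfl | rfl
  · exact List.not_mem_nil h1
  · exact List.not_mem_nil h2

/-- The bridge between the local hulls of the nodes `l` and `m`, in either order. -/
def pairBridge {n : ℕ} (s : Side) (sub : Fin n → List Pt) (l m : Fin n) : Option (Pt × Pt) :=
  if l < m then bridgeOf s (hullChain s (sub l)) (hullChain s (sub m))
  else if m < l then bridgeOf s (hullChain s (sub m)) (hullChain s (sub l))
  else none

theorem pairBridge_comm {n : ℕ} (s : Side) (sub : Fin n → List Pt) (l m : Fin n) :
    pairBridge s sub l m = pairBridge s sub m l := by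
  unfold pairBridge
  rcases lt_trichotomy l m with h | rfl | h
  · simp [h, h.not_gt]
  · simp
  · simp [h, h.not_gt]

/-- The points of `U` that lie strictly between the endpoints of one of the bridges `R m`. -/
def betweenMarks {n : ℕ} (U : List Pt) (R : Fin n → Option (Pt × Pt)) : Set Pt :=
  {v | v ∈ U ∧ ∃ m a b, R m = some (a, b) ∧ lexLT a v ∧ lexLT v b}

/-- What node `i` holds concerning one side after all bridges have been found, apart from the
fragments. -/
def bridgedSide {n : ℕ} (s : Side) (sub : Fin n → List Pt) (i : Fin n) : SideMem n where
  sub := sub i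
  hull := hullChain s (sub i)
  bridge := pairBridge s sub i
  marked := betweenMarks (sub i) (pairBridge s sub i)

section Marking

variable {n : ℕ} {s : Side} {sub : Fin n → List Pt}

/-- A vertex of the global hull lies strictly outside of every segment between an earlier and a later
point, whereas a vertex of a local hull is marked only if it lies on or inside of such a segment. -/
theorem not_marked_of_mem_hullChain (hs : (gather sub).Pairwise lexLT) {i : Fin n} {v : Pt}
    (hvi : v ∈ sub i) (hv : v ∈ hullChain s (gather sub)) :
    v ∉ betweenMarks (sub i) (pairBridge s sub i) ∧
    v ∉ angleMarked (bridgedSide s sub i) s i := by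
  rw [mem_hullChain] at hv
  have hU : ∀ j, hullChain s (sub j) ⊆ gather sub := fun j p hp =>
    gather_mem.2 ⟨j, hullChain_subset _ _ hp⟩
  have hvh : v ∈ hullChain s (sub i) :=
    hullChain_anti (fun p hp => gather_mem.2 ⟨i, hp⟩) hvi (mem_hullChain.2 hv)
  constructor
  · rintro ⟨-, m, a, b, h, hav, hvb⟩
    unfold pairBridge at h
    split at h
    · obtain ⟨ha, hb, hS, -⟩ := bridgeOf_some h
      exact (hv.2 a (hU _ ha) b (hU _ hb) hav hvb).not_ge (hS.1 v hvh)
    · split at h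
      · obtain ⟨ha, hb, hS, -⟩ := bridgeOf_some h
        exact (hv.2 a (hU _ ha) b (hU _ hb) hav hvb).not_ge (hS.2 v hvh)
      · cases h
  · rintro ⟨-, -, -, k, m, hk, hm, a, b, h1, h2, h3⟩
    have hlt := (gather_pairwise.1 hs).2
    simp only [bridgedSide, pairBridge, hk.not_gt, hk, hm, if_true, if_false] at h1 h2
    obtain ⟨ha, -⟩ := bridgeOf_some h1
    obtain ⟨-, hb, -⟩ := bridgeOf_some h2
    refine (hv.2 a (hU _ ha) b (hU _ hb) ?_ ?_).not_ge h3
    · exact hlt _ _ hk _ (hullChain_subset _ _ ha) _ hvi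
    · exact hlt _ _ hm _ hvi _ (hullChain_subset _ _ hb)

/-- If an edge of the global hull passes over the node `i`, then the bridge to the node of its left
endpoint ends, on node `i`, to the right of the bridge to the node of its right endpoint, or both
end in the same vertex and form an angle of at most 180 degrees there. -/
theorem bridges_under_edge {F G H : List Pt} {a b a₁ p₁ p₂ b₂ : Pt}
    (hFG : ∀ p ∈ F, ∀ q ∈ G, lexLT p q) (hGH : ∀ p ∈ G, ∀ q ∈ H, lexLT p q)
    (ha : a ∈ F) (hb : b ∈ H) (hG : ∀ p ∈ G, s.out a b p ≤ 0)
    (h₁ : IsBridge s F G a₁ p₁) (h₂ : IsBridge s G H p₂ b₂) :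
    lexLE p₂ p₁ ∧ (p₁ = p₂ → s.out a₁ b₂ p₁ ≤ 0) := by
  obtain ⟨ha₁, hp₁, hS₁, -, hr₁⟩ := h₁
  obtain ⟨hp₂, hb₂, hS₂, hl₂, -⟩ := h₂
  have lap₁ := hFG a ha p₁ hp₁
  have la₁p₁ := hFG a₁ ha₁ p₁ hp₁
  have lp₂b := hGH p₂ hp₂ b hb
  have lp₂b₂ := hGH p₂ hp₂ b₂ hb₂
  constructor
  · rw [← not_lexLT]
    intro hlt
    have n1 : s.out a₁ p₁ p₂ < 0 := lt_of_le_of_ne (hS₁.2 p₂ hp₂) fun h0 =>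
      not_lexLT.2 (hr₁ p₂ hp₂ h0) hlt
    have n2 : s.out p₂ b₂ p₁ < 0 := lt_of_le_of_ne (hS₂.1 p₁ hp₁) fun h0 =>
      not_lexLT.2 (hl₂ p₁ hp₁ h0) hlt
    have t1 : 0 < s.out a p₂ p₁ := out_pos_of_segment_below s la₁p₁ lap₁ hlt
      (hS₁.1 a ha) n1.le (.inr n1) (out_self_right s _ _)
    have t2 : 0 < s.out p₁ b p₂ := out_pos_of_segment_below s lp₂b₂ hlt lp₂b
      n2.le (hS₂.2 b hb) (.inl n2) (out_self_left s _ _)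
    exact (out_pos_of_two_turns s lap₁ hlt lp₂b t1 t2).not_ge (hG p₁ hp₁)
  · rintro rfl
    by_contra! hpos
    have n1 : s.out a₁ p₁ b₂ < 0 := by
      have := out_rot s a₁ p₁ b₂
      have := out_rot s p₁ b₂ a₁
      have := out_swap s a₁ b₂ p₁
      linarith
    have n2 : s.out a₁ p₁ b < 0 := out_extend s la₁p₁ lp₂b₂ lp₂b n1 (hS₂.2 b hb)
    exact (out_pos_of_segment_below s la₁p₁ lap₁ lp₂b (hS₁.1 a ha) n2.le (.inr n2)
      (out_self_right s _ _)).not_ge (hG p₁ hp₁)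

/-- A vertex of a local hull that is no vertex of the global hull lies below an edge of the global
hull. If an endpoint of this edge belongs to the same node, then the edge is a bridge and the
vertex is marked because of it. Otherwise `bridges_under_edge` applies. -/
theorem marked_of_not_mem_hullChain (hs : (gather sub).Pairwise lexLT) {i : Fin n} {v : Pt}
    (hvi : v ∈ hullChain s (sub i)) (hv : v ∉ hullChain s (gather sub)) :
    v ∈ betweenMarks (sub i) (pairBridge s sub i) ∨
    v ∈ angleMarked (bridgedSide s sub i) s i := by
  have hlt := (gather_pairwise.1 hs).2
  have hUj : ∀ j, sub j ⊆ gather sub := fun j p hp => gather_mem.2 ⟨j, hp⟩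
  have hU : ∀ j, hullChain s (sub j) ⊆ gather sub := fun j p hp => hUj j (hullChain_subset _ _ hp)
  have hvs := hullChain_subset _ _ hvi
  have hh : ∀ i j, i < j → ∀ p ∈ hullChain s (sub i), ∀ q ∈ hullChain s (sub j), lexLT p q :=
    fun i j hij p hp q hq => hlt i j hij p (hullChain_subset _ _ hp) q (hullChain_subset _ _ hq)
  obtain ⟨a', ha', b', hb', hav', hvb', hv'⟩ : ∃ a ∈ gather sub, ∃ b ∈ gather sub,
      lexLT a v ∧ lexLT v b ∧ s.out a b v ≤ 0 := by
    by_contra! hcon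
    exact hv (mem_hullChain.2 ⟨hUj i hvs, hcon⟩)
  obtain ⟨a, b, hE, hav, hvb, hvab⟩ := exists_isEdge ha' hb' hav' hvb' hv'
  have hab := hav.trans hvb
  obtain ⟨k, hak⟩ := gather_mem.1 hE.1
  obtain ⟨m, hbm⟩ := gather_mem.1 hE.2.1
  have hak' := hE.left_mem hab (hUj k) hak
  have hbm' := hE.right_mem hab (hUj m) hbm
  have hki : k ≤ i := by
    by_contra! h
    exact (hlt i k h v hvs a hak).asymm hav
  have him : i ≤ m := by
    by_contra! h
    exact (hlt m i h b hbm v hvs).asymm hvb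
  have hbr : k < m → pairBridge s sub k m = some (a, b) := fun hkm => by
    rw [pairBridge, if_pos hkm]
    exact bridgeOf_eq (hh k m hkm) ⟨hak', hbm', ⟨fun p hp => (hE.2.2 p (hU _ hp)).1,
      fun p hp => (hE.2.2 p (hU _ hp)).1⟩, fun p hp h0 => ((hE.2.2 p (hU _ hp)).2 h0).1,
      fun p hp h0 => ((hE.2.2 p (hU _ hp)).2 h0).2⟩
  rcases hki.lt_or_eq with hki | rfl
  · rcases him.lt_or_eq with him | rfl
    · obtain ⟨a₁, p₁, e₁, hB₁⟩ := bridgeOf_isSome (hh k i hki) (List.ne_nil_of_mem hak')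
        (List.ne_nil_of_mem hvi)
      obtain ⟨p₂, b₂, e₂, hB₂⟩ := bridgeOf_isSome (hh i m him) (List.ne_nil_of_mem hvi)
        (List.ne_nil_of_mem hbm')
      have e₁' : pairBridge s sub i k = some (a₁, p₁) := by
        rw [pairBridge, if_neg hki.not_gt, if_pos hki, e₁]
      have e₂' : pairBridge s sub i m = some (p₂, b₂) := by
        rw [pairBridge, if_pos him, e₂]
      obtain ⟨hle, hangle⟩ := bridges_under_edge (hh k i hki) (hh i m him) hak' hbm'
        (fun p hp => (hE.2.2 p (hU _ hp)).1) hB₁ hB₂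
      have hun : ∀ q ∈ sub i, q ∉ betweenMarks (sub i) (pairBridge s sub i) →
          lexLE p₁ q ∧ lexLE q p₂ := by
        intro q hq hqm
        rw [← not_lexLT, ← not_lexLT]
        constructor <;> intro h <;> refine hqm ⟨hq, ?_⟩
        · exact ⟨k, a₁, p₁, e₁', hlt k i hki _ (hullChain_subset _ _ hB₁.1) _ hq, h⟩
        · exact ⟨m, p₂, b₂, e₂', h, hlt i m him _ hq _ (hullChain_subset _ _ hB₂.2.1)⟩
      by_cases hvm : v ∈ betweenMarks (sub i) (pairBridge s sub i)
      · exact .inl hvm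
      · right
        obtain ⟨h1, h2⟩ := hun v hvs hvm
        have e12 : p₁ = p₂ := (h1.trans h2).antisymm hle
        obtain rfl : v = p₁ := by
          rw [← e12] at h2
          exact h2.antisymm h1
        refine ⟨hvs, hvm, fun q hq hqm => ?_, k, m, hki, him, a₁, b₂, e₁', ?_, hangle e12⟩
        · obtain ⟨h3, h4⟩ := hun q hq hqm
          rw [← e12] at h4
          exact h4.antisymm h3
        · rw [e12]; exact e₂'
    · exact .inl ⟨hvs, k, a, b, by rw [pairBridge_comm]; exact hbr hki, hav, hvb⟩
  · rcases him.lt_or_eq with him | rfl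
    · exact .inl ⟨hvs, m, a, b, hbr him, hav, hvb⟩
    · exact absurd hvab ((mem_hullChain.1 hvi).2 a hak b hbm hav hvb).not_ge

open Classical in
/-- The vertices that node `i` keeps. -/
def pieceOf {n : ℕ} (s : Side) (sub : Fin n → List Pt) (i : Fin n) : List Pt :=
  (hullChain s (sub i)).filter fun v => decide (v ∉ betweenMarks (sub i) (pairBridge s sub i) ∪
    angleMarked (bridgedSide s sub i) s i)

/-- The vertices kept by the nodes are those of the hull of all subsequences together. -/
theorem gather_pieceOf (hs : (gather sub).Pairwise lexLT) :
    gather (pieceOf s sub) = hullChain s (gather sub) := by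
  classical
  conv_rhs => rw [hullChain, gather_filter]
  congr 1
  funext i
  rw [pieceOf, hullChain, List.filter_filter]
  refine List.filter_congr fun v hv => ?_
  have h1 : v ∈ hullChain s (sub i) ↔ ∀ a ∈ sub i, ∀ b ∈ sub i, lexLT a v → lexLT v b →
    0 < s.out a b v := by rw [mem_hullChain, and_iff_right hv]
  have hvU : v ∈ gather sub := gather_mem.2 ⟨i, hv⟩
  have h2 : v ∈ hullChain s (gather sub) ↔ ∀ a ∈ gather sub, ∀ b ∈ gather sub, lexLT a v →
    lexLT v b → 0 < s.out a b v := by rw [mem_hullChain, and_iff_right hvU]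
  rw [← Bool.decide_and, decide_eq_decide, ← h1, ← h2, Set.mem_union]
  constructor
  · rintro ⟨hm, hl⟩
    by_contra hv'
    exact hm (marked_of_not_mem_hullChain hs hl hv')
  · intro h
    have := not_marked_of_mem_hullChain hs hv h
    exact ⟨by tauto, hullChain_anti (fun p hp => gather_mem.2 ⟨i, hp⟩) hv h⟩

end Marking

/-! ### Splitting at the line through the extreme points -/

open Classical in
/-- The points inside of the segment between the extreme points do not matter for a hull: neither
are they vertices, nor are they needed to exclude a point, as no edge ends in them. -/
theorem hullChain_filter_outer (s : Side) {X : List Pt} {a₀ b₀ : Pt} (ha₀ : a₀ ∈ X) (hb₀ : b₀ ∈ X)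
    (hmin : ∀ p ∈ X, lexLE a₀ p) (hmax : ∀ p ∈ X, lexLE p b₀) :
    hullChain s (X.filter fun q => decide (0 ≤ s.out a₀ b₀ q)) = hullChain s X := by
  conv_lhs => rw [hullChain]
  conv_rhs => rw [hullChain]
  rw [List.filter_filter]
  refine List.filter_congr fun v hv => ?_
  rw [← Bool.decide_and, decide_eq_decide]
  constructor
  · rintro ⟨h, h0⟩ a ha b hb hav hvb
    by_contra! hle
    obtain ⟨c, d, hE, hcv, hvd, hcd⟩ := exists_isEdge ha hb hav hvb hle
    refine hcd.not_gt (h c ?_ d ?_ hcv hvd)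
    -- the extreme points lie on or below the edge, so its endpoints are not below their segment
    all_goals
      rw [List.mem_filter, decide_eq_true_eq]
    · refine ⟨hE.1, ?_⟩
      rcases lexLE_iff.1 (hmin c hE.1) with h1 | rfl
      · by_contra! h2
        exact (out_segment_neg s (hcv.trans hvd) h1 ((hcv.trans hvd).trans_le (hmax d hE.2.1))
          (hE.2.2 _ ha₀).1 (hE.2.2 _ hb₀).1 h2.le (.inr (.inr h2))).ne (out_self_left _ _ _)
      · rw [out_self_left]
    · refine ⟨hE.2.1, ?_⟩
      rcases lexLE_iff.1 (hmax d hE.2.1) with h1 | rfl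
      · by_contra! h2
        exact (out_segment_neg s (hcv.trans hvd) ((hmin c hE.1).trans_lt (hcv.trans hvd)) h1
          (hE.2.2 _ ha₀).1 (hE.2.2 _ hb₀).1 h2.le (.inr (.inr h2))).ne (out_self_right _ _ _)
      · rw [out_self_right]
  · intro h
    refine ⟨fun a ha b hb => h a (List.mem_of_mem_filter ha) b (List.mem_of_mem_filter hb), ?_⟩
    rcases lexLE_iff.1 (hmin v hv) with h1 | rfl
    · rcases lexLE_iff.1 (hmax v hv) with h2 | rfl
      · exact (h _ ha₀ _ hb₀ h1 h2).le
      · rw [out_self_right]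
    · rw [out_self_left]

/-! ### Convex hulls -/

/-- A point of `S` at which some linear functional is strictly larger than at the rest of `S` is a
vertex of the convex hull. -/
theorem mem_extremePoints_of_functional {S : Set Pt} {v : Pt} (hv : v ∈ S) (f : Pt →ₗ[ℝ] ℝ)
    (hf : ∀ p ∈ S, p ≠ v → f p < f v) : v ∈ Set.extremePoints ℝ (convexHull ℝ S) := by
  have hle : ∀ x ∈ convexHull ℝ S, f x ≤ f v ∧ (f x = f v → x = v) := by
    intro x hx
    by_cases hne : (S \ {v}).Nonempty
    · rw [← Set.insert_sdiff_self_of_mem hv, convexHull_insert hne] at hx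
      simp only [mem_convexJoin, Set.mem_singleton_iff, exists_eq_left] at hx
      obtain ⟨z, hz, hxz⟩ := hx
      have hfz : f z < f v := by
        have hsub : convexHull ℝ (S \ {v}) ⊆ {p | f p < f v} :=
          convexHull_min (fun p hp => hf p hp.1 hp.2) (convex_halfSpace_lt f.isLinear _)
        exact hsub hz
      obtain ⟨α, β, hα, hβ, hαβ, rfl⟩ := hxz
      simp only [map_add, map_smul, smul_eq_mul]
      obtain rfl : α = 1 - β := by linarith
      have := mul_nonneg hβ (sub_pos.2 hfz).le
      refine ⟨by nlinarith, fun h => ?_⟩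
      have : β * (f v - f z) = 0 := by nlinarith
      rcases mul_eq_zero.1 this with h | h
      · simp [h]
      · linarith
    · have : S = {v} := by
        rw [Set.not_nonempty_iff_eq_empty, Set.sdiff_eq_empty] at hne
        exact hne.antisymm (by simpa)
      rw [this, convexHull_singleton] at hx
      rw [Set.mem_singleton_iff.1 hx]
      simp
  rw [mem_extremePoints]
  refine ⟨subset_convexHull ℝ S hv, fun x hx y hy hxy => ?_⟩
  obtain ⟨h1, h1'⟩ := hle x hx
  obtain ⟨h2, h2'⟩ := hle y hy
  obtain ⟨α, β, hα, hβ, hαβ, h⟩ := hxy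
  have e : α * f x + β * f y = f v := by
    rw [← h]; simp
  obtain rfl : α = 1 - β := by linarith
  constructor
  · apply h1'; nlinarith
  · apply h2'; nlinarith

/-- The functional `p ↦ p.2 - t * (p.1 + ε * p.2)`, up to the sign for the lower side. -/
def slopeFunctional (s : Side) (ε t : ℝ) : Pt →ₗ[ℝ] ℝ :=
  (match s with | .upper => (1 : ℝ) | .lower => -1) • LinearMap.snd ℝ ℝ ℝ -
    t • (LinearMap.fst ℝ ℝ ℝ + ε • LinearMap.snd ℝ ℝ ℝ)

theorem out_eq_slope (s : Side) (ε t : ℝ) (a b v : Pt) : s.out a b v =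
    ((b.1 + ε * b.2) - (a.1 + ε * a.2)) * (slopeFunctional s ε t v - slopeFunctional s ε t a) -
    ((v.1 + ε * v.2) - (a.1 + ε * a.2)) * (slopeFunctional s ε t b - slopeFunctional s ε t a) := by
  cases s <;> simp [slopeFunctional, Side.out, orient] <;> ring

/-- The slopes of the segments that end in a vertex of a chain are larger than those of the segments
that start in it, and every slope in between gives a functional that is maximal in this vertex. -/
theorem hullChain_subset_extremePoints (s : Side) {X : List Pt} {v : Pt} (hv : v ∈ hullChain s X) :
    v ∈ Set.extremePoints ℝ (convexHull ℝ {p | p ∈ X}) := by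
  classical
  rw [mem_hullChain] at hv
  obtain ⟨hvX, hv⟩ := hv
  obtain ⟨ε, hε⟩ := exists_tilt (A := {p | p ∈ X}) X.finite_toSet
  set w : Pt → ℝ := fun p => p.1 + ε * p.2 with hw
  by_cases hl : ∃ a ∈ X, lexLT a v
  · by_cases hr : ∃ b ∈ X, lexLT v b
    · obtain ⟨a₁, ha₁, ha₁v⟩ := hl
      obtain ⟨b₁, hb₁, hvb₁⟩ := hr
      set f := slopeFunctional s ε 0
      obtain ⟨a, ha, hamin⟩ := (X.toFinset.filter (fun p => lexLT p v)).exists_min_image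
        (fun p => (f v - f p) / (w v - w p)) ⟨a₁, by simp [ha₁, ha₁v]⟩
      obtain ⟨b, hb, hbmax⟩ := (X.toFinset.filter (fun p => lexLT v p)).exists_max_image
        (fun p => (f p - f v) / (w p - w v)) ⟨b₁, by simp [hb₁, hvb₁]⟩
      simp only [Finset.mem_filter, List.mem_toFinset, and_imp] at ha hb hamin hbmax
      have wav : w a < w v := hε a ha.1 v hvX ha.2
      have wvb : w v < w b := hε v hvX b hb.1 hb.2
      have hlt : (f b - f v) / (w b - w v) < (f v - f a) / (w v - w a) := by
        rw [div_lt_div_iff₀ (by linarith) (by linarith)]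
        have := hv a ha.1 b hb.1 ha.2 hb.2
        rw [out_eq_slope s ε 0] at this
        change 0 < (w b - w a) * (f v - f a) - (w v - w a) * (f b - f a) at this
        linarith
      obtain ⟨t, ht1, ht2⟩ := exists_between hlt
      refine mem_extremePoints_of_functional hvX (slopeFunctional s ε t) fun p hp hpv => ?_
      have hf : ∀ q, slopeFunctional s ε t q = f q - t * w q := by
        intro q
        cases s <;> simp [f, slopeFunctional, hw] <;> ring
      rw [hf, hf]
      rcases lexLT_trichotomy p v with h | h | h
      · have h1 := ht2.trans_le (hamin p hp h)
        rw [lt_div_iff₀ (sub_pos.2 (hε p hp v hvX h))] at h1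
        change t * (w v - w p) < _ at h1
        linarith
      · exact absurd h hpv
      · have h1 := (hbmax p hp h).trans_lt ht1
        rw [div_lt_iff₀ (sub_pos.2 (hε v hvX p hp h))] at h1
        change _ < t * (w p - w v) at h1
        linarith
    · refine mem_extremePoints_of_functional hvX
        (LinearMap.fst ℝ ℝ ℝ + ε • LinearMap.snd ℝ ℝ ℝ) fun p hp hpv => ?_
      push Not at hr
      simp only [LinearMap.add_apply, LinearMap.smul_apply, LinearMap.fst_apply,
        LinearMap.snd_apply, smul_eq_mul]
      rcases lexLE_iff.1 (not_lexLT.1 (hr p hp)) with h | h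
      · exact hε p hp v hvX h
      · exact absurd h hpv
  · refine mem_extremePoints_of_functional hvX
      (-(LinearMap.fst ℝ ℝ ℝ + ε • LinearMap.snd ℝ ℝ ℝ)) fun p hp hpv => ?_
    push Not at hl
    simp only [LinearMap.neg_apply, LinearMap.add_apply, LinearMap.smul_apply,
      LinearMap.fst_apply, LinearMap.snd_apply, smul_eq_mul, neg_lt_neg_iff]
    rcases lexLE_iff.1 (not_lexLT.1 (hl p hp)) with h | h
    · exact hε v hvX p hp h
    · exact absurd h.symm hpv

/-- A point on or below one segment and on or above another lies on the vertical segment between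
points of the two. -/
theorem mem_convexHull_of_between {a b c d v : Pt} (hav : lexLT a v) (hvb : lexLT v b)
    (hcv : lexLT c v) (hvd : lexLT v d) (h1 : Side.upper.out a b v ≤ 0)
    (h2 : Side.lower.out c d v ≤ 0) : v ∈ convexHull ℝ {a, b, c, d} := by
  obtain ⟨ε, hε⟩ := exists_tilt (A := {a, b, c, d, v}) (Set.toFinite _)
  set w : Pt → ℝ := fun p => p.1 + ε * p.2 with hw
  have wav : w a < w v := hε a (by simp) v (by simp) hav
  have wvb : w v < w b := hε v (by simp) b (by simp) hvb
  have wcv : w c < w v := hε c (by simp) v (by simp) hcv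
  have wvd : w v < w d := hε v (by simp) d (by simp) hvd
  have key : ∀ {x y : Pt}, x ∈ ({a, b, c, d} : Set Pt) → y ∈ ({a, b, c, d} : Set Pt) →
      w x < w v → w v < w y → ∃ u ∈ convexHull ℝ ({a, b, c, d} : Set Pt),
        w u = w v ∧ orient x y v = (w y - w x) * (v.2 - u.2) := by
    intro x y hx hy hxv hvy
    have hne : w y - w x ≠ 0 := by linarith
    refine ⟨((w y - w v) / (w y - w x)) • x + ((w v - w x) / (w y - w x)) • y,
      convex_convexHull ℝ _ (subset_convexHull ℝ _ hx) (subset_convexHull ℝ _ hy)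
        (div_nonneg (by linarith) (by linarith)) (div_nonneg (by linarith) (by linarith))
        (by field_simp; ring), ?_, ?_⟩
    · simp only [hw, Prod.fst_add, Prod.smul_fst, Prod.snd_add, Prod.smul_snd, smul_eq_mul] at hne ⊢
      field_simp
      ring
    · have e : (w y - w x) * ((w y - w v) / (w y - w x) * x.2 + (w v - w x) / (w y - w x) * y.2) =
          (w y - w v) * x.2 + (w v - w x) * y.2 := by
        field_simp
      rw [Prod.snd_add, Prod.smul_snd, Prod.smul_snd, smul_eq_mul, smul_eq_mul, mul_sub, e]
      simp only [hw, orient]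
      ring
  obtain ⟨u, hu, hwu, eu⟩ := key (x := a) (y := b) (by simp) (by simp) wav wvb
  obtain ⟨z, hz, hwz, ez⟩ := key (x := c) (y := d) (by simp) (by simp) wcv wvd
  have hvu : v.2 ≤ u.2 := by
    simp only [Side.out] at h1
    rw [eu] at h1
    by_contra! h
    have := mul_pos (sub_pos.2 (wav.trans wvb)) (sub_pos.2 h)
    linarith
  have hzv : z.2 ≤ v.2 := by
    simp only [Side.out] at h2
    rw [ez] at h2
    by_contra! h
    have := mul_pos (sub_pos.2 (wcv.trans wvd)) (sub_pos.2 h)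
    linarith
  have hseg : v ∈ segment ℝ z u := by
    rcases (hzv.trans hvu).eq_or_lt with h | h
    · have e2 : v.2 = u.2 := le_antisymm hvu (h ▸ hzv)
      have : v = u := by
        refine Prod.ext ?_ e2
        have : u.1 + ε * u.2 = v.1 + ε * v.2 := hwu
        rw [e2] at this
        linarith
      rw [this]
      exact right_mem_segment ℝ z u
    · have hne : u.2 - z.2 ≠ 0 := by linarith
      refine ⟨(u.2 - v.2) / (u.2 - z.2), (v.2 - z.2) / (u.2 - z.2),
        div_nonneg (by linarith) (by linarith), div_nonneg (by linarith) (by linarith),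
        by field_simp; ring, Prod.ext ?_ ?_⟩
      · have e1 : u.1 = v.1 + ε * v.2 - ε * u.2 := by
          have : u.1 + ε * u.2 = v.1 + ε * v.2 := hwu
          linarith
        have e2 : z.1 = v.1 + ε * v.2 - ε * z.2 := by
          have : z.1 + ε * z.2 = v.1 + ε * v.2 := hwz
          linarith
        simp only [Prod.fst_add, Prod.smul_fst, smul_eq_mul, e1, e2]
        field_simp
        ring
      · simp only [Prod.snd_add, Prod.smul_snd, smul_eq_mul]
        field_simp
        ring
  exact (convex_convexHull ℝ _).segment_subset hz hu hseg

/-- A point that is neither an upper nor a lower vertex lies in the convex hull of four other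
points, by `mem_convexHull_of_between`. -/
theorem extremePoints_eq_hullChains (X : List Pt) :
    Set.extremePoints ℝ (convexHull ℝ {p | p ∈ X}) =
      {v | v ∈ hullChain .upper X ∨ v ∈ hullChain .lower X} := by
  refine Set.Subset.antisymm (fun v hv => ?_) ?_
  · have hvX : v ∈ X := extremePoints_convexHull_subset (A := {p | p ∈ X}) hv
    by_contra hcon
    simp only [Set.mem_ofPred_eq, mem_hullChain, hvX, true_and, not_or, not_forall, not_lt] at hcon
    obtain ⟨⟨a, ha, b, hb, hav, hvb, h1⟩, c, hc, d, hd, hcv, hvd, h2⟩ := hcon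
    have hmem := mem_convexHull_of_between hav hvb hcv hvd h1 h2
    rw [(convex_convexHull ℝ _).mem_extremePoints_iff_mem_sdiff_convexHull_sdiff] at hv
    refine hv.2 (convexHull_mono ?_ hmem)
    rintro p (rfl | rfl | rfl | rfl)
    · exact ⟨subset_convexHull ℝ _ ha, hav.ne⟩
    · exact ⟨subset_convexHull ℝ _ hb, hvb.ne.symm⟩
    · exact ⟨subset_convexHull ℝ _ hc, hcv.ne⟩
    · exact ⟨subset_convexHull ℝ _ hd, hvd.ne.symm⟩
  · rintro v (hv | hv) <;> exact hullChain_subset_extremePoints _ hv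

open Classical in
/-- The upper hull from left to right, then the lower hull from right to left without the extreme
points `a₀` and `b₀`. -/
def hullCycle (X : List Pt) (a₀ b₀ : Pt) : List Pt :=
  hullChain .upper X ++
    (hullChain .lower X).reverse.filter (fun v => decide (v ≠ a₀ ∧ v ≠ b₀))

theorem hullChain_pairwise {s : Side} {X : List Pt} {R : Pt → Pt → Prop} (h : X.Pairwise R) :
    (hullChain s X).Pairwise R := List.Pairwise.filter _ h

theorem triplewise_of_pairwise_lexLT {R : Pt → Pt → Pt → Prop} {L : List Pt}
    (h : L.Pairwise lexLT)
    (hR : ∀ a ∈ L, ∀ b ∈ L, ∀ c ∈ L, lexLT a b → lexLT b c → R a b c) : L.Triplewise R := by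
  rw [List.triplewise_iff_getElem]
  intro i j k hij hjk hk
  rw [List.pairwise_iff_getElem] at h
  exact hR _ (List.getElem_mem _) _ (List.getElem_mem _) _ (List.getElem_mem _)
    (h i j _ _ hij) (h j k _ _ hjk)

section Cycle

variable {X : List Pt} {a₀ b₀ : Pt}

theorem mem_hullChain_of_min (s : Side) (ha : a₀ ∈ X) (hmin : ∀ p ∈ X, lexLE a₀ p) :
    a₀ ∈ hullChain s X :=
  mem_hullChain.2 ⟨ha, fun a ha _ _ h => absurd h (not_lexLT.2 (hmin a ha))⟩

theorem mem_hullChain_of_max (s : Side) (hb : b₀ ∈ X) (hmax : ∀ p ∈ X, lexLE p b₀) :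
    b₀ ∈ hullChain s X :=
  mem_hullChain.2 ⟨hb, fun _ _ b hb _ h => absurd h (not_lexLT.2 (hmax b hb))⟩

theorem mem_hullCycle (ha : a₀ ∈ X) (hb : b₀ ∈ X) (hmin : ∀ p ∈ X, lexLE a₀ p)
    (hmax : ∀ p ∈ X, lexLE p b₀) {v : Pt} :
    v ∈ hullCycle X a₀ b₀ ↔ v ∈ hullChain .upper X ∨ v ∈ hullChain .lower X := by
  simp only [hullCycle, List.mem_append, List.mem_filter, List.mem_reverse, decide_eq_true_eq]
  constructor
  · tauto
  · rintro (h | h)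
    · exact .inl h
    · by_cases h1 : v = a₀
      · exact .inl (h1 ▸ mem_hullChain_of_min _ ha hmin)
      · by_cases h2 : v = b₀
        · exact .inl (h2 ▸ mem_hullChain_of_max _ hb hmax)
        · exact .inr ⟨h, h1, h2⟩

/-- The vertices of a hull lie strictly outside of the segment between the extreme points, apart from
these themselves. -/
theorem out_extreme_nonneg (ha : a₀ ∈ X) (hb : b₀ ∈ X) (hmin : ∀ p ∈ X, lexLE a₀ p)
    (hmax : ∀ p ∈ X, lexLE p b₀) {s : Side} {v : Pt} (hv : v ∈ hullChain s X) :
    0 ≤ s.out a₀ b₀ v ∧ (v ≠ a₀ → v ≠ b₀ → 0 < s.out a₀ b₀ v ∧ lexLT a₀ v ∧ lexLT v b₀) := by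
  rw [mem_hullChain] at hv
  rcases lexLE_iff.1 (hmin v hv.1) with h1 | rfl
  · rcases lexLE_iff.1 (hmax v hv.1) with h2 | rfl
    · have := hv.2 a₀ ha b₀ hb h1 h2
      exact ⟨this.le, fun _ _ => ⟨this, h1, h2⟩⟩
    · exact ⟨(out_self_right _ _ _).ge, fun _ h => absurd rfl h⟩
  · exact ⟨(out_self_left _ _ _).ge, fun h => absurd rfl h⟩

/-- The line through two vertices of a chain passes on or above the extreme points. -/
theorem out_min_max_nonpos (ha : a₀ ∈ X) (hb : b₀ ∈ X) (hmin : ∀ p ∈ X, lexLE a₀ p)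
    (hmax : ∀ p ∈ X, lexLE p b₀) {s : Side} {u v : Pt} (hu : u ∈ hullChain s X)
    (hv : v ∈ hullChain s X) (huv : lexLT u v) :
    s.out u v a₀ ≤ 0 ∧ (u ≠ a₀ → s.out u v a₀ < 0) ∧ s.out u v b₀ ≤ 0 ∧
      (v ≠ b₀ → s.out u v b₀ < 0) := by
  have e1 : u ≠ a₀ → s.out u v a₀ < 0 := by
    intro h
    rcases lexLE_iff.1 (hmin u (hullChain_subset _ _ hu)) with h1 | h1
    · have := (mem_hullChain.1 hu).2 a₀ ha v (hullChain_subset _ _ hv) h1 huv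
      rw [← out_rot, ← out_rot, out_swap, out_rot] at this
      have := out_swap s a₀ v u
      have := out_rot s a₀ v u
      have := out_rot s u v a₀
      have := out_rot s v u a₀
      have := out_swap s u v a₀
      linarith
    · exact absurd h1.symm h
  have e2 : v ≠ b₀ → s.out u v b₀ < 0 := by
    intro h
    rcases lexLE_iff.1 (hmax v (hullChain_subset _ _ hv)) with h1 | h1
    · have := (mem_hullChain.1 hv).2 u (hullChain_subset _ _ hu) b₀ hb huv h1
      have := out_rot s u b₀ v
      have := out_rot s b₀ v u
      have := out_swap s u v b₀
      linarith
    · exact absurd h1 h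
  refine ⟨?_, e1, ?_, e2⟩
  · by_cases h : u = a₀
    · rw [h, out_self_left]
    · exact (e1 h).le
  · by_cases h : v = b₀
    · rw [h, out_self_right]
    · exact (e2 h).le

theorem hullCycle_nodup (hX : X.Pairwise lexLT) (ha : a₀ ∈ X) (hb : b₀ ∈ X)
    (hmin : ∀ p ∈ X, lexLE a₀ p) (hmax : ∀ p ∈ X, lexLE p b₀) : (hullCycle X a₀ b₀).Nodup := by
  have hnd : X.Nodup := hX.imp lexLT.ne
  rw [hullCycle, List.nodup_append]
  refine ⟨hnd.filter _, (List.nodup_reverse.2 (hnd.filter _)).filter _, ?_⟩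
  rintro u hu v hv rfl
  simp only [List.mem_filter, List.mem_reverse, decide_eq_true_eq] at hv
  have h1 := ((out_extreme_nonneg ha hb hmin hmax hu).2 hv.2.1 hv.2.2).1
  have h2 := ((out_extreme_nonneg ha hb hmin hmax hv.1).2 hv.2.1 hv.2.2).1
  simp only [Side.out] at h1 h2
  linarith

theorem hullCycle_isClockwise (hX : X.Pairwise lexLT) (ha : a₀ ∈ X) (hb : b₀ ∈ X)
    (hmin : ∀ p ∈ X, lexLE a₀ p) (hmax : ∀ p ∈ X, lexLE p b₀) :
    IsClockwise (hullCycle X a₀ b₀) := by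
  have hno : ∀ a b c, orient a c b = - orient a b c := fun a b c => by
    simp only [orient]; ring
  have hrot : ∀ a b c, orient a b c = orient b c a := fun a b c => by
    simp only [orient]; ring
  rw [IsClockwise, hullCycle, List.triplewise_append]
  refine ⟨?_, ?_, fun u hu => ?_, fun v hv => ?_⟩
  · refine triplewise_of_pairwise_lexLT (hullChain_pairwise hX) fun a ha b hb c hc hab hbc => ?_
    have := (mem_hullChain.1 hb).2 a (hullChain_subset _ _ ha) c (hullChain_subset _ _ hc) hab hbc
    simp only [Side.out] at this
    linarith [hno a b c]
  · rw [List.filter_reverse, List.triplewise_reverse]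
    refine triplewise_of_pairwise_lexLT ((hullChain_pairwise hX).filter _)
      fun a ha b hb c hc hab hbc => ?_
    rw [List.mem_filter] at ha hb hc
    have := (mem_hullChain.1 hb.1).2 a (hullChain_subset _ _ ha.1) c (hullChain_subset _ _ hc.1)
      hab hbc
    simp only [Side.out] at this
    linarith [hrot a c b]
  · -- one upper and two lower vertices
    rw [List.filter_reverse, List.pairwise_reverse]
    refine ((hullChain_pairwise hX).filter _).imp_of_mem fun {c d} hc hd hcd => ?_
    simp only [List.mem_filter, decide_eq_true_eq] at hc hd
    obtain ⟨h1, h1', h2, h2'⟩ := out_min_max_nonpos ha hb hmin hmax hc.1 hd.1 hcd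
    have h3 := (out_extreme_nonneg ha hb hmin hmax hu).1
    replace h1' := h1' hc.2.1
    replace h2' := h2' hd.2.2
    have : Side.lower.out c d u < 0 := by
      rcases lexLE_iff.1 (hmin u (hullChain_subset _ _ hu)) with h4 | rfl
      · rcases lexLE_iff.1 (hmax u (hullChain_subset _ _ hu)) with h5 | rfl
        · refine out_segment_neg _ hcd h4 h5 h1 h2 ?_ (.inl h1')
          simp only [Side.out] at h3 ⊢
          linarith
        · exact h2'
      · exact h1'
    simp only [Side.out] at this
    linarith [hrot u d c, hno d c u, hno c d u, hrot c d u, hrot d c u, hno c u d]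
  · -- two upper vertices and a lower one
    simp only [List.mem_filter, List.mem_reverse, decide_eq_true_eq] at hv
    refine (hullChain_pairwise hX).imp_of_mem fun {c d} hc hd hcd => ?_
    obtain ⟨h1, -, h2, -⟩ := out_min_max_nonpos ha hb hmin hmax hc hd hcd
    obtain ⟨h3, h4, h5⟩ := (out_extreme_nonneg ha hb hmin hmax hv.1).2 hv.2.1 hv.2.2
    have h6 : Side.upper.out a₀ b₀ v < 0 := by
      simp only [Side.out] at h3 ⊢
      linarith
    exact out_segment_neg _ hcd h4 h5 h1 h2 h6.le (.inr (.inr h6))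

end Cycle

/-! ### Batches -/

theorem chunk_length_le {n : ℕ} (L : List Pt) (i : Fin n) : (chunk L i).length ≤ n := by
  simp [chunk]

theorem chunk_getElem? {n : ℕ} (L : List Pt) (i : Fin n) (k : ℕ) :
    (chunk L i)[k]? = if k < n then L[i * n + k]? else none := by
  simp [chunk, List.getElem?_take, List.getElem?_drop]

theorem flatten_take_drop {α : Type*} (n m : ℕ) (L : List α) :
    (List.ofFn fun i : Fin m => (L.drop (i * n)).take n).flatten = L.take (m * n) := by
  induction m with
  | zero => simp
  | succ m ih =>
    rw [List.ofFn_succ_last]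
    simp only [List.flatten_append, Fin.val_castSucc, ih, List.flatten_cons, List.flatten_nil,
      List.append_nil, Fin.val_last]
    rw [Nat.succ_mul, List.take_add]

theorem gather_chunk {n : ℕ} {L : List Pt} (h : L.length ≤ n * n) :
    gather (chunk (n := n) L) = L := by
  rw [gather, show (chunk (n := n) L) = fun i : Fin n => (L.drop (i * n)).take n from rfl,
    flatten_take_drop, List.take_of_length_le h]

theorem holdsConvexHull_hullCycle {n : ℕ} {S : Set Pt} {X : List Pt} {a₀ b₀ : Pt}
    (hS : {p | p ∈ X} = S) (hlen : X.length ≤ n * n) (hX : X.Pairwise lexLT) (ha : a₀ ∈ X)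
    (hb : b₀ ∈ X) (hmin : ∀ p ∈ X, lexLE a₀ p) (hmax : ∀ p ∈ X, lexLE p b₀) :
    HoldsConvexHull S (chunk (n := n) (hullCycle X a₀ b₀)) := by
  have hnd := hullCycle_nodup hX ha hb hmin hmax
  refine ⟨hullCycle X a₀ b₀, hnd, ?_, hullCycle_isClockwise hX ha hb hmin hmax, ?_, fun i => rfl⟩
  · rw [← hS, extremePoints_eq_hullChains]
    ext v
    exact mem_hullCycle ha hb hmin hmax
  · refine gather_chunk (le_trans ?_ hlen)
    refine (List.subperm_of_subset hnd fun v hv => ?_).length_le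
    rcases (mem_hullCycle ha hb hmin hmax).1 hv with h | h <;> exact hullChain_subset _ _ h

/-! ### Sorted inputs -/

section Sorted

variable {n : ℕ}

/-- The sorted list of all input points. -/
def sortedPts (S : Fin n → Fin n → Pt) : List Pt := sortPts (gather fun j => List.ofFn (S j))

/-- The batch of node `i` after sorting. -/
def batchOf (S : Fin n → Fin n → Pt) (i : Fin n) : List Pt := chunk (sortedPts S) i

open Classical in
/-- The part of the batch of node `i` on the side `s` of the line through the extreme points. -/
def subOf (S : Fin n → Fin n → Pt) (s : Side) (i : Fin n) : List Pt :=
  (batchOf S i).filter fun q => decide (∀ a ∈ (sortedPts S).head?,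
    ∀ b ∈ (sortedPts S).getLast?, 0 ≤ s.out a b q)

theorem sortPts_perm (L : List Pt) : (sortPts L).Perm L := List.mergeSort_perm _ _

theorem sortPts_pairwise (L : List Pt) : (sortPts L).Pairwise lexLE := by
  have := List.pairwise_mergeSort (le := fun p q => @decide (lexLE p q) (Classical.propDecidable _))
    (fun a b c => by simp only [decide_eq_true_eq]; exact lexLE.trans)
    (fun a b => by simpa using lexLE_total a b) L
  simpa [sortPts] using this

theorem head?_eq_of_min {L : List Pt} (h : L.Pairwise lexLE) {a : Pt} (ha : a ∈ L)
    (hmin : ∀ p ∈ L, lexLE a p) : L.head? = some a := by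
  cases L with
  | nil => cases ha
  | cons x L =>
    rw [List.head?_cons, Option.some_inj]
    rcases List.mem_cons.1 ha with rfl | ha
    · rfl
    · exact ((List.pairwise_cons.1 h).1 a ha).antisymm (hmin x List.mem_cons_self)

theorem getLast?_eq_of_max {L : List Pt} (h : L.Pairwise lexLE) {a : Pt} (ha : a ∈ L)
    (hmax : ∀ p ∈ L, lexLE p a) : L.getLast? = some a := by
  rw [← List.head?_reverse]
  have h : L.reverse.Pairwise (fun p q => lexLE q p) := List.pairwise_reverse.2 h
  rw [← List.mem_reverse] at ha
  replace hmax : ∀ p ∈ L.reverse, lexLE p a := fun p hp => hmax p (List.mem_reverse.1 hp)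
  cases hL : L.reverse with
  | nil => rw [hL] at ha; cases ha
  | cons x K =>
    rw [hL] at h ha hmax
    rw [List.head?_cons, Option.some_inj]
    rcases List.mem_cons.1 ha with rfl | ha
    · rfl
    · exact (hmax x List.mem_cons_self).antisymm ((List.pairwise_cons.1 h).1 a ha)

theorem gather_length {n m : ℕ} {f : Fin n → List Pt} (h : ∀ i, (f i).length = m) :
    (gather f).length = n * m := by
  simp [gather, List.length_flatten, List.map_ofFn, Function.comp_def, h]

variable {S : Fin n → Fin n → Pt}

theorem sortedPts_length (S : Fin n → Fin n → Pt) : (sortedPts S).length = n * n := by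
  rw [sortedPts, (sortPts_perm _).length_eq, gather_length (m := n)]
  simp

theorem mem_sortedPts {p : Pt} : p ∈ sortedPts S ↔ p ∈ pointSet S := by
  rw [sortedPts, (sortPts_perm _).mem_iff, gather_mem]
  simp [List.mem_ofFn, pointSet]

theorem sortedPts_pairwise (hS : DistinctPoints S) : (sortedPts S).Pairwise lexLT := by
  have hnd : (sortedPts S).Nodup := by
    rw [sortedPts, (sortPts_perm _).nodup_iff, List.Nodup, gather_pairwise]
    constructor
    · intro i
      rw [← List.Nodup, List.nodup_ofFn]
      intro j k h
      have := @hS (i, j) (i, k) h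
      simpa using this
    · intro i j hij p hp q hq
      rw [List.mem_ofFn] at hp hq
      obtain ⟨k, rfl⟩ := hp
      obtain ⟨l, rfl⟩ := hq
      intro h
      have := @hS (i, k) (j, l) h
      simp only [Prod.mk.injEq] at this
      exact hij.ne this.1
  refine (hnd.and (sortPts_pairwise _)).imp fun {p q} ⟨h1, h2⟩ => ?_
  rcases lexLE_iff.1 h2 with h | h
  · exact h
  · exact absurd h h1

theorem gather_batchOf (S : Fin n → Fin n → Pt) : gather (batchOf S) = sortedPts S :=
  gather_chunk (sortedPts_length S).le

/-- The first and the last point of the input. -/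
theorem exists_extreme (hn : 2 ≤ n) (S : Fin n → Fin n → Pt) : ∃ a₀ b₀,
    (sortedPts S).head? = some a₀ ∧ (sortedPts S).getLast? = some b₀ ∧ a₀ ∈ sortedPts S ∧
    b₀ ∈ sortedPts S ∧ (∀ p ∈ sortedPts S, lexLE a₀ p) ∧ (∀ p ∈ sortedPts S, lexLE p b₀) := by
  have hne : sortedPts S ≠ [] := by
    rw [← List.length_pos_iff, sortedPts_length]
    positivity
  have hpw : (sortedPts S).Pairwise lexLE := sortPts_pairwise _
  have : Std.Refl lexLE := ⟨lexLE_refl⟩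
  refine ⟨_, _, List.head?_eq_some_head hne, List.getLast?_eq_some_getLast hne,
    List.head_mem hne, List.getLast_mem hne, fun p hp => hpw.rel_head hp,
    fun p hp => hpw.rel_getLast hp⟩

theorem subOf_eq {s : Side} {a₀ b₀ : Pt} (ha : (sortedPts S).head? = some a₀)
    (hb : (sortedPts S).getLast? = some b₀) (i : Fin n) : subOf S s i =
    (batchOf S i).filter fun q => @decide (0 ≤ s.out a₀ b₀ q) (Classical.propDecidable _) := by
  simp [subOf, ha, hb]

theorem gather_subOf {s : Side} {a₀ b₀ : Pt} (ha : (sortedPts S).head? = some a₀)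
    (hb : (sortedPts S).getLast? = some b₀) : gather (subOf S s) =
    (sortedPts S).filter fun q => @decide (0 ≤ s.out a₀ b₀ q) (Classical.propDecidable _) := by
  rw [← gather_batchOf, gather_filter]
  congr 1
  funext i
  exact subOf_eq ha hb i

theorem gather_subOf_pairwise (hS : DistinctPoints S) (s : Side) :
    (gather (subOf S s)).Pairwise lexLT := by
  have h := sortedPts_pairwise hS
  rw [← gather_batchOf] at h
  rw [gather_pairwise] at h ⊢
  exact ⟨fun i => (h.1 i).filter _, fun i j hij p hp q hq =>
    h.2 i j hij p (List.mem_of_mem_filter hp) q (List.mem_of_mem_filter hq)⟩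

theorem gather_pieceOf_subOf (hn : 2 ≤ n) (hS : DistinctPoints S) (s : Side) :
    gather (pieceOf s (subOf S s)) = hullChain s (sortedPts S) := by
  obtain ⟨a₀, b₀, ha, hb, ha', hb', hmin, hmax⟩ := exists_extreme hn S
  rw [gather_pieceOf (gather_subOf_pairwise hS s), gather_subOf ha hb,
    hullChain_filter_outer s ha' hb' hmin hmax]

theorem batchOf_length (S : Fin n → Fin n → Pt) (i : Fin n) : (batchOf S i).length = n := by
  have : i * n + n ≤ n * n := by
    have : (i + 1) * n ≤ n * n := Nat.mul_le_mul_right n i.2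
    linarith
  simp only [batchOf, chunk, List.length_take, List.length_drop, sortedPts_length]
  omega

/-- The extreme points of the input are found among the extreme points of the batches. -/
theorem allEnds_eq (hn : 2 ≤ n) {m : Mem n}
    (hm : ∀ j, m.ends j = ((batchOf S j).head?, (batchOf S j).getLast?)) :
    m.allEnds.head? = (sortedPts S).head? ∧ m.allEnds.getLast? = (sortedPts S).getLast? := by
  obtain ⟨a₀, b₀, ha, hb, ha', hb', hmin, hmax⟩ := exists_extreme hn S
  have hsub : ∀ p ∈ m.allEnds, p ∈ sortedPts S := by
    intro p hp
    rw [Mem.allEnds, (sortPts_perm _).mem_iff, gather_mem] at hp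
    obtain ⟨j, hj⟩ := hp
    rw [← gather_batchOf, gather_mem]
    refine ⟨j, ?_⟩
    simp only [hm, List.mem_append, Option.mem_toList] at hj
    rcases hj with hj | hj
    · exact List.mem_of_mem_head? hj
    · exact List.mem_of_mem_getLast? hj
  rw [ha, hb]
  constructor
  · refine head?_eq_of_min (sortPts_pairwise _) ?_ fun p hp => hmin p (hsub p hp)
    rw [(sortPts_perm _).mem_iff, gather_mem]
    refine ⟨⟨0, by omega⟩, ?_⟩
    rw [hm, List.mem_append, Option.mem_toList]
    left
    simp [batchOf, chunk, List.head?_take, ha]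
    omega
  · refine getLast?_eq_of_max (sortPts_pairwise _) ?_ fun p hp => hmax p (hsub p hp)
    rw [(sortPts_perm _).mem_iff, gather_mem]
    refine ⟨⟨n - 1, by omega⟩, ?_⟩
    rw [hm, List.mem_append, Option.mem_toList, Option.mem_toList]
    right
    have h1 : (n - 1) * n + n = n * n := by
      rw [← Nat.succ_mul]; congr 1; omega
    have h2 : ¬ n * n ≤ (n - 1) * n := by omega
    simp only [batchOf, chunk]
    rw [List.take_of_length_le (by rw [List.length_drop, sortedPts_length]; omega),
      List.getLast?_drop, sortedPts_length, if_neg h2, hb]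

end Sorted

/-! ### Halving fragments -/

theorem medianPt_eq {F : List Pt} (h : F ≠ []) :
    F[F.length / 2]? = some (medianPt F) := by
  have : F.length / 2 < F.length := by
    have := List.length_pos_iff.2 h; omega
  rw [medianPt, List.getD_eq_getElem _ _ this, List.getElem?_eq_getElem this]

theorem mem_dropLeft {F : List Pt} (hF : F.Pairwise lexLT) {a : Pt} (ha : a ∈ F)
    (h : lexLT (medianPt F) a) : a ∈ dropLeft F := by
  obtain ⟨i, hi, rfl⟩ := List.getElem_of_mem ha
  have hm : F.length / 2 < F.length := by omega
  rw [medianPt, List.getD_eq_getElem _ _ hm] at h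
  rw [dropLeft, List.mem_drop_iff_getElem]
  have : F.length / 2 ≤ i := by
    by_contra! hlt
    exact (List.pairwise_iff_getElem.1 hF i _ _ _ hlt).asymm h
  exact ⟨i - F.length / 2, by omega, by congr 1; omega⟩

theorem mem_dropRight {F : List Pt} (hF : F.Pairwise lexLT) {a : Pt} (ha : a ∈ F)
    (h : ¬ lexLT (medianPt F) a) : a ∈ dropRight F := by
  obtain ⟨i, hi, rfl⟩ := List.getElem_of_mem ha
  have hm : F.length / 2 < F.length := by omega
  rw [medianPt, List.getD_eq_getElem _ _ hm] at h
  rw [dropRight, List.mem_take_iff_getElem]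
  have : i ≤ F.length / 2 := by
    by_contra! hlt
    exact h (List.pairwise_iff_getElem.1 hF _ i _ _ hlt)
  exact ⟨i, by omega, rfl⟩

theorem dropLeft_sublist (F : List Pt) : List.Sublist (dropLeft F) F := List.drop_sublist _ _

theorem dropRight_sublist (F : List Pt) : List.Sublist (dropRight F) F := List.take_sublist _ _

theorem size_half (x : ℕ) : Nat.size (x / 2) = Nat.size x - 1 := by
  rcases Nat.eq_zero_or_pos x with rfl | hx
  · simp
  · refine le_antisymm ?_ ?_
    · rw [Nat.size_le]
      have h : x < 2 ^ (Nat.size x - 1 + 1) := by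
        have := Nat.size_pos.2 hx
        rw [Nat.sub_add_cancel this]
        exact Nat.lt_size_self x
      rw [pow_succ] at h
      omega
    · have h : Nat.size x ≤ Nat.size (x / 2) + 1 := by
        rw [Nat.size_le, pow_succ]
        have := Nat.lt_size_self (x / 2)
        omega
      omega

/-- The number of halvings that a fragment admits before it has at most two vertices. -/
def halvings (F : List Pt) : ℕ := Nat.size (F.length - 2)

theorem halvings_half {F F' : List Pt} (h : F' = dropLeft F ∨ F' = dropRight F) :
    halvings F' ≤ halvings F - 1 := by
  rw [halvings, halvings, ← size_half]
  apply Nat.size_le_size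
  rcases h with rfl | rfl
  · simp only [dropLeft, List.length_drop]; omega
  · simp only [dropRight, List.length_take]; omega

theorem halvings_pos {F : List Pt} (h : 3 ≤ F.length) : 0 < halvings F := by
  rw [halvings, Nat.size_pos]; omega

open Classical in
/-- The half of the fragment `F` that contains the endpoint of the bridge of `H` and `G` on `H`. -/
def nextFrag (s : Side) (H G F : List Pt) : List Pt :=
  if ∃ z ∈ bridgeOf s H G, lexLT (medianPt F) z.1 then dropLeft F else dropRight F

theorem nextFrag_half (s : Side) (H G F : List Pt) :
    nextFrag s H G F = dropLeft F ∨ nextFrag s H G F = dropRight F := by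
  unfold nextFrag
  split <;> simp

theorem nextFrag_sublist (s : Side) (H G F : List Pt) : List.Sublist (nextFrag s H G F) F := by
  rcases nextFrag_half s H G F with h | h <;> rw [h]
  · exact dropLeft_sublist F
  · exact dropRight_sublist F

theorem mem_nextFrag {s : Side} {H G F : List Pt} {a b : Pt} (hz : bridgeOf s H G = some (a, b))
    (hF : F.Pairwise lexLT) (ha : a ∈ F) : a ∈ nextFrag s H G F := by
  unfold nextFrag
  split_ifs with h
  · obtain ⟨z, hz', h⟩ := h
    rw [hz] at hz'
    obtain rfl := Option.some.inj hz'
    exact mem_dropLeft hF ha h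
  · exact mem_dropRight hF ha fun h' => h ⟨_, hz, h'⟩

/-- The recursion of `Bridge` ends with the fragments `F` and `G`. -/
def Stops (s : Side) (F G : List Pt) : Prop :=
  F.length ≤ 2 ∨ G.length ≤ 2 ∨ Supports s F G (medianPt F) (medianPt G)

/-! ### Invariants of the runs -/

section Runs

variable {n : ℕ}

theorem setSide_same (m : Mem n) (s : Side) (x : SideMem n) : (m.setSide s x).side s = x := by
  simp [Mem.setSide]

theorem setSide_other (m : Mem n) {s t : Side} (x : SideMem n) (h : t ≠ s) :
    (m.setSide s x).side t = m.side t := by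
  simp [Mem.setSide, h]

variable (S : Fin n → Fin n → Pt)

/-- The batches are sorted, and the extreme points and the subsequences are known. -/
structure IsSplit (M : Fin n → Mem n) : Prop where
  pmin : ∀ i, (M i).pmin = (sortedPts S).head?
  pmax : ∀ i, (M i).pmax = (sortedPts S).getLast?
  sub : ∀ i s, ((M i).side s).sub = subOf S s i

/-- Nothing has been marked or found on the side `s`. -/
def IsFresh (s : Side) (M : Fin n → Mem n) : Prop :=
  ∀ i, ((M i).side s).marked = ∅ ∧ ((M i).side s).bridge = fun _ => none

/-- Every node has the right piece of the hull of the side `s`. -/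
def IsKept (s : Side) (M : Fin n → Mem n) : Prop :=
  ∀ i, ((M i).side s).piece = pieceOf s (subOf S s) i

/-- The state of the other side while the side `s` is being worked on: the upper hull comes first. -/
def OtherSide : Side → (Fin n → Mem n) → Prop
  | .upper, M => IsFresh .lower M
  | .lower, M => IsKept S .upper M

/-- The invariant of the calls of `Bridge` after `j` levels. The fragments of an active call contain
the endpoints of the bridge of the whole local hulls, and every level has halved one of them. -/
structure CallsInv (s : Side) (j : ℕ) (M : Fin n → Mem n) : Prop where
  hull : ∀ i, ((M i).side s).hull = hullChain s (subOf S s i)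
  bridge : ∀ l m, ((M l).side s).bridge m = none ∨
    ((M l).side s).bridge m = pairBridge s (subOf S s) l m
  bridge_comm : ∀ l m, ((M l).side s).bridge m = ((M m).side s).bridge l
  frag : ∀ l m, l < m → ActiveCall s M l m → ∃ a b,
    pairBridge s (subOf S s) l m = some (a, b) ∧
    a ∈ ((M l).side s).frag m ∧ b ∈ ((M m).side s).frag l ∧
    List.Sublist (((M l).side s).frag m) (hullChain s (subOf S s l)) ∧
    List.Sublist (((M m).side s).frag l) (hullChain s (subOf S s m)) ∧
    halvings (((M l).side s).frag m) + halvings (((M m).side s).frag l) + j ≤ 2 * Nat.size n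
  marked : ∀ i, ((M i).side s).marked = betweenMarks (subOf S s i) ((M i).side s).bridge

/-- All bridges have been found. -/
structure IsBridged (s : Side) (M : Fin n → Mem n) : Prop where
  hull : ∀ i, ((M i).side s).hull = hullChain s (subOf S s i)
  bridge : ∀ i, ((M i).side s).bridge = pairBridge s (subOf S s) i
  marked : ∀ i, ((M i).side s).marked = betweenMarks (subOf S s i) (pairBridge s (subOf S s) i)

/-- All points that do not qualify have been marked. -/
structure IsMarked (s : Side) (M : Fin n → Mem n) : Prop where
  hull : ∀ i, ((M i).side s).hull = hullChain s (subOf S s i)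
  marked : ∀ i, ((M i).side s).marked =
    betweenMarks (subOf S s i) (pairBridge s (subOf S s) i) ∪
      angleMarked (bridgedSide s (subOf S s) i) s i

/-- The number of steps after which the work on a side begins at the latest. -/
def sideStart (n : ℕ) : Side → ℕ
  | .upper => 4
  | .lower => 9 + 2 * Nat.size n

/-- What holds after `k` steps of a run that has reached the given stage. -/
def RunInv (k : ℕ) : Stage → (Fin n → Mem n) → Prop
  | .sort, M => k = 0 ∧ M = (Config.initial S).mem
  | .sendEnds, M => k ≤ 1 ∧ (∀ i, (M i).batch = batchOf S i) ∧ ∀ s, IsFresh s M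
  | .split, M => k ≤ 2 ∧ (∀ i, (M i).batch = batchOf S i) ∧
      (∀ i j, (M i).ends j = ((batchOf S j).head?, (batchOf S j).getLast?)) ∧ ∀ s, IsFresh s M
  | .sendSubEnds, M => k ≤ 3 ∧ IsSplit S M ∧ ∀ s, IsFresh s M
  | .localHull s, M => k ≤ sideStart n s ∧ IsSplit S M ∧ IsFresh s M ∧ OtherSide S s M
  | .bridges s, M => IsSplit S M ∧ OtherSide S s M ∧ ∃ j, k ≤ sideStart n s + 1 + j ∧
      j ≤ 2 * Nat.size n + 1 ∧ CallsInv S s j M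
  | .angles s, M => k ≤ sideStart n s + 3 + 2 * Nat.size n ∧ IsSplit S M ∧ OtherSide S s M ∧
      IsBridged S s M
  | .prune s, M => k ≤ sideStart n s + 4 + 2 * Nat.size n ∧ IsSplit S M ∧ OtherSide S s M ∧
      IsMarked S s M
  | .collect, M => k ≤ 14 + 4 * Nat.size n ∧ IsSplit S M ∧ ∀ s, IsKept S s M
  | .done, M => k ≤ 15 + 4 * Nat.size n ∧ ∀ a₀ b₀, (sortedPts S).head? = some a₀ →
      (sortedPts S).getLast? = some b₀ → ∀ i, (M i).output = chunk (hullCycle (sortedPts S) a₀ b₀) i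

variable {S}

theorem IsSplit.setSide {M : Fin n → Mem n} (h : IsSplit S M) (s : Side) (x : Fin n → SideMem n)
    (hx : ∀ i, (x i).sub = ((M i).side s).sub) : IsSplit S (fun i => (M i).setSide s (x i)) where
  pmin := h.pmin
  pmax := h.pmax
  sub i t := by
    by_cases ht : t = s
    · subst ht
      rw [setSide_same, hx, h.sub]
    · rw [setSide_other _ _ ht, h.sub]

theorem OtherSide.setSide {s : Side} {M : Fin n → Mem n} (h : OtherSide S s M)
    (x : Fin n → SideMem n) : OtherSide S s (fun i => (M i).setSide s (x i)) := by
  cases s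
  · intro i
    simpa only [setSide_other _ _ (show Side.lower ≠ Side.upper by simp)] using h i
  · intro i
    simpa only [setSide_other _ _ (show Side.upper ≠ Side.lower by simp)] using h i

theorem hull_lt {S : Fin n → Fin n → Pt} (hS : DistinctPoints S) (s : Side) {l m : Fin n}
    (hlm : l < m) :
    ∀ p ∈ hullChain s (subOf S s l), ∀ q ∈ hullChain s (subOf S s m), lexLT p q :=
  fun p hp q hq => (gather_pairwise.1 (gather_subOf_pairwise hS s)).2 l m hlm
    p (hullChain_subset _ _ hp) q (hullChain_subset _ _ hq)

theorem hull_pairwise {S : Fin n → Fin n → Pt} (hS : DistinctPoints S) (s : Side) (i : Fin n) :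
    (hullChain s (subOf S s i)).Pairwise lexLT :=
  hullChain_pairwise ((gather_pairwise.1 (gather_subOf_pairwise hS s)).1 i)

theorem hull_length_le (S : Fin n → Fin n → Pt) (s : Side) (i : Fin n) :
    (hullChain s (subOf S s i)).length ≤ n :=
  (List.length_filter_le _ _).trans
    ((List.length_filter_le _ _).trans (batchOf_length S i).le)

theorem callsInv_start (hS : DistinctPoints S) {s : Side} {M : Fin n → Mem n} (h : IsSplit S M)
    (hf : IsFresh s M) : CallsInv S s 0 (fun i => (M i).setSide s { (M i).side s with
      hull := hullChain s ((M i).side s).sub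
      frag := fun _ => hullChain s ((M i).side s).sub }) where
  hull i := by rw [setSide_same, h.sub]
  bridge l m := by rw [setSide_same, (hf l).2]; exact .inl rfl
  bridge_comm l m := by simp only [setSide_same, (hf _).2]
  frag l m hlm hact := by
    simp only [ActiveCall, setSide_same, h.sub] at hact ⊢
    obtain ⟨a, b, e, hB⟩ := bridgeOf_isSome (hull_lt hS s hlm) hact.1 hact.2.1
    refine ⟨a, b, ?_, hB.1, hB.2.1, List.Sublist.refl _, List.Sublist.refl _, ?_⟩
    · rw [pairBridge, if_pos hlm, e]
    · have h1 := Nat.size_le_size ((Nat.sub_le _ 2).trans (hull_length_le S s l))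
      have h2 := Nat.size_le_size ((Nat.sub_le _ 2).trans (hull_length_le S s m))
      simp only [halvings]
      omega
  marked i := by simp only [setSide_same, (hf _), betweenMarks]; simp

/-- One level of the calls keeps the invariant: every active call either finds the bridge of the
local hulls, as the bridge of the fragments is unique, or it prunes a fragment. -/
theorem CallsInv.level (hS : DistinctPoints S) {s : Side} {j : ℕ} {M : Fin n → Mem n}
    (hI : CallsInv S s j M) (hsub : ∀ i, ((M i).side s).sub = subOf S s i)
    {F : Fin n → Fin n → List Pt} {R : Fin n → Fin n → Option (Pt × Pt)}
    (h1 : ∀ l m, l < m → ActiveCall s M l m →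
        BridgeStep s (((M l).side s).frag m) (((M m).side s).frag l) (F l m) (F m l) (R l m))
    (h2 : ∀ l m, l < m → ¬ ActiveCall s M l m → F l m = ((M l).side s).frag m ∧
        F m l = ((M m).side s).frag l ∧ R l m = ((M l).side s).bridge m)
    (h3 : ∀ l m, R m l = R l m)
    (h4 : ∀ l, F l l = ((M l).side s).frag l ∧ R l l = ((M l).side s).bridge l) :
    CallsInv S s (j + 1) (fun i => (M i).setSide s { (M i).side s with
            frag := F i
            bridge := R i
            marked := markBelow ((M i).side s) (R i) }) := by
  have hold : ∀ l m, ((M l).side s).bridge m ≠ none → R l m = ((M l).side s).bridge m := by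
    intro l m h
    rcases lt_trichotomy l m with hlm | rfl | hlm
    · exact (h2 l m hlm fun hact => h hact.2.2).2.2
    · exact (h4 l).2
    · rw [hI.bridge_comm] at h ⊢
      rw [h3]
      exact (h2 m l hlm fun hact => h hact.2.2).2.2
  have hfound : ∀ l m, l < m → ActiveCall s M l m → ∀ a b,
      IsBridge s (((M l).side s).frag m) (((M m).side s).frag l) a b →
      pairBridge s (subOf S s) l m = some (a, b) := by
    intro l m hlm hact a b hab
    obtain ⟨a', b', e, ha', hb', hl, hr, -⟩ := hI.frag l m hlm hact
    have e' := e
    rw [pairBridge, if_pos hlm] at e'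
    obtain ⟨rfl, rfl⟩ := hab.unique
      (fun p hp q hq => hull_lt hS s hlm p (hl.subset hp) q (hr.subset hq))
      ((bridgeOf_some e').mono hl.subset hr.subset ha' hb')
    exact e
  have hres : ∀ l m, l < m → R l m = none ∨ R l m = pairBridge s (subOf S s) l m := by
    intro l m hlm
    by_cases hact : ActiveCall s M l m
    · have hst := h1 l m hlm hact
      generalize R l m = r at hst ⊢
      generalize F l m = F' at hst
      generalize F m l = G' at hst
      cases hst with
      | small a b _ hab => exact .inr (hfound l m hlm hact a b hab).symm
      | median a b _ _ _ hab => exact .inr (hfound l m hlm hact a b hab).symm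
      | prune => exact .inl rfl
    · rw [(h2 l m hlm hact).2.2]
      exact hI.bridge l m
  constructor
  · intro i
    rw [setSide_same]
    exact hI.hull i
  · intro l m
    simp only [setSide_same]
    rcases lt_trichotomy l m with hlm | rfl | hlm
    · exact hres l m hlm
    · rw [(h4 l).2]
      exact hI.bridge l l
    · rw [← h3, pairBridge_comm]
      exact hres m l hlm
  · intro l m
    simp only [setSide_same]
    exact h3 m l
  · intro l m hlm hact
    simp only [ActiveCall, setSide_same] at hact ⊢
    have hact' : ActiveCall s M l m := by
      refine ⟨hact.1, hact.2.1, ?_⟩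
      by_contra hne
      rw [hold l m hne] at hact
      exact hne hact.2.2
    obtain ⟨a, b, e, ha, hb, hl, hr, hj⟩ := hI.frag l m hlm hact'
    have hst := h1 l m hlm hact'
    rw [hact.2.2] at hst
    have e' := e
    rw [pairBridge, if_pos hlm] at e'
    have hB := (bridgeOf_some e').mono hl.subset hr.subset ha hb
    generalize F l m = F' at hst
    generalize F m l = G' at hst
    cases hst with
    | prune _ _ hF3 hG3 _ hF' hkeep =>
      obtain ⟨ha', hb'⟩ := hkeep a b hB
      have hFpos := halvings_pos hF3
      have hGpos := halvings_pos hG3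
      refine ⟨a, b, e, ha', hb', ?_⟩
      rcases hF' with ⟨hF', rfl⟩ | ⟨rfl, hG'⟩
      · have := halvings_half hF'
        refine ⟨?_, hr, by omega⟩
        rcases hF' with rfl | rfl
        · exact (dropLeft_sublist _).trans hl
        · exact (dropRight_sublist _).trans hl
      · have := halvings_half hG'
        refine ⟨hl, ?_, by omega⟩
        rcases hG' with rfl | rfl
        · exact (dropLeft_sublist _).trans hr
        · exact (dropRight_sublist _).trans hr
  · intro i
    simp only [setSide_same, markBelow, hI.marked, hsub]
    ext v
    simp only [betweenMarks, Set.mem_union, Set.mem_ofPred_eq]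
    constructor
    · rintro (⟨hv, m, a, b, h, hav⟩ | h)
      · exact ⟨hv, m, a, b, by rw [hold i m (by rw [h]; simp), h], hav⟩
      · exact h
    · exact .inr

theorem CallsInv.isBridged {s : Side} {j : ℕ} {M : Fin n → Mem n}
    (hI : CallsInv S s j M) (h : ∀ l m, l < m → ¬ ActiveCall s M l m) : IsBridged S s M := by
  have hlt : ∀ l m, l < m → ((M l).side s).bridge m = pairBridge s (subOf S s) l m := by
    intro l m hlm
    rcases hI.bridge l m with h0 | h0
    · have := h l m hlm
      simp only [ActiveCall, hI.hull, h0, and_true] at this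
      rw [h0, pairBridge, if_pos hlm, bridgeOf_none (by tauto)]
    · exact h0
  have hb : ∀ i, ((M i).side s).bridge = pairBridge s (subOf S s) i := by
    intro i
    funext m
    rcases lt_trichotomy i m with him | rfl | him
    · exact hlt i m him
    · rcases hI.bridge i i with h0 | h0
      · rw [h0]; simp [pairBridge]
      · exact h0
    · rw [hI.bridge_comm, pairBridge_comm]
      exact hlt m i him
  exact ⟨hI.hull, hb, fun i => by rw [hI.marked, hb]⟩

theorem RunInv.step (hn : 2 ≤ n) (hS : DistinctPoints S) {k : ℕ} {st : Stage}
    {M : Fin n → Mem n} {d : Config n} (h : RunInv S k st M) (hst : Step ⟨st, M⟩ d) :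
    RunInv S (k + 1) d.stage d.mem := by
  cases hst with
  | sort =>
    obtain ⟨rfl, rfl⟩ := h
    exact ⟨le_rfl, fun i => rfl, fun s i => ⟨rfl, rfl⟩⟩
  | sendEnds =>
    obtain ⟨hk, hb, hf⟩ := h
    exact ⟨by omega, hb, fun i j => by simp only [hb], hf⟩
  | split =>
    obtain ⟨hk, hb, he, hf⟩ := h
    have hmm := fun i => allEnds_eq hn (he i)
    refine ⟨by omega, ⟨fun i => (hmm i).1, fun i => (hmm i).2, fun i s => ?_⟩, hf⟩
    change (M i).splitBatch (M i).allEnds.head? (M i).allEnds.getLast? s = subOf S s i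
    rw [(hmm i).1, (hmm i).2, Mem.splitBatch, hb, subOf]
  | sendSubEnds =>
    obtain ⟨hk, hs, hf⟩ := h
    exact ⟨by simp [sideStart]; omega, ⟨hs.pmin, hs.pmax, hs.sub⟩, hf .upper, hf .lower⟩
  | localHull s =>
    obtain ⟨hk, hs, hf, ho⟩ := h
    exact ⟨hs.setSide s _ fun _ => rfl, ho.setSide _, 0, by omega, by omega,
      callsInv_start hS hs hf⟩
  | bridgeLevel s _ F R hact h1 h2 h3 h4 =>
    obtain ⟨hs, ho, j, hk, hj, hI⟩ := h
    refine ⟨hs.setSide s _ fun _ => rfl, ho.setSide _, j + 1, by omega, ?_,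
      hI.level hS (fun i => hs.sub i s) h1 h2 h3 h4⟩
    obtain ⟨l, m, hlm, hact⟩ := hact
    obtain ⟨_, _, _, _, _, _, _, hle⟩ := hI.frag l m hlm hact
    omega
  | bridgesDone s _ hdone =>
    obtain ⟨hs, ho, j, hk, hj, hI⟩ := h
    exact ⟨by omega, hs, ho, hI.isBridged hdone⟩
  | angles s =>
    obtain ⟨hk, hs, ho, hb⟩ := h
    refine ⟨by omega, hs.setSide s _ fun _ => rfl, ho.setSide _, fun i => ?_, fun i => ?_⟩
    · rw [setSide_same]
      exact hb.hull i
    · simp only [setSide_same, hb.marked]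
      congr 1
      simp only [angleMarked, hs.sub, hb.marked, hb.bridge, bridgedSide]
  | prune s =>
    obtain ⟨hk, hs, ho, hm⟩ := h
    have hkept : IsKept S s (fun i => (M i).setSide s { (M i).side s with
        piece := unmarkedHull ((M i).side s) }) := by
      intro i
      simp only [setSide_same, unmarkedHull, hm.hull, pieceOf]
      refine List.filter_congr fun v _ => ?_
      rw [decide_eq_decide, hm.marked]
    have ho' := ho.setSide (fun i => { (M i).side s with piece := unmarkedHull ((M i).side s) })
    have hs' := hs.setSide s (fun i => { (M i).side s with
      piece := unmarkedHull ((M i).side s) }) fun _ => rfl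
    cases s with
    | upper => exact ⟨by simp only [sideStart] at hk ⊢; omega, hs', ho', hkept⟩
    | lower =>
      refine ⟨by simp only [sideStart] at hk; omega, hs', fun t => ?_⟩
      cases t
      · exact ho'
      · exact hkept
  | collect =>
    obtain ⟨hk, hs, hkept⟩ := h
    refine ⟨by omega, fun a₀ b₀ ha hb i => ?_⟩
    simp only [hs.pmin, hs.pmax, hullSequence, ha, hb]
    congr 1
    rw [show (fun j => ((M j).side .upper).piece) = pieceOf .upper (subOf S .upper) from
        funext (hkept .upper), show (fun j => ((M j).side .lower).piece) =
        pieceOf .lower (subOf S .lower) from funext (hkept .lower),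
      gather_pieceOf_subOf hn hS, gather_pieceOf_subOf hn hS, hullCycle]
    congr 1
    refine List.filter_congr fun v _ => ?_
    rw [decide_eq_decide]
    simp only [Option.mem_def, Option.some.injEq, ne_eq, eq_comm (a := v)]

theorem IsRun.inv (hn : 2 ≤ n) (hS : DistinctPoints S) {K : ℕ} {c : ℕ → Config n}
    (h : IsRun S K c) : ∀ k ≤ K, RunInv S k (c k).stage (c k).mem := by
  intro k hk
  induction k with
  | zero => rw [h.1]; exact ⟨rfl, rfl⟩
  | succ k ih => exact (ih (by omega)).step hn hS (h.2 k (by omega))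

theorem RunInv.le {k : ℕ} {st : Stage} {M : Fin n → Mem n} (h : RunInv S k st M) :
    k ≤ 15 + 4 * Nat.size n := by
  cases st with
  | sort => have := h.1; omega
  | sendEnds => have := h.1; omega
  | split => have := h.1; omega
  | sendSubEnds => have := h.1; omega
  | localHull s =>
    have := h.1
    cases s <;> simp only [sideStart] at this <;> omega
  | bridges s =>
    obtain ⟨-, -, j, hk, hj, -⟩ := h
    cases s <;> simp only [sideStart] at hk <;> omega
  | angles s =>
    have := h.1
    cases s <;> simp only [sideStart] at this <;> omega
  | prune s =>
    have := h.1
    cases s <;> simp only [sideStart] at this <;> omega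
  | collect => have := h.1; omega
  | done => have := h.1; omega

theorem RunInv.holdsConvexHull (hn : 2 ≤ n) (hS : DistinctPoints S) {k : ℕ} {M : Fin n → Mem n}
    (h : RunInv S k .done M) : HoldsConvexHull (pointSet S) fun i => (M i).output := by
  obtain ⟨a₀, b₀, ha, hb, ha', hb', hmin, hmax⟩ := exists_extreme hn S
  have := holdsConvexHull_hullCycle (n := n) (S := pointSet S) (X := sortedPts S)
    (by ext p; exact mem_sortedPts) (sortedPts_length S).le (sortedPts_pairwise hS) ha' hb'
    hmin hmax
  rwa [show (fun i => (M i).output) = chunk (hullCycle (sortedPts S) a₀ b₀) from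
    funext (h.2 a₀ b₀ ha hb)]

/-! ### Progress -/

/-- A step that, if it is a level of the calls of `Bridge`, works on the left fragment of each
active call: the call ends if it may, and otherwise the fragment is halved. -/
def CanonicalStep (c d : Config n) : Prop :=
  Step c d ∧ ∀ s, c.stage = .bridges s → d.stage = .bridges s → ∀ l m, l < m →
    ActiveCall s c.mem l m →
    ((d.mem m).side s).frag l = ((c.mem m).side s).frag l ∧
    (Stops s (((c.mem l).side s).frag m) (((c.mem m).side s).frag l) →
      ((d.mem l).side s).frag m = ((c.mem l).side s).frag m ∧
      ((d.mem l).side s).bridge m =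
        bridgeOf s ((c.mem l).side s).hull ((c.mem m).side s).hull) ∧
    (¬ Stops s (((c.mem l).side s).frag m) (((c.mem m).side s).frag l) →
      ((d.mem l).side s).frag m = nextFrag s ((c.mem l).side s).hull ((c.mem m).side s).hull
        (((c.mem l).side s).frag m) ∧
      ((d.mem l).side s).bridge m = none)

open Classical in
theorem CallsInv.exists_level (hS : DistinctPoints S) {s : Side} {j : ℕ} {M : Fin n → Mem n}
    (hI : CallsInv S s j M) (hact : ∃ l m, l < m ∧ ActiveCall s M l m) :
    ∃ d, CanonicalStep ⟨.bridges s, M⟩ d := by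
  set F : Fin n → Fin n → List Pt := fun l m =>
    if l < m ∧ ActiveCall s M l m ∧ ¬ Stops s (((M l).side s).frag m) (((M m).side s).frag l) then
      nextFrag s ((M l).side s).hull ((M m).side s).hull (((M l).side s).frag m)
    else ((M l).side s).frag m with hF
  set R₀ : Fin n → Fin n → Option (Pt × Pt) := fun l m =>
    if ActiveCall s M l m ∧ Stops s (((M l).side s).frag m) (((M m).side s).frag l) then
      bridgeOf s ((M l).side s).hull ((M m).side s).hull
    else ((M l).side s).bridge m with hR₀
  set R : Fin n → Fin n → Option (Pt × Pt) := fun l m =>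
    if l < m then R₀ l m else if m < l then R₀ m l else ((M l).side s).bridge m with hR
  refine ⟨_, Step.bridgeLevel s M F R hact ?_ ?_ ?_ ?_, ?_⟩
  · intro l m hlm ha
    obtain ⟨a, b, e, hal, hbm, hl, hr, -⟩ := hI.frag l m hlm ha
    rw [pairBridge, if_pos hlm] at e
    have hB := bridgeOf_some e
    have hB' := hB.mono hl.subset hr.subset hal hbm
    have hFG : ∀ p ∈ ((M l).side s).frag m, ∀ q ∈ ((M m).side s).frag l, lexLT p q :=
      fun p hp q hq => hull_lt hS s hlm p (hl.subset hp) q (hr.subset hq)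
    have eG : F m l = ((M m).side s).frag l := by simp [hF, hlm.not_gt]
    by_cases hst : Stops s (((M l).side s).frag m) (((M m).side s).frag l)
    · have e1 : F l m = ((M l).side s).frag m := by simp [hF, hst]
      have e2 : R l m = some (a, b) := by simp [hR, hR₀, hlm, hst, ha, hI.hull, e]
      rw [eG, e1, e2]
      by_cases hsm : (((M l).side s).frag m).length ≤ 2 ∨ (((M m).side s).frag l).length ≤ 2
      · exact .small a b hsm hB'
      · refine .median a b (by omega) (by omega) ?_ hB'
        rcases hst with h | h | h
        · exact absurd (.inl h) hsm
        · exact absurd (.inr h) hsm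
        · exact h
    · have e1 : F l m = nextFrag s ((M l).side s).hull ((M m).side s).hull
          (((M l).side s).frag m) := by simp [hF, hst, hlm, ha]
      have e2 : R l m = none := by simp [hR, hR₀, hlm, hst, ha.2.2]
      rw [eG, e1, e2]
      simp only [Stops, not_or, not_le] at hst
      refine .prune _ _ hst.1 hst.2.1 hst.2.2 (.inl ⟨nextFrag_half _ _ _ _, rfl⟩) ?_
      intro a' b' h'
      obtain ⟨rfl, rfl⟩ := hB'.unique hFG h'
      refine ⟨?_, hbm⟩
      rw [hI.hull, hI.hull]
      exact mem_nextFrag e ((hull_pairwise hS s l).sublist hl) hal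
  · intro l m hlm ha
    simp [hF, hR, hR₀, ha, hlm, hlm.not_gt]
  · intro l m
    rcases lt_trichotomy l m with h | rfl | h
    · simp [hR, h, h.not_gt]
    · rfl
    · simp [hR, h, h.not_gt]
  · intro l
    simp [hF, hR]
  · intro t ht _ l m hlm ha
    obtain rfl : s = t := by simpa using ht
    simp only [setSide_same] at ha ⊢
    exact ⟨by simp [hF, hlm.not_gt], fun hst => ⟨by simp [hF, hst],
      by simp [hR, hR₀, hlm, hst, ha]⟩, fun hst => ⟨by simp [hF, hst, hlm, ha],
      by simp [hR, hR₀, hlm, hst, ha.2.2]⟩⟩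

theorem CanonicalStep.of_ne {c d : Config n} (h : Step c d)
    (hne : ∀ s, c.stage ≠ .bridges s ∨ d.stage ≠ .bridges s) : CanonicalStep c d :=
  ⟨h, fun s h1 h2 => absurd h2 ((hne s).resolve_left (not_not_intro h1))⟩

/-- A run can be continued until it is done: an active call always admits a level, as one of the two
halves of the left fragment contains the endpoint of the bridge. -/
theorem RunInv.exists_step (hS : DistinctPoints S) {k : ℕ} {c : Config n}
    (h : RunInv S k c.stage c.mem) (hne : c.stage ≠ .done) : ∃ d, CanonicalStep c d := by
  obtain ⟨st, M⟩ := c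
  replace h : RunInv S k st M := h
  cases st with
  | sort => exact ⟨_, .of_ne (.sort M) (by simp)⟩
  | sendEnds => exact ⟨_, .of_ne (.sendEnds M) (by simp)⟩
  | split => exact ⟨_, .of_ne (.split M) (by simp)⟩
  | sendSubEnds => exact ⟨_, .of_ne (.sendSubEnds M) (by simp)⟩
  | localHull s => exact ⟨_, .of_ne (.localHull s M) (by simp)⟩
  | bridges s =>
    obtain ⟨-, -, j, -, -, hI⟩ := h
    by_cases hact : ∃ l m, l < m ∧ ActiveCall s M l m
    · exact hI.exists_level hS hact
    · push Not at hact
      exact ⟨_, .of_ne (.bridgesDone s M hact) (by simp)⟩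
  | angles s => exact ⟨_, .of_ne (.angles s M) (by simp)⟩
  | prune s => exact ⟨_, .of_ne (.prune s M) (by simp)⟩
  | collect => exact ⟨_, .of_ne (.collect M) (by simp)⟩
  | done => exact absurd rfl hne

end Runs

/-! ### Knowledge of the nodes -/

section Knowledge

variable {Ω : Type} {n b : ℕ}

/-- `f` has the same value in any two worlds that are related by `K`. If `K` relates the worlds that
a node cannot distinguish, this means that the node can compute `f`. -/
def Knows {α : Type} (K : Ω → Ω → Prop) (f : Ω → α) : Prop := ∀ x y, K x y → f x = f y

theorem Knows.comp {α β : Type} {K : Ω → Ω → Prop} {f : Ω → α} (h : Knows K f) (g : α → β) :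
    Knows K fun ω => g (f ω) := fun x y hxy => congrArg g (h x y hxy)

theorem Knows.comp₂ {α β γ : Type} {K : Ω → Ω → Prop} {f : Ω → α} {f' : Ω → β} (h : Knows K f)
    (h' : Knows K f') (g : α → β → γ) : Knows K fun ω => g (f ω) (f' ω) := fun x y hxy => by
  simp only [h x y hxy, h' x y hxy]

theorem Knows.pi {ι α : Type} {K : Ω → Ω → Prop} {f : ι → Ω → α} (h : ∀ j, Knows K (f j)) :
    Knows K fun ω j => f j ω := fun x y hxy => funext fun j => h j x y hxy

theorem knows_const {α : Type} (K : Ω → Ω → Prop) (a : α) : Knows K fun _ => a :=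
  fun _ _ _ => rfl

/-- `Reach b r K K'`: if node `i` initially cannot distinguish exactly the worlds related by `K i`,
then this is so for `K' i` after some `r` rounds with `b`-bit messages. In every round, a node may
send any message that it can compute. -/
inductive Reach (b : ℕ) (K : Fin n → Ω → Ω → Prop) : ℕ → (Fin n → Ω → Ω → Prop) → Prop
  | refl : Reach b K 0 K
  | round {r : ℕ} {K' : Fin n → Ω → Ω → Prop} (h : Reach b K r K')
      (m : Fin n → Fin n → Ω → BitVec b) (hm : ∀ i j, Knows (K' i) (m i j)) :
      Reach b K (r + 1) fun i x y => K' i x y ∧ ∀ j, m j i x = m j i y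

theorem Reach.trans {K K' K'' : Fin n → Ω → Ω → Prop} {r r' : ℕ} (h : Reach b K r K')
    (h' : Reach b K' r' K'') : Reach b K (r + r') K'' := by
  induction h' with
  | refl => exact h
  | round _ m hm ih => exact ih.round m hm

theorem Reach.le {K K' : Fin n → Ω → Ω → Prop} {r : ℕ} (h : Reach b K r K') {i : Fin n} {x y : Ω}
    (hxy : K' i x y) : K i x y := by
  induction h with
  | refl => exact hxy
  | round _ m hm ih => exact ih hxy.1

theorem Reach.knows {K K' : Fin n → Ω → Ω → Prop} {r : ℕ} (h : Reach b K r K') {i : Fin n}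
    {α : Type} {f : Ω → α} (hf : Knows (K i) f) : Knows (K' i) f := fun x y hxy =>
  hf x y (h.le hxy)

/-- The values of `f` are taken from a set of `N` elements. -/
def Fits {α : Type} (N : ℕ) (f : Ω → α) : Prop := ∃ A : Finset α, A.card ≤ N ∧ ∀ ω, f ω ∈ A

theorem Fits.mono {α : Type} {f : Ω → α} {N N' : ℕ} (h : Fits N f) (hN : N ≤ N') : Fits N' f := by
  obtain ⟨A, hA, hf⟩ := h
  exact ⟨A, hA.trans hN, hf⟩

theorem Fits.prodMk {α β : Type} {f : Ω → α} {g : Ω → β} {N N' : ℕ} (h : Fits N f)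
    (h' : Fits N' g) : Fits (N * N') fun ω => (f ω, g ω) := by
  obtain ⟨A, hA, hf⟩ := h
  obtain ⟨B, hB, hg⟩ := h'
  exact ⟨A ×ˢ B, by rw [Finset.card_product]; exact Nat.mul_le_mul hA hB, fun ω => by
    simp [hf, hg]⟩

theorem fits_prop (f : Ω → Prop) : Fits 2 f := by
  classical
  refine ⟨{True, False}, Finset.card_le_two, fun ω => ?_⟩
  by_cases h : f ω <;> simp [h]

theorem fits_nat {f : Ω → ℕ} {N : ℕ} (h : ∀ ω, f ω < N) : Fits N f :=
  ⟨Finset.range N, by simp, fun ω => by simp [h]⟩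

theorem fits_option {α : Type} {f : Ω → Option α} {U : Finset α}
    (h : ∀ ω, ∀ a ∈ f ω, a ∈ U) : Fits (U.card + 1) f :=
  ⟨U.insertNone, by simp, fun ω => Finset.mem_insertNone.2 (h ω)⟩

/-- In one round every node can send every node something that it knows and that has at most `2 ^ b`
possible values. -/
theorem exchange {α : Type} {K : Fin n → Ω → Ω → Prop} (m : Fin n → Fin n → Ω → α)
    (hk : ∀ i j, Knows (K i) (m i j)) (hf : ∀ i j, Fits (2 ^ b) (m i j)) :
    ∃ K', Reach b K 1 K' ∧ ∀ i j, Knows (K' i) (m j i) := by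
  have henc : ∀ i j, ∃ e : α → BitVec b, ∀ x y, e (m i j x) = e (m i j y) → m i j x = m i j y := by
    intro i j
    obtain ⟨A, hA, hm⟩ := hf i j
    classical
    obtain ⟨e⟩ := Function.Embedding.nonempty_of_card_le (α := A) (β := Fin (2 ^ b)) (by simpa)
    refine ⟨fun a => if h : a ∈ A then BitVec.ofFin (e ⟨a, h⟩) else 0, fun x y h => ?_⟩
    dsimp only at h
    rw [dif_pos (hm x), dif_pos (hm y), BitVec.ofFin.injEq] at h
    simpa using e.injective h
  choose e he using henc
  refine ⟨_, Reach.refl.round (fun i j ω => e i j (m i j ω)) fun i j => (hk i j).comp _, ?_⟩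
  intro i j x y hxy
  exact he j i x y (hxy.2 j)

/-- In one round every node can tell all others one and the same thing. -/
theorem announce {α : Type} {K : Fin n → Ω → Ω → Prop} (m : Fin n → Ω → α)
    (hk : ∀ i, Knows (K i) (m i)) (hf : ∀ i, Fits (2 ^ b) (m i)) :
    ∃ K', Reach b K 1 K' ∧ ∀ i j, Knows (K' i) (m j) :=
  exchange (fun i _ => m i) (fun i _ => hk i) (fun i _ => hf i)

/-- Iteration of a procedure that takes `r` rounds. -/
theorem Reach.iterate {r : ℕ} (P : ℕ → (Fin n → Ω → Ω → Prop) → Prop)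
    (hP : ∀ j K, P j K → ∃ K', Reach b K r K' ∧ P (j + 1) K') {K : Fin n → Ω → Ω → Prop}
    (h0 : P 0 K) (j : ℕ) : ∃ K', Reach b K (r * j) K' ∧ P j K' := by
  induction j with
  | zero => exact ⟨K, .refl, h0⟩
  | succ j ih =>
    obtain ⟨K', h1, h2⟩ := ih
    obtain ⟨K'', h3, h4⟩ := hP j K' h2
    exact ⟨K'', h1.trans h3, h4⟩

end Knowledge

/-! ### Protocols from knowledge -/

section Protocol

variable {Ω : Type} {n b : ℕ} {In Out : Type}

/-- The worlds that node `i` cannot distinguish from `x` after `t` rounds with the messages `m`. -/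
def viewAfter (inp : Ω → Fin n → In) (m : ℕ → Fin n → Fin n → Ω → BitVec b) (t : ℕ) (i : Fin n)
    (x y : Ω) : Prop :=
  inp x i = inp y i ∧ ∀ s < t, ∀ j, m s j i x = m s j i y

/-- The messages of all rounds. After the last round, when nothing more is said, they are zero. -/
theorem Reach.exists_messages {inp : Ω → Fin n → In} {K : Fin n → Ω → Ω → Prop} {T : ℕ}
    (h : Reach b (fun i x y => inp x i = inp y i) T K) :
    ∃ m : ℕ → Fin n → Fin n → Ω → BitVec b,
      (∀ t i j, Knows (viewAfter inp m t i) (m t i j)) ∧ K = viewAfter inp m T := by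
  suffices H : ∃ m : ℕ → Fin n → Fin n → Ω → BitVec b,
      (∀ t, ∀ i j, Knows (viewAfter inp m t i) (m t i j)) ∧ K = viewAfter inp m T ∧
      ∀ t, T ≤ t → m t = fun _ _ _ => 0 by
    obtain ⟨m, h1, h2, -⟩ := H
    exact ⟨m, h1, h2⟩
  induction h with
  | refl =>
    refine ⟨fun _ _ _ _ => 0, fun t i j => knows_const _ _, ?_, fun _ _ => rfl⟩
    funext i x y
    simp [viewAfter]
  | @round r K' _ m' hm' ih =>
    obtain ⟨m, h1, rfl, h3⟩ := ih
    have heq : ∀ s < r, Function.update m r m' s = m s := fun s hs =>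
      Function.update_of_ne hs.ne _ _
    have hview : ∀ t ≤ r, viewAfter inp (Function.update m r m') t = viewAfter inp m t := by
      intro t ht
      funext i x y
      simp only [viewAfter, eq_iff_iff]
      refine and_congr_right fun _ => forall₂_congr fun s hs => ?_
      rw [heq s (by omega)]
    refine ⟨Function.update m r m', fun t i j => ?_, ?_, fun t ht => ?_⟩
    · rcases lt_trichotomy t r with ht | rfl | ht
      · rw [hview t ht.le, heq t ht]
        exact h1 t i j
      · rw [hview t le_rfl, Function.update_self]
        exact hm' i j
      · rw [Function.update_of_ne ht.ne', h3 t ht.le]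
        exact knows_const _ _
    · funext i x y
      simp only [eq_iff_iff]
      rw [← hview r le_rfl]
      simp only [viewAfter, and_assoc]
      refine and_congr_right fun _ => ?_
      constructor
      · rintro ⟨h, h'⟩ s hs j
        rcases (Nat.lt_succ_iff_lt_or_eq.1 hs) with hs | rfl
        · exact h s hs j
        · rw [Function.update_self]; exact h' j
      · intro h
        refine ⟨fun s hs => h s (by omega), fun j => ?_⟩
        have := h r (by omega) j
        rwa [Function.update_self] at this
    · rw [Function.update_of_ne (by omega), h3 t (by omega)]

open Classical in
/-- The protocol in which the state of a node consists of the time and of the set of the worlds that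
are compatible with everything the node has seen. Whatever a node knows is the same in all of these
worlds, so that it can be computed from an arbitrarily chosen one. -/
def worldsProtocol (inp : Ω → Fin n → In) (m : ℕ → Fin n → Fin n → Ω → BitVec b)
    (output : ℕ → Fin n → Ω → List Pt) : CliqueProtocol n b In (List Pt) where
  State := ℕ × Set Ω
  init i a := (0, {x | inp x i = a})
  send i σ j := if h : σ.2.Nonempty then m σ.1 i j h.some else 0
  recv i σ msg := (σ.1 + 1, {x | x ∈ σ.2 ∧ ∀ j, m σ.1 j i x = msg j})
  output i σ := if h : σ.2.Nonempty then output σ.1 i h.some else []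

theorem worldsProtocol_exec {inp : Ω → Fin n → In} {m : ℕ → Fin n → Fin n → Ω → BitVec b}
    (output : ℕ → Fin n → Ω → List Pt) (hm : ∀ t i j, Knows (viewAfter inp m t i) (m t i j))
    (ω : Ω) (t : ℕ) (i : Fin n) :
    (worldsProtocol inp m output).exec (inp ω) t i = (t, {x | viewAfter inp m t i ω x}) := by
  induction t generalizing i with
  | zero =>
    simp only [CliqueProtocol.exec, worldsProtocol, viewAfter, Prod.mk.injEq, true_and]
    ext x
    simp [eq_comm]
  | succ t ih =>
    have hsend : ∀ j, (worldsProtocol inp m output).send j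
        ((worldsProtocol inp m output).exec (inp ω) t j) i = m t j i ω := by
      intro j
      have hne : {x | viewAfter inp m t j ω x}.Nonempty := ⟨ω, rfl, fun _ _ _ => rfl⟩
      rw [ih]
      simp only [worldsProtocol]
      rw [dif_pos hne]
      exact (hm t j i _ _ hne.some_mem).symm
    have : (worldsProtocol inp m output).exec (inp ω) (t + 1) i =
        (worldsProtocol inp m output).recv i ((worldsProtocol inp m output).exec (inp ω) t i)
          (fun j => (worldsProtocol inp m output).send j
            ((worldsProtocol inp m output).exec (inp ω) t j) i) := rfl
    rw [this, ih, funext hsend]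
    simp only [worldsProtocol, Prod.mk.injEq, true_and]
    ext x
    simp only [viewAfter, Set.mem_ofPred_eq]
    constructor
    · rintro ⟨⟨h1, h2⟩, h3⟩
      refine ⟨h1, fun s hs j => ?_⟩
      rcases Nat.lt_succ_iff_lt_or_eq.1 hs with hs | rfl
      · exact h2 s hs j
      · exact (h3 j).symm
    · rintro ⟨h1, h2⟩
      exact ⟨⟨h1, fun s hs => h2 s (by omega)⟩, fun j => (h2 t (by omega) j).symm⟩

end Protocol

/-! ### Routing -/

section Routing

variable {Ω : Type} {n b : ℕ}

open Classical in
/-- The object with the property `P`, if there is one. -/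
def optOf {α : Type} (P : α → Prop) : Option α := if h : ∃ z, P z then some h.choose else none

theorem optOf_eq_some {α : Type} {P : α → Prop} (h : ∀ z z', P z → P z' → z = z') {z : α} :
    optOf P = some z ↔ P z := by
  unfold optOf
  split_ifs with h'
  · rw [Option.some_inj]
    constructor
    · rintro rfl; exact h'.choose_spec
    · exact h _ _ h'.choose_spec
  · simp only [false_iff]
    exact fun hz => h' ⟨z, hz⟩

/-- If every node `i` has lists `f τ i` of at most `n` elements that are to occupy the positions of
the list `Y` from `s τ i` onwards, then two rounds suffice to move every element to the node
responsible for its position: the element with position `pos` is sent to node `pos % n`, and from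
there to node `pos / n`. No two elements of one list, and no two elements with the same destination,
meet in an intermediate node. -/
theorem route {K : Fin n → Ω → Ω → Prop} (hn : 0 < n) {U : Finset Pt}
    (hU : (n * U.card + 1) ^ 2 ≤ 2 ^ b)
    {f : Bool → Fin n → Ω → List Pt} {s : Bool → Fin n → Ω → ℕ} {Y : Ω → List Pt}
    (hf : ∀ τ i, Knows (K i) (f τ i)) (hs : ∀ τ i, Knows (K i) (s τ i))
    (hlen : ∀ τ i ω, (f τ i ω).length ≤ n) (hfU : ∀ τ i ω, ∀ p ∈ f τ i ω, p ∈ U)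
    (hY : ∀ ω pos v, (Y ω)[pos]? = some v ↔
      ∃ τ i k, pos = s τ i ω + k ∧ (f τ i ω)[k]? = some v) :
    ∃ K', Reach b K 2 K' ∧ ∀ i, Knows (K' i) fun ω => chunk (n := n) (Y ω) i := by
  set P : Fin n → Fin n → Ω → Bool → ℕ × Pt → Prop := fun i p ω τ z =>
    ∃ k, s τ i ω + k = z.1 * n + p ∧ z.1 < n ∧ (f τ i ω)[k]? = some z.2 with hP
  have huniq : ∀ i p ω τ z z', P i p ω τ z → P i p ω τ z' → z = z' := by
    rintro i p ω τ ⟨d, v⟩ ⟨d', v'⟩ ⟨k, h1, -, h3⟩ ⟨k', h1', -, h3'⟩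
    dsimp only at h1 h1' h3 h3'
    have hk : k < n := (List.getElem?_eq_some_iff.1 h3).1.trans_le (hlen τ i ω)
    have hk' : k' < n := (List.getElem?_eq_some_iff.1 h3').1.trans_le (hlen τ i ω)
    have hd : d = d' := by
      rcases lt_trichotomy d d' with h | h | h
      · have : (d + 1) * n ≤ d' * n := Nat.mul_le_mul_right n h
        rw [Nat.succ_mul] at this
        omega
      · exact h
      · have : (d' + 1) * n ≤ d * n := Nat.mul_le_mul_right n h
        rw [Nat.succ_mul] at this
        omega
    subst hd
    obtain rfl : k = k' := by omega
    rw [h3] at h3'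
    exact Prod.ext rfl (Option.some.inj h3')
  obtain ⟨K₁, hK₁, hk₁⟩ := exchange (b := b) (K := K) (fun i p ω τ => optOf (P i p ω τ))
    (fun i p => Knows.pi fun τ => (hs τ i).comp₂ (hf τ i) fun s f => optOf fun z : ℕ × Pt =>
      ∃ k, s + k = z.1 * n + p ∧ z.1 < n ∧ f[k]? = some z.2)
    (fun i p => by
      classical
      refine Fits.mono ⟨Fintype.piFinset fun _ : Bool =>
        (Finset.range n ×ˢ U).insertNone, le_rfl, fun ω => ?_⟩ ?_
      · rw [Fintype.mem_piFinset]
        intro τ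
        rw [Finset.mem_insertNone]
        intro z hz
        obtain ⟨k, -, h2, h3⟩ := (optOf_eq_some (huniq i p ω τ)).1 hz
        rw [Finset.mem_product, Finset.mem_range]
        exact ⟨h2, hfU τ i ω _ (List.mem_of_getElem? h3)⟩
      · simpa [Fintype.card_piFinset] using hU)
  have hmem : ∀ ω (p d : Fin n) v, (Y ω)[d * n + p]? = some v ↔
      ∃ i τ, optOf (P i p ω τ) = some ((d : ℕ), v) := by
    intro ω p d v
    rw [hY]
    constructor
    · rintro ⟨τ, i, k, h1, h2⟩
      exact ⟨i, τ, (optOf_eq_some (huniq i p ω τ)).2 ⟨k, h1.symm, d.2, h2⟩⟩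
    · rintro ⟨i, τ, h⟩
      obtain ⟨k, h1, -, h3⟩ := (optOf_eq_some (huniq i p ω τ)).1 h
      exact ⟨τ, i, k, h1.symm, h3⟩
  obtain ⟨K₂, hK₂, hk₂⟩ := exchange (b := b) (K := K₁)
    (fun (p d : Fin n) ω => (Y ω)[(d : ℕ) * n + p]?)
    (fun p d x y hxy => Option.ext fun v => by
      rw [hmem, hmem]
      refine exists₂_congr fun i τ => ?_
      have := congrFun (hk₁ p i x y hxy) τ
      dsimp only at this
      rw [this])
    (fun p d => by
      refine Fits.mono (fits_option (U := U) fun ω v hv => ?_) (le_trans ?_ hU)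
      · obtain ⟨τ, i, k, -, h⟩ := (hY ω _ v).1 hv
        exact hfU τ i ω _ (List.mem_of_getElem? h)
      · have : U.card ≤ n * U.card := Nat.le_mul_of_pos_left _ hn
        nlinarith)
  refine ⟨K₂, hK₁.trans hK₂, fun i x y hxy => List.ext_getElem? fun k => ?_⟩
  simp only [chunk_getElem?]
  split_ifs with hk
  · exact hk₂ i ⟨k, hk⟩ x y hxy
  · rfl

/-- The position in the concatenation of lists with the lengths `c` at which list `j` begins. -/
def startPos (c : Fin n → ℕ) (j : Fin n) : ℕ := ((List.ofFn c).take j).sum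

theorem flatten_getElem? {α : Type} (L : List (List α)) (pos : ℕ) (v : α) :
    L.flatten[pos]? = some v ↔ ∃ j k, ∃ l, L[j]? = some l ∧
      pos = ((L.map List.length).take j).sum + k ∧ l[k]? = some v := by
  induction L generalizing pos with
  | nil => simp
  | cons l L ih =>
    rw [List.flatten_cons, List.getElem?_append]
    split_ifs with h
    · constructor
      · intro hv
        exact ⟨0, pos, l, by simp, by simp, hv⟩
      · rintro ⟨j, k, l', h1, h2, h3⟩
        cases j with
        | zero => simp at h1 h2; subst h1 h2; exact h3
        | succ j => simp at h2; omega
    · rw [ih]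
      constructor
      · rintro ⟨j, k, l', h1, h2, h3⟩
        exact ⟨j + 1, k, l', by simpa, by simp; omega, h3⟩
      · rintro ⟨j, k, l', h1, h2, h3⟩
        cases j with
        | zero =>
          simp at h1 h2
          subst h1 h2
          exact absurd (List.getElem?_eq_some_iff.1 h3).1 h
        | succ j => exact ⟨j, k, l', by simpa using h1, by simp at h2; omega, h3⟩

theorem gather_getElem? (g : Fin n → List Pt) (pos : ℕ) (v : Pt) :
    (gather g)[pos]? = some v ↔ ∃ j k, pos = startPos (fun j => (g j).length) j + k ∧
      (g j)[k]? = some v := by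
  rw [gather, flatten_getElem?]
  constructor
  · rintro ⟨j, k, l, h1, h2, h3⟩
    obtain ⟨hj, rfl⟩ := List.getElem?_eq_some_iff.1 h1
    rw [List.length_ofFn] at hj
    rw [List.getElem_ofFn] at h3
    exact ⟨⟨j, hj⟩, k, by rw [h2, List.map_ofFn]; rfl, h3⟩
  · rintro ⟨j, k, h2, h3⟩
    exact ⟨j, k, g j, by simp, by rw [h2, List.map_ofFn]; rfl, h3⟩

/-- Concatenating two families of lists held by the nodes, in any order of the nodes. -/
theorem route_gather {K : Fin n → Ω → Ω → Prop} (hn : 0 < n) {U : Finset Pt}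
    (hU : (n * U.card + 1) ^ 2 ≤ 2 ^ b) (hb : (n + 1) ^ 2 ≤ 2 ^ b)
    {f : Bool → Fin n → Ω → List Pt} (e : Bool → Equiv.Perm (Fin n))
    (hf : ∀ τ i, Knows (K i) (f τ i)) (hlen : ∀ τ i ω, (f τ i ω).length ≤ n)
    (hfU : ∀ τ i ω, ∀ p ∈ f τ i ω, p ∈ U) :
    ∃ K', Reach b K 3 K' ∧ ∀ i, Knows (K' i) fun ω => chunk (n := n)
      (gather (fun j => f false (e false j) ω) ++ gather fun j => f true (e true j) ω) i := by
  obtain ⟨K₁, hK₁, hk₁⟩ := announce (b := b) (K := K)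
    (fun i ω => ((f false i ω).length, (f true i ω).length))
    (fun i => (hf false i).comp₂ (hf true i) fun l l' => (l.length, l'.length))
    (fun i => (Fits.prodMk (fits_nat (N := n + 1) fun ω => Nat.lt_succ_of_le (hlen _ _ _))
      (fits_nat (N := n + 1) fun ω => Nat.lt_succ_of_le (hlen _ _ _))).mono
        (by rw [← sq]; exact hb))
  have hc : ∀ i τ, Knows (K₁ i) fun ω j => (f τ j ω).length := by
    intro i τ
    refine Knows.pi fun j => ?_
    cases τ
    · exact (hk₁ i j).comp Prod.fst
    · exact (hk₁ i j).comp Prod.snd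
  set base : Bool → Ω → ℕ := fun τ ω =>
    if τ then (gather fun j => f false (e false j) ω).length else 0 with hbase
  have hbk : ∀ i τ, Knows (K₁ i) (base τ) := by
    intro i τ
    cases τ
    · exact knows_const _ _
    · have : base true = fun ω => ((List.ofFn fun j => (f false (e false j) ω).length).sum) := by
        funext ω
        simp only [hbase, if_true, gather, List.length_flatten, List.map_ofFn]
        rfl
      rw [this]
      exact (hc i false).comp fun c => (List.ofFn fun j => c (e false j)).sum
  obtain ⟨K₂, hK₂, hk₂⟩ := route (K := K₁) hn hU (f := f)
    (s := fun τ i ω => base τ ω + startPos (fun j => (f τ (e τ j) ω).length) ((e τ).symm i))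
    (Y := fun ω => gather (fun j => f false (e false j) ω) ++ gather fun j => f true (e true j) ω)
    (fun τ i => hK₁.knows (hf τ i))
    (fun τ i => (hbk i τ).comp₂ (hc i τ)
      fun a c => a + startPos (fun j => c (e τ j)) ((e τ).symm i))
    hlen hfU (fun ω pos v => by
      rw [List.getElem?_append]
      simp only [Bool.exists_bool]
      constructor
      · split_ifs with h
        · rw [gather_getElem?]
          rintro ⟨j, k, h1, h2⟩
          exact .inl ⟨e false j, k, by simp [hbase, h1], h2⟩
        · rw [gather_getElem?]
          rintro ⟨j, k, h1, h2⟩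
          refine .inr ⟨e true j, k, ?_, h2⟩
          simp only [hbase, if_true, Equiv.symm_apply_apply]
          omega
      · rintro (⟨i, k, h1, h2⟩ | ⟨i, k, h1, h2⟩)
        · have h3 : (gather fun j => f false (e false j) ω)[pos]? = some v := by
            rw [gather_getElem?]
            exact ⟨(e false).symm i, k, by simpa [hbase] using h1, by simpa using h2⟩
          rw [if_pos (List.getElem?_eq_some_iff.1 h3).1, h3]
        · simp only [hbase, if_true] at h1
          rw [if_neg (by omega), gather_getElem?]
          exact ⟨(e true).symm i, k, by omega, by simpa using h2⟩)
  exact ⟨K₂, hK₁.trans hK₂, hk₂⟩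

end Routing

/-! ### Sorting on the clique -/

section Radix

/-- The number of points of `U` before `p`. -/
def rankIn (U : Finset Pt) (p : Pt) : ℕ := by
  classical exact (U.filter fun q => lexLT q p).card

theorem rankIn_lt {U : Finset Pt} {p : Pt} (hp : p ∈ U) : rankIn U p < U.card := by
  classical
  refine Finset.card_lt_card ⟨Finset.filter_subset _ _, fun h => ?_⟩
  exact lexLT_irrefl p (Finset.mem_filter.1 (h hp)).2

theorem lexLE_of_rankIn_le {U : Finset Pt} {p q : Pt} (hq : q ∈ U)
    (h : rankIn U p ≤ rankIn U q) : lexLE p q := by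
  classical
  by_contra hlt
  rw [not_lexLE] at hlt
  refine h.not_gt (Finset.card_lt_card ⟨fun r hr => ?_, fun hsub => ?_⟩)
  · rw [Finset.mem_filter] at hr ⊢
    exact ⟨hr.1, hr.2.trans hlt⟩
  · exact lexLT_irrefl q (Finset.mem_filter.1 (hsub (Finset.mem_filter.2 ⟨hq, hlt⟩))).2

/-- Stable sorting by the lowest `t` bits of the ranks, one bit after another. -/
def radixSort (U : Finset Pt) (X : List Pt) : ℕ → List Pt
  | 0 => X
  | t + 1 => (radixSort U X t).filter (fun p => !(rankIn U p).testBit t) ++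
      (radixSort U X t).filter (fun p => (rankIn U p).testBit t)

theorem radixSort_perm (U : Finset Pt) (X : List Pt) (t : ℕ) : (radixSort U X t).Perm X := by
  induction t with
  | zero => exact .refl _
  | succ t ih =>
    exact (List.perm_append_comm.trans (List.filter_append_perm _ _)).trans ih

theorem radixSort_pairwise (U : Finset Pt) (X : List Pt) (t : ℕ) :
    (radixSort U X t).Pairwise fun p q => rankIn U p % 2 ^ t ≤ rankIn U q % 2 ^ t := by
  induction t with
  | zero => simpa [Nat.mod_one] using List.pairwise_of_forall fun _ _ => trivial
  | succ t ih =>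
    have hmod : ∀ x, x % 2 ^ (t + 1) = 2 ^ t * (x.testBit t).toNat + x % 2 ^ t := fun x => by
      rw [Nat.mod_pow_succ, Nat.add_comm, Nat.toNat_testBit]
    rw [radixSort, List.pairwise_append]
    refine ⟨?_, ?_, ?_⟩
    · refine (ih.filter _).imp_of_mem fun {p q} hp hq hpq => ?_
      simp only [List.mem_filter, Bool.not_eq_true'] at hp hq
      rw [hmod, hmod, hp.2, hq.2]
      omega
    · refine (ih.filter _).imp_of_mem fun {p q} hp hq hpq => ?_
      simp only [List.mem_filter] at hp hq
      rw [hmod, hmod, hp.2, hq.2]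
      omega
    · intro p hp q hq
      simp only [List.mem_filter, Bool.not_eq_true'] at hp hq
      have : rankIn U p % 2 ^ t < 2 ^ t := Nat.mod_lt _ (by positivity)
      rw [hmod, hmod, hp.2, hq.2]
      simp only [Bool.toNat_false, Bool.toNat_true]
      omega

theorem radixSort_eq_sortPts {U : Finset Pt} {X : List Pt} (hX : ∀ p ∈ X, p ∈ U) {t : ℕ}
    (ht : U.card ≤ 2 ^ t) : radixSort U X t = sortPts X := by
  have hperm := radixSort_perm U X t
  refine List.Perm.eq_of_pairwise (le := lexLE) (fun a b _ _ h h' => h.antisymm h') ?_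
    (sortPts_pairwise X) (hperm.trans (sortPts_perm X).symm)
  refine (radixSort_pairwise U X t).imp_of_mem fun {p q} hp hq hpq => ?_
  have hp := hX p (hperm.mem_iff.1 hp)
  have hq := hX q (hperm.mem_iff.1 hq)
  rw [Nat.mod_eq_of_lt ((rankIn_lt hp).trans_le ht),
    Nat.mod_eq_of_lt ((rankIn_lt hq).trans_le ht)] at hpq
  exact lexLE_of_rankIn_le hq hpq

theorem chunk_gather {n : ℕ} {f : Fin n → List Pt} (h : ∀ i, (f i).length = n) (i : Fin n) :
    chunk (gather f) i = f i := by
  have h1 := List.drop_take_succ_flatten_eq_getElem (List.ofFn f) i (by simp)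
  have h2 : (List.ofFn f).map List.length = List.replicate n n := by
    rw [List.map_ofFn, List.eq_replicate_iff]
    simp [List.mem_ofFn, h]
  rw [h2, List.take_replicate, List.take_replicate, List.sum_replicate, List.sum_replicate,
    Nat.min_eq_left (by omega), Nat.min_eq_left (by omega), List.getElem_ofFn, List.drop_take] at h1
  rw [chunk, gather, ← h1]
  congr 1
  simp [Nat.succ_mul]

variable {Ω : Type} {n b : ℕ}

/-- Radix sort takes three rounds per bit of the ranks. -/
theorem reach_sorted {K : Fin n → Ω → Ω → Prop} (hn : 0 < n) {U : Finset Pt}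
    (hU : (n * U.card + 1) ^ 2 ≤ 2 ^ b) (hb : (n + 1) ^ 2 ≤ 2 ^ b) {t : ℕ} (ht : U.card ≤ 2 ^ t)
    {S : Ω → Fin n → Fin n → Pt} (hK : ∀ i, Knows (K i) fun ω => S ω i)
    (hS : ∀ ω i j, S ω i j ∈ U) :
    ∃ K', Reach b K (3 * t) K' ∧ ∀ i, Knows (K' i) fun ω => batchOf (S ω) i := by
  have hXU : ∀ ω, ∀ p ∈ gather (fun j => List.ofFn (S ω j)), p ∈ U := by
    intro ω p hp
    rw [gather_mem] at hp
    obtain ⟨i, hp⟩ := hp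
    rw [List.mem_ofFn] at hp
    obtain ⟨j, rfl⟩ := hp
    exact hS ω i j
  obtain ⟨K', h1, h2⟩ := Reach.iterate (b := b) (r := 3) (fun t K' => ∀ i, Knows (K' i) fun ω =>
      chunk (n := n) (radixSort U (gather fun j => List.ofFn (S ω j)) t) i) (fun t K' hK' => by
    obtain ⟨K'', h1, h2⟩ := route_gather (K := K') hn hU hb (f := fun τ i ω =>
        (chunk (n := n) (radixSort U (gather fun j => List.ofFn (S ω j)) t) i).filter
          fun p => (rankIn U p).testBit t == τ) (fun _ => Equiv.refl _)
      (fun τ i => (hK' i).comp _)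
      (fun τ i ω => (List.length_filter_le _ _).trans (chunk_length_le _ _))
      (fun τ i ω p hp => hXU ω p ((radixSort_perm U _ t).mem_iff.1
        (List.mem_of_mem_drop (List.mem_of_mem_take (List.mem_of_mem_filter hp)))))
    refine ⟨K'', h1, fun i => ?_⟩
    have := h2 i
    simp only [Equiv.refl_apply, ← gather_filter] at this
    convert this using 4 with ω
    rw [gather_chunk (by rw [(radixSort_perm U _ t).length_eq, gather_length (m := n)]; simp)]
    simp [radixSort]) (K := K) (fun i => by
    have : (fun ω => chunk (n := n) (radixSort U (gather fun j => List.ofFn (S ω j)) 0) i) =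
        fun ω => List.ofFn (S ω i) := by
      funext ω
      exact chunk_gather (by simp) i
    rw [this]
    exact (hK i).comp fun f => List.ofFn f) t
  refine ⟨K', h1, fun i => ?_⟩
  have : (fun ω => batchOf (S ω) i) = fun ω =>
      chunk (n := n) (radixSort U (gather fun j => List.ofFn (S ω j)) t) i := by
    funext ω
    rw [radixSort_eq_sortPts (hXU ω) ht]
    rfl
  rw [this]
  exact h2 i

end Radix

/-! ### Finding bridges by tangents -/

/-- A vertex `v` of the left chain lies to the left of the endpoint `a` of the bridge if and only
if the tangent from `v` to the right chain passes below some later vertex of the left chain. -/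
theorem lexLT_endpoint_iff {s : Side} {F G : List Pt} (hFG : ∀ p ∈ F, ∀ q ∈ G, lexLT p q)
    (hF : ∀ v ∈ F, ∀ x ∈ F, ∀ y ∈ F, lexLT x v → lexLT v y → 0 < s.out x y v) {a b : Pt}
    (hab : IsBridge s F G a b) {v q : Pt} (hv : v ∈ F) (hq : q ∈ G)
    (ht : ∀ g ∈ G, s.out v q g ≤ 0) :
    lexLT v a ↔ ∃ p ∈ F, lexLT v p ∧ 0 < s.out v q p := by
  obtain ⟨ha, hb, ⟨hSF, hSG⟩, hl, -⟩ := hab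
  constructor
  · intro hva
    refine ⟨a, ha, hva, out_pos_of_segment_below s (hFG a ha b hb) hva (hFG a ha q hq)
      (hSF v hv) (hSG q hq) (.inl ?_) (out_self_left s a b)⟩
    exact lt_of_le_of_ne (hSF v hv) fun h0 => not_lexLT.2 (hl v hv h0) hva
  · rintro ⟨p, hp, hvp, hpos⟩
    by_contra hnot
    have hvq := hFG v hv q hq
    have hvb := hFG v hv b hb
    rcases lexLE_iff.1 (not_lexLT.1 hnot) with hav | rfl
    · have h1 : s.out a v p < 0 := by
        have := hF v hv a ha p hp hav hvp
        have := out_rot s a v p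
        have := out_rot s v p a
        have := out_swap s a p v
        linarith
      have h2 : s.out v p q < 0 := by
        have := out_rot s v p q
        have := out_rot s p q v
        have := out_swap s v q p
        linarith
      have h3 : s.out v p b < 0 :=
        (out_trans_left s hvp hvq hvb h2.le (ht b hb)).2 (.inl h2)
      have h4 : s.out a v b < 0 := out_extend s hav hvp hvb h1 h3.le
      have := hSF v hv
      have := out_rot s a v b
      have := out_rot s v b a
      have := out_swap s a b v
      linarith
    · exact ((out_trans_left s hvq hvb hvp (ht b hb) (hSF p hp)).1).not_gt hpos

/-- A point of `G` on the tangent from `v`. -/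
def tangentPt (s : Side) (v : Pt) (G : List Pt) : Option Pt :=
  optOf fun q => q ∈ G ∧ ∀ g ∈ G, s.out v q g ≤ 0

theorem optOf_spec {α : Type} {P : α → Prop} {z : α} (h : z ∈ optOf P) : P z := by
  unfold optOf at h
  split_ifs at h with h'
  · obtain rfl := Option.some.inj h
    exact h'.choose_spec
  · cases h

theorem exists_mem_optOf {α : Type} {P : α → Prop} (h : ∃ z, P z) : ∃ z, z ∈ optOf P := by
  unfold optOf
  rw [dif_pos h]
  exact ⟨_, rfl⟩

theorem exists_tangentPt (s : Side) {v : Pt} {G : List Pt} (hv : ∀ q ∈ G, lexLT v q)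
    (hG : G ≠ []) : ∃ q, q ∈ tangentPt s v G := by
  obtain ⟨a, b, ha, hb, hS, -⟩ := exists_isBridge s (F := [v]) (G := G)
    (fun p hp q hq => by rw [List.mem_singleton.1 hp]; exact hv q hq) (by simp) hG
  obtain rfl := List.mem_singleton.1 ha
  exact exists_mem_optOf ⟨b, hb, hS.2⟩

open Classical in
/-- The half of the fragment `F` of the chain `H` on the side of its median that is indicated by
the point `o` of a tangent from the median. -/
def tangentHalf (s : Side) (H F : List Pt) (o : Option Pt) : List Pt :=
  if ∃ q ∈ o, ∃ p ∈ H, lexLT (medianPt F) p ∧ 0 < s.out (medianPt F) q p then dropLeft F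
  else dropRight F

theorem nextFrag_eq_tangentHalf {s : Side} {H G F : List Pt} (hHG : ∀ p ∈ H, ∀ q ∈ G, lexLT p q)
    (hH : ∀ v ∈ H, ∀ x ∈ H, ∀ y ∈ H, lexLT x v → lexLT v y → 0 < s.out x y v) (hF : F ⊆ H) :
    nextFrag s H G F =
      tangentHalf s H F ((F[F.length / 2]?).bind fun v => tangentPt s v G) := by
  by_cases hne : F = []
  · subst hne
    simp [nextFrag, tangentHalf, dropLeft, dropRight]
  · have hm : medianPt F ∈ H := hF (List.mem_of_getElem? (medianPt_eq hne))
    rw [medianPt_eq hne, Option.bind_some, nextFrag, tangentHalf]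
    have : (∃ z ∈ bridgeOf s H G, lexLT (medianPt F) z.1) ↔
        ∃ q ∈ tangentPt s (medianPt F) G, ∃ p ∈ H,
        lexLT (medianPt F) p ∧ 0 < s.out (medianPt F) q p := by
      constructor
      · rintro ⟨z, hz, hlt⟩
        have hB := bridgeOf_some hz
        obtain ⟨q, hq⟩ := exists_tangentPt s (hHG _ hm) (List.ne_nil_of_mem hB.2.1)
        have hq' := optOf_spec hq
        exact ⟨q, hq, (lexLT_endpoint_iff hHG hH hB hm hq'.1 hq'.2).1 hlt⟩
      · rintro ⟨q, hq, h⟩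
        have hq' := optOf_spec hq
        obtain ⟨a, b, e, hB⟩ := bridgeOf_isSome hHG (List.ne_nil_of_mem hm)
          (List.ne_nil_of_mem hq'.1)
        exact ⟨(a, b), e, (lexLT_endpoint_iff hHG hH hB hm hq'.1 hq'.2).2 h⟩
    by_cases h : ∃ z ∈ bridgeOf s H G, lexLT (medianPt F) z.1
    · rw [if_pos h, if_pos (this.1 h)]
    · rw [if_neg h, if_neg fun h' => h (this.2 h')]

/-- The fragments of the binary search for the endpoint on `H` of the bridge of `H` and `G`. -/
def searchFrag (s : Side) (H G : List Pt) : ℕ → List Pt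
  | 0 => H
  | j + 1 => nextFrag s H G (searchFrag s H G j)

theorem searchFrag_sublist (s : Side) (H G : List Pt) (j : ℕ) :
    List.Sublist (searchFrag s H G j) H := by
  induction j with
  | zero => exact .refl _
  | succ j ih => exact (nextFrag_sublist s H G _).trans ih

theorem searchFrag_length (s : Side) {H : List Pt} (G : List Pt) {n : ℕ} (hH : H.length ≤ n) :
    (searchFrag s H G (Nat.size n)).length ≤ 2 := by
  have h : ∀ j, halvings (searchFrag s H G j) ≤ Nat.size n - j := by
    intro j
    induction j with
    | zero => exact Nat.size_le_size ((Nat.sub_le _ _).trans hH)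
    | succ j ih =>
      have := halvings_half (nextFrag_half s H G (searchFrag s H G j))
      rw [searchFrag]
      omega
  by_contra! hlt
  have := halvings_pos hlt
  have := h (Nat.size n)
  omega

theorem bridgeOf_searchFrag {s : Side} {H G : List Pt} (hHG : ∀ p ∈ H, ∀ q ∈ G, lexLT p q)
    (hH : H.Pairwise lexLT) (j : ℕ) : bridgeOf s (searchFrag s H G j) G = bridgeOf s H G := by
  have hsub := searchFrag_sublist s H G
  by_cases hne : H = [] ∨ G = []
  · rw [bridgeOf_none hne, bridgeOf_none]
    rcases hne with rfl | h
    · exact .inl (List.sublist_nil.1 (hsub j))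
    · exact .inr h
  · rw [not_or] at hne
    obtain ⟨a, b, e, hB⟩ := bridgeOf_isSome (s := s) hHG hne.1 hne.2
    have hmem : ∀ j, a ∈ searchFrag s H G j := by
      intro j
      induction j with
      | zero => exact hB.1
      | succ j ih => exact mem_nextFrag e (hH.sublist (hsub j)) ih
    rw [e]
    exact bridgeOf_eq (fun p hp q hq => hHG p ((hsub j).subset hp) q hq)
      (hB.mono (hsub j).subset (List.Subset.refl _) (hmem j) hB.2.1)

open Classical in
/-- The fragment of `H` and the bridge, if found, after `j` levels of a call in which only the
fragment of `H` is pruned. -/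
def callState (s : Side) (H G : List Pt) : ℕ → List Pt × Option (Pt × Pt)
  | 0 => (H, none)
  | j + 1 =>
    if (callState s H G j).2 = none then
      if Stops s (callState s H G j).1 G then ((callState s H G j).1, bridgeOf s H G)
      else (nextFrag s H G (callState s H G j).1, none)
    else callState s H G j

theorem callState_sublist (s : Side) (H G : List Pt) (j : ℕ) :
    List.Sublist (callState s H G j).1 H := by
  induction j with
  | zero => exact .refl _
  | succ j ih =>
    rw [callState]
    split_ifs
    · exact ih
    · exact (nextFrag_sublist s H G _).trans ih
    · exact ih

theorem callState_snd (s : Side) (H G : List Pt) (j : ℕ) :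
    (callState s H G j).2 = none ∨ (callState s H G j).2 = bridgeOf s H G := by
  induction j with
  | zero => exact .inl rfl
  | succ j ih =>
    rw [callState]
    split_ifs
    · exact .inr rfl
    · exact .inl rfl
    · exact ih

/-- The test for the end of the recursion, in terms of the medians and of a test of either chain
by its own node. -/
theorem stops_iff (s : Side) (F G : List Pt) : Stops s F G ↔ F.length ≤ 2 ∨ G.length ≤ 2 ∨
    (∀ w ∈ G[G.length / 2]?, ∀ p ∈ F, s.out (medianPt F) w p ≤ 0) ∧
    (∀ v ∈ F[F.length / 2]?, ∀ p ∈ G, s.out v (medianPt G) p ≤ 0) := by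
  unfold Stops Supports
  by_cases hF : F = []
  · simp [hF]
  by_cases hG : G = []
  · simp [hG]
  rw [medianPt_eq hF, medianPt_eq hG]
  simp

/-! ### The calls of `Bridge` on the clique -/

section Bridges

variable {Ω : Type} {n b : ℕ}

/-- A node that knows the median `v` of a fragment of the other node sends the tangent from `v` to
its own chain; by `nextFrag_eq_tangentHalf` this guides a binary search for the left endpoints of
all bridges. The right endpoints are then computed from the remaining fragments. -/
theorem reach_pairBridge {K : Fin n → Ω → Ω → Prop} {U : Finset Pt}
    (hB : (U.card + 1) ^ 2 ≤ 2 ^ b) {s : Side} {sub : Ω → Fin n → List Pt}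
    (hsub : ∀ ω, (gather (sub ω)).Pairwise lexLT) (hU : ∀ ω i, ∀ p ∈ sub ω i, p ∈ U)
    (hlen : ∀ ω i, (sub ω i).length ≤ n) (hK : ∀ i, Knows (K i) fun ω => sub ω i) :
    ∃ K', Reach b K (2 * Nat.size n + 2) K' ∧
      ∀ i m, Knows (K' i) fun ω => pairBridge s (sub ω) i m := by
  set H : Ω → Fin n → List Pt := fun ω i => hullChain s (sub ω i) with hH
  have hKH : ∀ i, Knows (K i) fun ω => H ω i := fun i => (hK i).comp (hullChain s)
  have hHU : ∀ ω i, ∀ p ∈ H ω i, p ∈ U := fun ω i p hp => hU ω i p (hullChain_subset _ _ hp)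
  have hlt : ∀ ω l m, l < m → ∀ p ∈ H ω l, ∀ q ∈ H ω m, lexLT p q := fun ω l m hlm p hp q hq =>
    (gather_pairwise.1 (hsub ω)).2 l m hlm p (hullChain_subset _ _ hp) q (hullChain_subset _ _ hq)
  have hpw : ∀ ω i, (H ω i).Pairwise lexLT := fun ω i =>
    hullChain_pairwise ((gather_pairwise.1 (hsub ω)).1 i)
  have hch : ∀ ω i, ∀ v ∈ H ω i, ∀ x ∈ H ω i, ∀ y ∈ H ω i, lexLT x v → lexLT v y →
      0 < s.out x y v := fun ω i v hv x hx y hy =>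
    (mem_hullChain.1 hv).2 x (hullChain_subset _ _ hx) y (hullChain_subset _ _ hy)
  have hHlen : ∀ ω i, (H ω i).length ≤ n := fun ω i =>
    (List.length_filter_le _ _).trans (hlen ω i)
  have hb1 : U.card + 1 ≤ 2 ^ b := le_trans (by nlinarith) hB
  obtain ⟨K₁, hK₁, hb, hk₁⟩ := Reach.iterate (b := b) (r := 2) (K := K) (fun j K' =>
      (∀ i, Knows (K' i) fun ω => H ω i) ∧
      ∀ l m, l < m → Knows (K' l) fun ω => searchFrag s (H ω l) (H ω m) j) (by
    rintro j K' ⟨hb, hk⟩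
    obtain ⟨K₁, hK₁, hk₁⟩ := exchange (b := b) (K := K') (fun l m ω => if l < m then
        (searchFrag s (H ω l) (H ω m) j)[(searchFrag s (H ω l) (H ω m) j).length / 2]? else none)
      (fun l m => by
        split_ifs with h
        · exact (hk l m h).comp fun F => F[F.length / 2]?
        · exact knows_const _ _)
      (fun l m => (fits_option (U := U) fun ω a ha => by
        split_ifs at ha
        · exact hHU ω l a ((searchFrag_sublist s _ _ j).subset (List.mem_of_getElem? ha))
        · cases ha).mono hb1)
    have hb' : ∀ i, Knows (K₁ i) fun ω => H ω i := fun i => hK₁.knows (hb i)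
    obtain ⟨K₂, hK₂, hk₂⟩ := exchange (b := b) (K := K₁) (fun m l ω => if l < m then
        ((searchFrag s (H ω l) (H ω m) j)[(searchFrag s (H ω l) (H ω m) j).length / 2]?).bind
          fun v => tangentPt s v (H ω m) else none)
      (fun m l => by
        split_ifs with h
        · have := hk₁ m l
          simp only [h, if_true] at this
          exact this.comp₂ (hb' m) fun o G => o.bind fun v => tangentPt s v G
        · exact knows_const _ _)
      (fun m l => (fits_option (U := U) fun ω a ha => by
        split_ifs at ha
        · obtain ⟨v, -, hv⟩ := Option.mem_bind_iff.1 ha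
          exact hHU ω m a (optOf_spec hv).1
        · cases ha).mono hb1)
    refine ⟨K₂, hK₁.trans hK₂, fun i => hK₂.knows (hb' i), fun l m hlm x y hxy => ?_⟩
    have e1 := hk l m hlm x y (hK₁.le (hK₂.le hxy))
    have e2 := hb' l x y (hK₂.le hxy)
    have e3 := hk₂ l m x y hxy
    simp only [hlm, if_true] at e1 e2 e3
    simp only [searchFrag]
    rw [nextFrag_eq_tangentHalf (hlt x l m hlm) (hch x l) (searchFrag_sublist s _ _ j).subset,
      nextFrag_eq_tangentHalf (hlt y l m hlm) (hch y l) (searchFrag_sublist s _ _ j).subset,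
      e3, e1, e2]) ⟨hKH, fun l m _ => hKH l⟩ (Nat.size n)
  obtain ⟨K₂, hK₂, hk₂⟩ := exchange (b := b) (K := K₁) (fun l m ω => if l < m then
      ((searchFrag s (H ω l) (H ω m) (Nat.size n))[0]?,
        (searchFrag s (H ω l) (H ω m) (Nat.size n))[1]?) else (none, none))
    (fun l m => by
      split_ifs with h
      · exact (hk₁ l m h).comp fun F => (F[0]?, F[1]?)
      · exact knows_const _ _)
    (fun l m => by
      split_ifs with h
      · refine ((fits_option (U := U) fun ω a ha => ?_).prodMk
          (fits_option (U := U) fun ω a ha => ?_)).mono (by rw [← sq]; exact hB)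
        · exact hHU ω l a ((searchFrag_sublist s _ _ _).subset (List.mem_of_getElem? ha))
        · exact hHU ω l a ((searchFrag_sublist s _ _ _).subset (List.mem_of_getElem? ha))
      · exact ⟨{(none, none)}, by simpa using Nat.one_le_two_pow, by simp⟩)
  have hright : ∀ l m, l < m → Knows (K₂ m) fun ω => bridgeOf s (H ω l) (H ω m) := by
    intro l m hlm x y hxy
    have e1 := hk₂ m l x y hxy
    have e2 := hb m x y (hK₂.le hxy)
    simp only [hlm, if_true, Prod.mk.injEq] at e1 e2
    have e3 : searchFrag s (H x l) (H x m) (Nat.size n) =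
        searchFrag s (H y l) (H y m) (Nat.size n) := by
      have hx := searchFrag_length s (H x m) (hHlen x l)
      have hy := searchFrag_length s (H y m) (hHlen y l)
      refine List.ext_getElem? fun k => ?_
      match k with
      | 0 => exact e1.1
      | 1 => exact e1.2
      | k + 2 => rw [List.getElem?_eq_none (by omega), List.getElem?_eq_none (by omega)]
    simp only
    rw [← bridgeOf_searchFrag (hlt x l m hlm) (hpw x l) (Nat.size n),
      ← bridgeOf_searchFrag (hlt y l m hlm) (hpw y l) (Nat.size n), e3, e2]
  obtain ⟨K₃, hK₃, hk₃⟩ := exchange (b := b) (K := K₂) (fun m l ω => if l < m then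
      bridgeOf s (H ω l) (H ω m) else none)
    (fun m l => by
      split_ifs with h
      · exact hright l m h
      · exact knows_const _ _)
    (fun m l => (fits_option (U := U ×ˢ U) fun ω z hz => by
      split_ifs at hz
      · have := bridgeOf_some (a := z.1) (b := z.2) hz
        exact Finset.mem_product.2 ⟨hHU ω l _ this.1, hHU ω m _ this.2.1⟩
      · cases hz).mono (by
        rw [Finset.card_product]
        nlinarith))
  refine ⟨K₃, (hK₁.trans hK₂).trans hK₃, fun i m => ?_⟩
  unfold pairBridge
  split_ifs with h h'
  · have := hk₃ i m
    simpa only [h, if_true] using this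
  · exact hK₃.knows (hright m i h')
  · exact knows_const _ _

/-- In the `j`-th level of the calls of `Bridge` on the side `s`, some call is active. -/
def SomeActive (s : Side) (sub : Fin n → List Pt) (j : ℕ) : Prop :=
  ∃ l m, l < m ∧ bridgeOf s (hullChain s (sub l)) (hullChain s (sub m)) ≠ none ∧
    (callState s (hullChain s (sub l)) (hullChain s (sub m)) j).2 = none

/-- In every level, the two nodes of a call exchange their medians and the results of testing the
own chain against the line through the medians, and all nodes tell whether they still work. -/
theorem reach_callState {K : Fin n → Ω → Ω → Prop} {U : Finset Pt}
    (hB : 4 * (U.card + 1) ^ 3 ≤ 2 ^ b) {s : Side} {sub : Ω → Fin n → List Pt}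
    (hU : ∀ ω i, ∀ p ∈ sub ω i, p ∈ U) (hK : ∀ i, Knows (K i) fun ω => sub ω i)
    (hbr : ∀ i m, Knows (K i) fun ω => pairBridge s (sub ω) i m) (D : ℕ) :
    ∃ K', Reach b K (2 * D) K' ∧ ∀ j < D,
      (∀ l m, l < m → Knows (K' l) fun ω =>
        callState s (hullChain s (sub ω l)) (hullChain s (sub ω m)) j) ∧
      (∀ l m, l < m → Knows (K' m) fun ω =>
        (callState s (hullChain s (sub ω l)) (hullChain s (sub ω m)) j).2) ∧
      ∀ i, Knows (K' i) fun ω => SomeActive s (sub ω) j := by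
  set H : Ω → Fin n → List Pt := fun ω i => hullChain s (sub ω i) with hH
  have hKH : ∀ i, Knows (K i) fun ω => H ω i := fun i => (hK i).comp (hullChain s)
  have hHU : ∀ ω i, ∀ p ∈ H ω i, p ∈ U := fun ω i p hp => hU ω i p (hullChain_subset _ _ hp)
  have hbr' : ∀ l m, l < m → Knows (K l) fun ω => bridgeOf s (H ω l) (H ω m) := by
    intro l m hlm
    simpa only [pairBridge, hlm, if_true] using hbr l m
  have hU2 : U.card * U.card + 1 ≤ (U.card + 1) ^ 2 := by nlinarith
  obtain ⟨K', hK', -, -, -, hP⟩ := Reach.iterate (b := b) (r := 2) (K := K) (fun j K' =>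
      (∀ i, Knows (K' i) fun ω => H ω i) ∧
      (∀ l m, l < m → Knows (K' l) fun ω => bridgeOf s (H ω l) (H ω m)) ∧
      (∀ l m, l < m → Knows (K' l) fun ω => callState s (H ω l) (H ω m) j) ∧
      ∀ j' < j, (∀ l m, l < m → Knows (K' l) fun ω => callState s (H ω l) (H ω m) j') ∧
        (∀ l m, l < m → Knows (K' m) fun ω => (callState s (H ω l) (H ω m) j').2) ∧
        ∀ i, Knows (K' i) fun ω => SomeActive s (sub ω) j') (by
    rintro j K' ⟨hb, hbr, hk, hold⟩
    have hwork : ∀ l, Knows (K' l) fun ω => ∃ m, l < m ∧ bridgeOf s (H ω l) (H ω m) ≠ none ∧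
        (callState s (H ω l) (H ω m) j).2 = none := by
      intro l
      have : ∀ m, Knows (K' l) fun ω => l < m ∧ bridgeOf s (H ω l) (H ω m) ≠ none ∧
          (callState s (H ω l) (H ω m) j).2 = none := by
        intro m
        by_cases h : l < m
        · exact (hbr l m h).comp₂ (hk l m h) fun z st => l < m ∧ z ≠ none ∧ st.2 = none
        · simp only [h, false_and]
          exact knows_const _ _
      exact (Knows.pi this).comp fun f => ∃ m, f m
    obtain ⟨K₁, hK₁, hk₁⟩ := exchange (b := b) (K := K') (fun l m ω =>
        (if l < m then (callState s (H ω l) (H ω m) j).1[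
            (callState s (H ω l) (H ω m) j).1.length / 2]? else none,
          if l < m then (callState s (H ω l) (H ω m) j).2 else none,
          ∃ m, l < m ∧ bridgeOf s (H ω l) (H ω m) ≠ none ∧
            (callState s (H ω l) (H ω m) j).2 = none))
      (fun l m => by
        split_ifs with h
        · exact (hk l m h).comp₂ (hwork l) fun st w => (st.1[st.1.length / 2]?, st.2, w)
        · exact (hwork l).comp fun w => (none, none, w))
      (fun l m => by
        refine ((fits_option (U := U) fun ω a ha => ?_).prodMk
          ((fits_option (U := U ×ˢ U) fun ω z hz => ?_).prodMk (fits_prop _))).mono ?_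
        · split_ifs at ha
          · exact hHU ω l a ((callState_sublist s _ _ _).subset (List.mem_of_getElem? ha))
          · cases ha
        · split_ifs at hz
          · rcases callState_snd s (H ω l) (H ω m) j with h | h
            · rw [h] at hz; cases hz
            · rw [h] at hz
              have := bridgeOf_some (a := z.1) (b := z.2) hz
              exact Finset.mem_product.2 ⟨hHU ω l _ this.1, hHU ω m _ this.2.1⟩
          · cases hz
        · rw [Finset.card_product]
          refine le_trans ?_ hB
          have := Nat.mul_le_mul_left (2 * (U.card + 1)) hU2
          nlinarith)
    have hb' : ∀ i, Knows (K₁ i) fun ω => H ω i := fun i => hK₁.knows (hb i)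
    obtain ⟨K₂, hK₂, hk₂⟩ := exchange (b := b) (K := K₁) (fun m l ω =>
        ((H ω m)[(H ω m).length / 2]?, (H ω m).length ≤ 2,
          ∀ v ∈ (if l < m then (callState s (H ω l) (H ω m) j).1[
            (callState s (H ω l) (H ω m) j).1.length / 2]? else none),
            ∀ p ∈ H ω m, s.out v (medianPt (H ω m)) p ≤ 0))
      (fun m l => ((hk₁ m l).comp Prod.fst).comp₂ (hb' m) fun o G =>
        (G[G.length / 2]?, G.length ≤ 2, ∀ v ∈ o, ∀ p ∈ G, s.out v (medianPt G) p ≤ 0))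
      (fun m l => by
        refine ((fits_option (U := U) fun ω a ha => ?_).prodMk
          ((fits_prop _).prodMk (fits_prop _))).mono ?_
        · exact hHU ω m a (List.mem_of_getElem? ha)
        · refine le_trans ?_ hB
          have : 1 ≤ (U.card + 1) ^ 2 := Nat.one_le_pow _ _ (by omega)
          nlinarith)
    refine ⟨K₂, hK₁.trans hK₂, fun i => hK₂.knows (hb' i),
      fun l m h => hK₂.knows (hK₁.knows (hbr l m h)), fun l m hlm x y hxy => ?_,
      fun j' hj' => ?_⟩
    · have e1 := hk l m hlm x y (hK₁.le (hK₂.le hxy))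
      have e2 := hbr l m hlm x y (hK₁.le (hK₂.le hxy))
      have e3 := hk₂ l m x y hxy
      simp only [hlm, if_true, Prod.mk.injEq] at e1 e2 e3
      have e4 : ∀ F, nextFrag s (H x l) (H x m) F = nextFrag s (H y l) (H y m) F := fun F => by
        unfold nextFrag
        rw [e2]
      have hst : Stops s (callState s (H x l) (H x m) j).1 (H x m) ↔
          Stops s (callState s (H y l) (H y m) j).1 (H y m) := by
        rw [stops_iff, stops_iff]
        refine or_congr (by rw [e1]) (or_congr (iff_of_eq e3.2.1)
          (and_congr ?_ (iff_of_eq e3.2.2)))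
        rw [e3.1, e1]
      rw [e1] at hst
      simp only [callState]
      rw [e1, propext hst, e2, e4]
    · rcases Nat.lt_succ_iff_lt_or_eq.1 hj' with hj' | rfl
      · obtain ⟨h1, h2, h3⟩ := hold j' hj'
        exact ⟨fun l m h => hK₂.knows (hK₁.knows (h1 l m h)),
          fun l m h => hK₂.knows (hK₁.knows (h2 l m h)),
          fun i => hK₂.knows (hK₁.knows (h3 i))⟩
      · refine ⟨fun l m h => hK₂.knows (hK₁.knows (hk l m h)), fun l m h => ?_, fun i => ?_⟩
        · have := (hk₁ m l).comp fun z => z.2.1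
          simp only [h, if_true] at this
          exact hK₂.knows this
        · exact hK₂.knows ((Knows.pi fun l => (hk₁ i l).comp fun z => z.2.2).comp
            fun f => ∃ l, f l)) ⟨hKH, hbr', fun l m _ => by
      simp only [callState]
      exact (hKH l).comp fun F => (F, none), by simp⟩ D
  exact ⟨K', hK', hP⟩

end Bridges

theorem gather_reverse {n : ℕ} (g : Fin n → List Pt) :
    (gather g).reverse = gather fun j => (g (Fin.rev j)).reverse := by
  rw [gather, gather, List.reverse_flatten, List.map_ofFn]
  congr 1
  refine List.ext_getElem (by simp) fun i h1 h2 => ?_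
  simp only [List.getElem_reverse, List.getElem_ofFn, List.length_ofFn, Function.comp_apply]
  congr 3
  simp
  omega

/-! ### What a node has to know about the run -/

section Agreement

variable {n b : ℕ}

open Classical in
/-- The vertices of the convex hull in the order in which the procedure collects them. -/
def finalSequence (S : Fin n → Fin n → Pt) : List Pt :=
  gather (pieceOf .upper (subOf S .upper)) ++
    (gather (pieceOf .lower (subOf S .lower))).reverse.filter
      fun v => decide (v ∉ (sortedPts S).head? ∧ v ∉ (sortedPts S).getLast?)

/-- On the inputs `S` and `S'`, node `i` holds the same in all configurations of a run with at most
`D` levels of the calls of `Bridge` in which only left fragments are pruned. -/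
structure Agree (D : ℕ) (i : Fin n) (S S' : Fin n → Fin n → Pt) : Prop where
  input : S i = S' i
  batch : batchOf S i = batchOf S' i
  ends : ∀ j, ((batchOf S j).head?, (batchOf S j).getLast?) =
    ((batchOf S' j).head?, (batchOf S' j).getLast?)
  sub : ∀ s, subOf S s i = subOf S' s i
  subEnds : ∀ s j, ((subOf S s j).head?, (subOf S s j).getLast?) =
    ((subOf S' s j).head?, (subOf S' s j).getLast?)
  call : ∀ s, ∀ j < D, ∀ m, i < m →
    callState s (hullChain s (subOf S s i)) (hullChain s (subOf S s m)) j =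
      callState s (hullChain s (subOf S' s i)) (hullChain s (subOf S' s m)) j
  found : ∀ s, ∀ j < D, ∀ l < i,
    (callState s (hullChain s (subOf S s l)) (hullChain s (subOf S s i)) j).2 =
      (callState s (hullChain s (subOf S' s l)) (hullChain s (subOf S' s i)) j).2
  active : ∀ s, ∀ j < D, SomeActive s (subOf S s) j = SomeActive s (subOf S' s) j
  output : chunk (finalSequence S) i = chunk (finalSequence S') i

open Classical in
/-- In this form the sequence can be routed: every node contributes two lists, and the second ones
are taken in the reverse order of the nodes. -/
theorem finalSequence_eq (S : Fin n → Fin n → Pt) : finalSequence S =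
    gather (pieceOf .upper (subOf S .upper)) ++ gather fun j =>
      ((pieceOf .lower (subOf S .lower) (Fin.rev j)).reverse.filter
        fun v => decide (v ∉ (sortedPts S).head? ∧ v ∉ (sortedPts S).getLast?)) := by
  rw [finalSequence, gather_reverse, gather_filter]

theorem pieceOf_congr {s : Side} {sub sub' : Fin n → List Pt} {i : Fin n} (h : sub i = sub' i)
    (hb : ∀ m, pairBridge s sub i m = pairBridge s sub' i m) :
    pieceOf s sub i = pieceOf s sub' i := by
  rw [pieceOf, pieceOf, bridgedSide, bridgedSide, h, funext hb]

theorem mem_of_mem_batchOf {S : Fin n → Fin n → Pt} {i : Fin n} {p : Pt} (h : p ∈ batchOf S i) :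
    ∃ j k, S j k = p := by
  have : p ∈ sortedPts S := by
    rw [← gather_batchOf, gather_mem]
    exact ⟨i, h⟩
  exact mem_sortedPts.1 this

variable {Ω : Type} {S : Ω → Fin n → Fin n → Pt} {U : Finset Pt}

theorem fits_ends (hb : (U.card + 1) ^ 2 ≤ 2 ^ b) {f : Ω → List Pt} (hU : ∀ ω, ∀ p ∈ f ω, p ∈ U) :
    Fits (2 ^ b) fun ω => ((f ω).head?, (f ω).getLast?) :=
  ((fits_option fun ω a ha => hU ω a (List.mem_of_mem_head? ha)).prodMk
    (fits_option fun ω a ha => hU ω a (List.mem_of_mem_getLast? ha))).mono (by rwa [← sq])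

/-- What the nodes learn about one side of the hull. -/
structure SideKnown (S : Ω → Fin n → Fin n → Pt) (D : ℕ) (s : Side)
    (K : Fin n → Ω → Ω → Prop) : Prop where
  subEnds : ∀ i j, Knows (K i) fun ω => ((subOf (S ω) s j).head?, (subOf (S ω) s j).getLast?)
  bridge : ∀ i m, Knows (K i) fun ω => pairBridge s (subOf (S ω) s) i m
  calls : ∀ j < D,
    (∀ l m, l < m → Knows (K l) fun ω =>
      callState s (hullChain s (subOf (S ω) s l)) (hullChain s (subOf (S ω) s m)) j) ∧
    (∀ l m, l < m → Knows (K m) fun ω =>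
      (callState s (hullChain s (subOf (S ω) s l)) (hullChain s (subOf (S ω) s m)) j).2) ∧
    ∀ i, Knows (K i) fun ω => SomeActive s (subOf (S ω) s) j

theorem SideKnown.trans {D : ℕ} {s : Side} {K K' : Fin n → Ω → Ω → Prop} {r : ℕ}
    (h : SideKnown S D s K) (hr : Reach b K r K') : SideKnown S D s K' where
  subEnds i j := hr.knows (h.subEnds i j)
  bridge i m := hr.knows (h.bridge i m)
  calls j hj := ⟨fun l m hlm => hr.knows ((h.calls j hj).1 l m hlm),
    fun l m hlm => hr.knows ((h.calls j hj).2.1 l m hlm), fun i => hr.knows ((h.calls j hj).2.2 i)⟩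

theorem reach_sideKnown (hS : ∀ ω, DistinctPoints (S ω)) (hb2 : (U.card + 1) ^ 2 ≤ 2 ^ b)
    (hb3 : 4 * (U.card + 1) ^ 3 ≤ 2 ^ b) {s : Side} (hU : ∀ ω i, ∀ p ∈ subOf (S ω) s i, p ∈ U)
    {K : Fin n → Ω → Ω → Prop} (hK : ∀ i, Knows (K i) fun ω => subOf (S ω) s i) (D : ℕ) :
    ∃ K', Reach b K (2 * Nat.size n + 2 * D + 3) K' ∧ SideKnown S D s K' := by
  obtain ⟨K₁, hK₁, hends⟩ := announce (b := b) (K := K)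
    (fun i ω => ((subOf (S ω) s i).head?, (subOf (S ω) s i).getLast?))
    (fun i => (hK i).comp fun l => (l.head?, l.getLast?))
    (fun i => fits_ends hb2 fun ω => hU ω i)
  obtain ⟨K₂, hK₂, hbridge⟩ := reach_pairBridge (s := s) (sub := fun ω => subOf (S ω) s) (K := K₁)
    hb2 (fun ω => gather_subOf_pairwise (hS ω) s) hU (fun ω i => (List.length_filter_le _ _).trans
      (batchOf_length _ i).le) fun i => hK₁.knows (hK i)
  obtain ⟨K₃, hK₃, hcalls⟩ := reach_callState (s := s) (sub := fun ω => subOf (S ω) s) (K := K₂)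
    hb3 hU (fun i => hK₂.knows (hK₁.knows (hK i))) hbridge D
  refine ⟨K₃, ?_, fun i j => hK₃.knows (hK₂.knows (hends i j)),
    fun i m => hK₃.knows (hbridge i m), hcalls⟩
  convert (hK₁.trans hK₂).trans hK₃ using 1
  omega

open Classical in
/-- Within `O(log n)` rounds a node learns all that is needed to follow its own part of a run in
which only left fragments are pruned. -/
theorem reach_agree (hn : 2 ≤ n) (hS : ∀ ω, DistinctPoints (S ω)) (hSU : ∀ ω i j, S ω i j ∈ U)
    {t : ℕ} (ht : U.card ≤ 2 ^ t) (hb : 4 * (n + 1) ^ 2 * (U.card + 1) ^ 4 ≤ 2 ^ b)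
    {K : Fin n → Ω → Ω → Prop} (hK : ∀ i, Knows (K i) fun ω => S ω i) :
    ∃ K', Reach b K (3 * t + 12 * Nat.size n + 18) K' ∧
      ∀ i x y, K' i x y → Agree (2 * Nat.size n + 2) i (S x) (S y) := by
  have hc1 : 1 ≤ (U.card + 1) := by omega
  have hn1 : 1 ≤ (n + 1) ^ 2 := Nat.one_le_pow _ _ (by omega)
  have hb4 : 4 * (U.card + 1) ^ 4 ≤ 2 ^ b := le_trans
    (Nat.mul_le_mul_right _ (Nat.le_mul_of_pos_right 4 (by positivity))) hb
  have hb3 : 4 * (U.card + 1) ^ 3 ≤ 2 ^ b :=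
    le_trans (Nat.mul_le_mul_left 4 (Nat.pow_le_pow_right hc1 (by norm_num))) hb4
  have hb2 : (U.card + 1) ^ 2 ≤ 2 ^ b := by
    have := Nat.pow_le_pow_right hc1 (show 2 ≤ 3 by norm_num)
    omega
  have hbn : (n + 1) ^ 2 ≤ 2 ^ b := by
    refine le_trans ?_ hb
    have : 1 ≤ (U.card + 1) ^ 4 := Nat.one_le_pow _ _ (by omega)
    nlinarith
  have hbr : (n * U.card + 1) ^ 2 ≤ 2 ^ b := by
    have h1 : n * U.card + 1 ≤ (n + 1) * (U.card + 1) := by nlinarith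
    have h2 := Nat.pow_le_pow_left h1 2
    have h3 := Nat.pow_le_pow_right hc1 (show 2 ≤ 4 by norm_num)
    rw [mul_pow] at h2
    have := Nat.mul_le_mul_left ((n + 1) ^ 2) h3
    nlinarith
  have hbU : ∀ ω i, ∀ p ∈ batchOf (S ω) i, p ∈ U := fun ω i p hp => by
    obtain ⟨j, k, rfl⟩ := mem_of_mem_batchOf hp
    exact hSU ω j k
  have hsU : ∀ s ω i, ∀ p ∈ subOf (S ω) s i, p ∈ U := fun s ω i p hp =>
    hbU ω i p (List.mem_of_mem_filter hp)
  have hslen : ∀ s ω i, (subOf (S ω) s i).length ≤ n := fun s ω i =>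
    (List.length_filter_le _ _).trans (batchOf_length _ i).le
  obtain ⟨K₁, hK₁, hbatch⟩ := reach_sorted (by omega) hbr hbn ht hK hSU
  obtain ⟨K₂, hK₂, hends⟩ := announce (b := b) (K := K₁)
    (fun i ω => ((batchOf (S ω) i).head?, (batchOf (S ω) i).getLast?))
    (fun i => (hbatch i).comp fun l => (l.head?, l.getLast?))
    (fun i => fits_ends hb2 fun ω => hbU ω i)
  have hext : ∀ i, Knows (K₂ i) fun ω => ((sortedPts (S ω)).head?, (sortedPts (S ω)).getLast?) := by
    intro i
    have h := (Knows.pi (hends i)).comp fun e =>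
      ((({ ends := e } : Mem n).allEnds).head?, (({ ends := e } : Mem n).allEnds).getLast?)
    intro x y hxy
    have := h x y hxy
    simp only at this
    rwa [(allEnds_eq hn fun _ => rfl).1, (allEnds_eq hn fun _ => rfl).2,
      (allEnds_eq hn fun _ => rfl).1, (allEnds_eq hn fun _ => rfl).2] at this
  have hsub : ∀ s i, Knows (K₂ i) fun ω => subOf (S ω) s i := fun s i =>
    (hext i).comp₂ (hK₂.knows (hbatch i)) fun e l => l.filter fun q => decide
      (∀ a ∈ e.1, ∀ b ∈ e.2, 0 ≤ s.out a b q)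
  obtain ⟨K₃, hK₃, hupper⟩ := reach_sideKnown hS hb2 hb3 (hsU .upper) (hsub .upper)
    (2 * Nat.size n + 2)
  obtain ⟨K₄, hK₄, hlower⟩ := reach_sideKnown hS hb2 hb3 (hsU .lower)
    (fun i => hK₃.knows (hsub .lower i)) (2 * Nat.size n + 2)
  have hside : ∀ s, SideKnown S (2 * Nat.size n + 2) s K₄ := by
    rintro (_ | _)
    · exact hupper.trans hK₄
    · exact hlower
  have h24 := hK₃.trans hK₄
  have hpiece : ∀ s i, Knows (K₄ i) fun ω => pieceOf s (subOf (S ω) s) i := fun s i x y hxy =>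
    pieceOf_congr (h24.knows (hsub s i) x y hxy) fun m => (hside s).bridge i m x y hxy
  obtain ⟨K₅, hK₅, hout⟩ := route_gather (K := K₄) (by omega) hbr hbn
    (f := fun τ i ω => if τ then (pieceOf .lower (subOf (S ω) .lower) i).reverse.filter
        fun v => decide (v ∉ (sortedPts (S ω)).head? ∧ v ∉ (sortedPts (S ω)).getLast?)
      else pieceOf .upper (subOf (S ω) .upper) i)
    (fun τ => if τ then Fin.revPerm else Equiv.refl _)
    (fun τ i => by
      cases τ
      · exact hpiece .upper i
      · exact (hpiece .lower i).comp₂ (h24.knows (hext i)) fun l e => l.reverse.filter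
          fun v => decide (v ∉ e.1 ∧ v ∉ e.2))
    (fun τ i ω => by
      cases τ
      · exact (List.length_filter_le _ _).trans (hull_length_le _ _ _)
      · refine (List.length_filter_le _ _).trans ?_
        rw [List.length_reverse]
        exact (List.length_filter_le _ _).trans (hull_length_le _ _ _))
    (fun τ i ω p hp => by
      cases τ
      · exact hsU _ ω i p (hullChain_subset _ _ (List.mem_of_mem_filter hp))
      · have hp := List.mem_reverse.1 (List.mem_of_mem_filter hp)
        exact hsU _ ω i p (hullChain_subset _ _ (List.mem_of_mem_filter hp)))
  have h2 := hK₂.trans (h24.trans hK₅)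
  have h4 := fun s => (hside s).trans hK₅
  refine ⟨K₅, ?_, fun i x y hxy => ?_⟩
  · convert hK₁.trans h2 using 1
    omega
  · exact {
      input := (hK₁.trans h2).knows (hK i) x y hxy
      batch := h2.knows (hbatch i) x y hxy
      ends := fun j => (h24.trans hK₅).knows (hends i j) x y hxy
      sub := fun s => (h24.trans hK₅).knows (hsub s i) x y hxy
      subEnds := fun s j => (h4 s).subEnds i j x y hxy
      call := fun s j hj m hm => ((h4 s).calls j hj).1 i m hm x y hxy
      found := fun s j hj l hl => ((h4 s).calls j hj).2.1 l i hl x y hxy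
      active := fun s j hj => ((h4 s).calls j hj).2.2 i x y hxy
      output := by
        have := hout i x y hxy
        simpa [finalSequence_eq] using this }

end Agreement

/-! ### Canonical runs -/

section Canonical

variable {n : ℕ}

/-- The state of the calls of `Bridge` after `j` canonical levels. Calls with an empty hull, which are
never active, need no exception: `callState` ends them at once and finds no bridge. -/
structure CanonicalCalls (S : Fin n → Fin n → Pt) (s : Side) (j : ℕ) (M : Fin n → Mem n) :
    Prop where
  inv : CallsInv S s j M
  fragLeft : ∀ l m, l < m → ((M l).side s).frag m =
    (callState s (hullChain s (subOf S s l)) (hullChain s (subOf S s m)) j).1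
  fragRight : ∀ l m, l < m → ((M m).side s).frag l = hullChain s (subOf S s m)
  found : ∀ l m, l < m → ((M l).side s).bridge m =
    (callState s (hullChain s (subOf S s l)) (hullChain s (subOf S s m)) j).2

variable {S S' : Fin n → Fin n → Pt}

theorem CanonicalCalls.activeCall_iff (hS : DistinctPoints S) {s : Side} {j : ℕ}
    {M : Fin n → Mem n} (h : CanonicalCalls S s j M) {l m : Fin n} (hlm : l < m) :
    ActiveCall s M l m ↔
      bridgeOf s (hullChain s (subOf S s l)) (hullChain s (subOf S s m)) ≠ none ∧
      (callState s (hullChain s (subOf S s l)) (hullChain s (subOf S s m)) j).2 = none := by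
  rw [ActiveCall, h.inv.hull, h.inv.hull, h.found l m hlm, ← and_assoc]
  refine and_congr_left fun _ => ?_
  constructor
  · rintro ⟨h1, h2⟩
    obtain ⟨a, b, e, -⟩ := bridgeOf_isSome (s := s) (hull_lt hS s hlm) h1 h2
    simp [e]
  · intro h
    by_contra hne
    exact h (bridgeOf_none (by tauto))

theorem CanonicalCalls.someActive_iff (hS : DistinctPoints S) {s : Side} {j : ℕ}
    {M : Fin n → Mem n} (h : CanonicalCalls S s j M) :
    SomeActive s (subOf S s) j ↔ ∃ l m, l < m ∧ ActiveCall s M l m :=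
  exists₂_congr fun _ _ => and_congr_right fun hlm => (h.activeCall_iff hS hlm).symm

theorem CanonicalCalls.le {s : Side} {j : ℕ} {M : Fin n → Mem n} (h : CanonicalCalls S s j M)
    (hact : ∃ l m, l < m ∧ ActiveCall s M l m) : j ≤ 2 * Nat.size n := by
  obtain ⟨l, m, hlm, hact⟩ := hact
  obtain ⟨_, _, _, _, _, _, _, hle⟩ := h.inv.frag l m hlm hact
  omega

theorem canonicalCalls_start (hS : DistinctPoints S) {s : Side} {M : Fin n → Mem n}
    (h : IsSplit S M) (hf : IsFresh s M) :
    CanonicalCalls S s 0 (fun i => (M i).setSide s { (M i).side s with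
      hull := hullChain s ((M i).side s).sub
      frag := fun _ => hullChain s ((M i).side s).sub }) where
  inv := callsInv_start hS h hf
  fragLeft l m _ := by simp only [setSide_same, h.sub, callState]
  fragRight l m _ := by simp only [setSide_same, h.sub]
  found l m _ := by simp only [setSide_same, (hf l).2, callState]

theorem CanonicalCalls.level (hS : DistinctPoints S) {s : Side} {j : ℕ} {M : Fin n → Mem n}
    (h : CanonicalCalls S s j M) (hsub : ∀ i, ((M i).side s).sub = subOf S s i)
    {F : Fin n → Fin n → List Pt} {R : Fin n → Fin n → Option (Pt × Pt)}
    (h1 : ∀ l m, l < m → ActiveCall s M l m →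
        BridgeStep s (((M l).side s).frag m) (((M m).side s).frag l) (F l m) (F m l) (R l m))
    (h2 : ∀ l m, l < m → ¬ ActiveCall s M l m → F l m = ((M l).side s).frag m ∧
        F m l = ((M m).side s).frag l ∧ R l m = ((M l).side s).bridge m)
    (h3 : ∀ l m, R m l = R l m)
    (h4 : ∀ l, F l l = ((M l).side s).frag l ∧ R l l = ((M l).side s).bridge l)
    (hc : CanonicalStep ⟨.bridges s, M⟩ ⟨.bridges s, fun i => (M i).setSide s { (M i).side s with
            frag := F i
            bridge := R i
            marked := markBelow ((M i).side s) (R i) }⟩) :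
    CanonicalCalls S s (j + 1) (fun i => (M i).setSide s { (M i).side s with
            frag := F i
            bridge := R i
            marked := markBelow ((M i).side s) (R i) }) := by
  have key : ∀ l m, l < m → F m l = ((M m).side s).frag l ∧ (F l m, R l m) =
      callState s (hullChain s (subOf S s l)) (hullChain s (subOf S s m)) (j + 1) := by
    intro l m hlm
    have hl := h.fragLeft l m hlm
    have hr := h.fragRight l m hlm
    have hf := h.found l m hlm
    by_cases hact : ActiveCall s M l m
    · have hc := hc.2 s rfl rfl l m hlm hact
      simp only [setSide_same, h.inv.hull, hr] at hc
      rw [hr, callState, if_pos (hf ▸ hact.2.2)]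
      refine ⟨hc.1, ?_⟩
      rw [← hl]
      split_ifs with hst
      · rw [(hc.2.1 hst).1, (hc.2.1 hst).2]
      · rw [(hc.2.2 hst).1, (hc.2.2 hst).2]
    · obtain ⟨e1, e2, e3⟩ := h2 l m hlm hact
      refine ⟨e2, ?_⟩
      rw [e1, e3, hl, hf, callState]
      split_ifs with hnone hst
      · rw [h.activeCall_iff hS hlm, and_iff_left hnone, not_not] at hact
        rw [hnone, hact]
      · refine absurd ?_ hst
        have hne := (h.activeCall_iff hS hlm).not.1 hact
        rw [and_iff_left hnone, not_not] at hne
        by_cases hl0 : hullChain s (subOf S s l) = []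
        · left
          have := (callState_sublist s (hullChain s (subOf S s l))
            (hullChain s (subOf S s m)) j).length_le
          rw [hl0, List.length_nil] at this
          rw [hl0]
          omega
        · right; left
          by_cases hm0 : hullChain s (subOf S s m) = []
          · simp [hm0]
          · obtain ⟨a, b, e, -⟩ := bridgeOf_isSome (hull_lt hS s hlm) hl0 hm0
            rw [e] at hne
            cases hne
      · rfl
  refine ⟨h.inv.level hS hsub h1 h2 h3 h4, fun l m hlm => ?_, fun l m hlm => ?_, fun l m hlm => ?_⟩
  · simp only [setSide_same]
    exact congrArg Prod.fst (key l m hlm).2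
  · simp only [setSide_same]
    rw [(key l m hlm).1, h.fragRight l m hlm]
  · simp only [setSide_same]
    exact congrArg Prod.snd (key l m hlm).2

/-- Two canonical runs, on the inputs `S` and `S'`, are in the same stage, and in the same level of
the calls of `Bridge`, and node `i` holds the same in both. -/
def InStep (i : Fin n) (S S' : Fin n → Fin n → Pt) (c c' : Config n) : Prop :=
  c.stage = c'.stage ∧ c.mem i = c'.mem i ∧ ∃ j ≤ 2 * Nat.size n + 1, ∀ s, c.stage = .bridges s →
    CanonicalCalls S s j c.mem ∧ CanonicalCalls S' s j c'.mem

theorem InStep.of_ne {i : Fin n} {c c' : Config n} (h : c.stage = c'.stage)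
    (h' : c.mem i = c'.mem i) (hne : ∀ s, c.stage ≠ .bridges s) : InStep i S S' c c' :=
  ⟨h, h', 0, by omega, fun s hs => absurd hs (hne s)⟩

theorem CanonicalCalls.calls_eq {i : Fin n} {s : Side} {j : ℕ} {M M' : Fin n → Mem n}
    (ha : Agree (2 * Nat.size n + 2) i S S') (hj : j ≤ 2 * Nat.size n + 1)
    (h : CanonicalCalls S s j M) (h' : CanonicalCalls S' s j M') {m : Fin n} (hm : m ≠ i) :
    ((M i).side s).frag m = ((M' i).side s).frag m ∧
      ((M i).side s).bridge m = ((M' i).side s).bridge m := by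
  rcases lt_or_gt_of_ne hm with hlt | hlt
  · rw [h.fragRight m i hlt, h'.fragRight m i hlt, h.inv.bridge_comm, h'.inv.bridge_comm,
      h.found m i hlt, h'.found m i hlt]
    exact ⟨by rw [ha.sub], ha.found s j (by omega) m hlt⟩
  · rw [h.fragLeft i m hlt, h'.fragLeft i m hlt, h.found i m hlt, h'.found i m hlt,
      ha.call s j (by omega) m hlt]
    exact ⟨rfl, rfl⟩

theorem hullSequence_eq {M : Fin n → Mem n} (hs : IsSplit S M) (hk : ∀ s, IsKept S s M)
    (i : Fin n) : hullSequence M (M i).pmin (M i).pmax = finalSequence S := by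
  have hp : ∀ s, (fun j => ((M j).side s).piece) = pieceOf s (subOf S s) := fun s => funext (hk s)
  rw [hullSequence, hp, hp, hs.pmin, hs.pmax, finalSequence]

/-- What a node holds after the next canonical step is determined by what it holds now and by the
values that occur in `Agree`. -/
theorem InStep.step (hS : DistinctPoints S) (hS' : DistinctPoints S') {i : Fin n}
    (ha : Agree (2 * Nat.size n + 2) i S S') {k : ℕ} {c c' d d' : Config n}
    (hr : RunInv S k c.stage c.mem) (hr' : RunInv S' k c'.stage c'.mem) (h : InStep i S S' c c')
    (hd : CanonicalStep c d) (hd' : CanonicalStep c' d') : InStep i S S' d d' := by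
  obtain ⟨st, M⟩ := c
  obtain ⟨st', M'⟩ := c'
  obtain ⟨hst, hM, j, hj, hcalls⟩ := h
  dsimp only at hst hM hcalls hr hr'
  subst hst
  have hd₁ := hd.1
  have hd₁' := hd'.1
  cases hd₁ with
  | sort =>
    cases hd₁'
    obtain ⟨-, rfl⟩ := hr
    obtain ⟨-, rfl⟩ := hr'
    refine .of_ne rfl ?_ (by simp)
    have := ha.batch
    simp only [batchOf, sortedPts] at this
    simp only [hM]
    simp only [Config.initial, this]
  | sendEnds =>
    cases hd₁'
    refine .of_ne rfl ?_ (by simp)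
    simp only [hM, hr.2.1, hr'.2.1, ha.ends]
  | split =>
    cases hd₁'
    refine .of_ne rfl ?_ (by simp)
    simp only [hM]
  | sendSubEnds =>
    cases hd₁'
    refine .of_ne rfl ?_ (by simp)
    simp only [hM, hr.2.1.sub, hr'.2.1.sub, ha.subEnds]
  | localHull s =>
    cases hd₁'
    refine ⟨rfl, by simp only [hM], 0, by omega, fun t ht => ?_⟩
    obtain rfl : s = t := by simpa using ht
    exact ⟨canonicalCalls_start hS hr.2.1 hr.2.2.1, canonicalCalls_start hS' hr'.2.1 hr'.2.2.1⟩
  | bridgeLevel s _ F R hact h1 h2 h3 h4 =>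
    obtain ⟨hI, hI'⟩ := hcalls s rfl
    have hact' := (hI'.someActive_iff hS').1
      ((ha.active s j (by omega)).mp ((hI.someActive_iff hS).2 hact))
    cases hd₁' with
    | bridgesDone _ _ hdone =>
      obtain ⟨l, m, hlm, hact'⟩ := hact'
      exact absurd hact' (hdone l m hlm)
    | bridgeLevel _ _ F' R' _ h1' h2' h3' h4' =>
      have hj1 : j + 1 ≤ 2 * Nat.size n + 1 := by
        have := hI.le hact
        omega
      have hJ := hI.level hS (fun i => hr.1.sub i s) h1 h2 h3 h4 hd
      have hJ' := hI'.level hS' (fun i => hr'.1.sub i s) h1' h2' h3' h4' hd'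
      have heq := fun m (hm : m ≠ i) => CanonicalCalls.calls_eq ha hj1 hJ hJ' hm
      simp only [setSide_same] at heq
      have hF : F i = F' i := by
        funext m
        by_cases hm : m = i
        · rw [hm, (h4 i).1, (h4' i).1, hM]
        · exact (heq m hm).1
      have hR : R i = R' i := by
        funext m
        by_cases hm : m = i
        · rw [hm, (h4 i).2, (h4' i).2, hM]
        · exact (heq m hm).2
      refine ⟨rfl, by simp only [hM, hF, hR], j + 1, hj1, fun t ht => ?_⟩
      obtain rfl : s = t := by simpa using ht
      exact ⟨hJ, hJ'⟩
  | bridgesDone s _ hdone =>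
    obtain ⟨hI, hI'⟩ := hcalls s rfl
    cases hd₁' with
    | bridgesDone => exact .of_ne rfl hM (by simp)
    | bridgeLevel _ _ _ _ hact' =>
      obtain ⟨l, m, hlm, hact⟩ := (hI.someActive_iff hS).1
        ((ha.active s j (by omega)).mpr ((hI'.someActive_iff hS').2 hact'))
      exact absurd hact (hdone l m hlm)
  | angles s =>
    cases hd₁'
    refine .of_ne rfl ?_ (by simp)
    simp only [hM]
  | prune s =>
    cases hd₁'
    refine .of_ne rfl ?_ (by cases s <;> simp [Side.after])
    simp only [hM]
  | collect =>
    cases hd₁'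
    refine .of_ne rfl ?_ (by simp)
    have hf := hullSequence_eq hr.2.1 hr.2.2 i
    have hf' := hullSequence_eq hr'.2.1 hr'.2.2 i
    simp only [hM] at hf
    simp only [hM, hf, hf', ha.output]

open Classical in
/-- A run of canonical steps, which rests in its last configuration. -/
def canonicalRun (S : Fin n → Fin n → Pt) : ℕ → Config n
  | 0 => Config.initial S
  | k + 1 => if h : ∃ d, CanonicalStep (canonicalRun S k) d then h.choose else canonicalRun S k

theorem canonicalRun_isRun (hn : 2 ≤ n) (hS : DistinctPoints S) {K : ℕ}
    (hK : ∀ k < K, (canonicalRun S k).stage ≠ .done) : IsRun S K (canonicalRun S) ∧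
      ∀ k < K, CanonicalStep (canonicalRun S k) (canonicalRun S (k + 1)) := by
  induction K with
  | zero => exact ⟨⟨rfl, by simp⟩, by simp⟩
  | succ K ih =>
    obtain ⟨h1, h2⟩ := ih fun k hk => hK k (by omega)
    have hstep := (h1.inv hn hS K le_rfl).exists_step hS (hK K (by omega))
    have hlast : CanonicalStep (canonicalRun S K) (canonicalRun S (K + 1)) := by
      rw [canonicalRun, dif_pos hstep]
      exact hstep.choose_spec
    refine ⟨⟨rfl, fun k hk => ?_⟩, fun k hk => ?_⟩
    · rcases Nat.lt_succ_iff_lt_or_eq.1 hk with hk | rfl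
      · exact h1.2 k hk
      · exact hlast.1
    · rcases Nat.lt_succ_iff_lt_or_eq.1 hk with hk | rfl
      · exact h2 k hk
      · exact hlast

theorem canonicalRun_of_done {K : ℕ} (h : (canonicalRun S K).stage = .done) {k : ℕ} (hk : K ≤ k) :
    canonicalRun S k = canonicalRun S K := by
  induction k, hk using Nat.le_induction with
  | base => rfl
  | succ k _ ih =>
    rw [canonicalRun, dif_neg, ih]
    rw [ih]
    rintro ⟨d, hd, -⟩
    generalize canonicalRun S K = c at h hd
    cases hd <;> simp at h

theorem exists_canonicalRun_done (hn : 2 ≤ n) (hS : DistinctPoints S) :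
    ∃ K ≤ 15 + 4 * Nat.size n, (canonicalRun S K).stage = .done ∧
      ∀ k < K, (canonicalRun S k).stage ≠ .done := by
  classical
  have h : ∃ K, (canonicalRun S K).stage = .done := by
    by_contra! h
    have := ((canonicalRun_isRun hn hS fun k (_ : k < 16 + 4 * Nat.size n) => h k).1.inv hn hS _
      le_rfl).le
    omega
  refine ⟨Nat.find h, ?_, Nat.find_spec h, fun k hk => Nat.find_min h hk⟩
  exact ((canonicalRun_isRun hn hS fun k hk => Nat.find_min h hk).1.inv hn hS _ le_rfl).le

theorem canonicalRun_eq_of_agree (hn : 2 ≤ n) (hS : DistinctPoints S) (hS' : DistinctPoints S')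
    {i : Fin n} (ha : Agree (2 * Nat.size n + 2) i S S') (k : ℕ) :
    (canonicalRun S k).mem i = (canonicalRun S' k).mem i := by
  have key : ∀ k, (∀ k' < k, (canonicalRun S k').stage ≠ .done) →
      (∀ k' < k, (canonicalRun S' k').stage ≠ .done) ∧
      InStep i S S' (canonicalRun S k) (canonicalRun S' k) := by
    intro k
    induction k with
    | zero =>
      intro _
      refine ⟨by simp, .of_ne rfl ?_ (by simp [canonicalRun, Config.initial])⟩
      simp only [canonicalRun, Config.initial, ha.input]
    | succ k ih =>
      intro hk
      obtain ⟨hk', hin⟩ := ih fun k' h => hk k' (by omega)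
      have hk1 : ∀ k' < k + 1, (canonicalRun S' k').stage ≠ .done := by
        intro k' h
        rcases Nat.lt_succ_iff_lt_or_eq.1 h with h | rfl
        · exact hk' k' h
        · rw [← hin.1]
          exact hk k' (by omega)
      obtain ⟨h1, h2⟩ := canonicalRun_isRun hn hS hk
      obtain ⟨h1', h2'⟩ := canonicalRun_isRun hn hS' hk1
      exact ⟨hk1, hin.step hS hS' ha (h1.inv hn hS k (by omega)) (h1'.inv hn hS' k (by omega))
        (h2 k (by omega)) (h2' k (by omega))⟩
  obtain ⟨K, -, hdone, hK⟩ := exists_canonicalRun_done hn hS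
  rcases le_total k K with h | h
  · exact (key k fun k' hk' => hK k' (by omega)).2.2.1
  · have hin := (key K hK).2
    rw [canonicalRun_of_done hdone h, canonicalRun_of_done (hin.1 ▸ hdone) h]
    exact hin.2.1

end Canonical

/-! ### The protocol -/

/-- The protocol collects what `Agree` asks for and then plays the canonical run. It has the same
number of rounds for all inputs; a run that is done earlier rests until the end. -/
theorem exists_protocol {n L b : ℕ} (hn : 2 ≤ n) (val : BitVec L → ℝ)
    (hb : 4 * (n + 1) ^ 2 * (2 ^ (2 * L) + 1) ^ 4 ≤ 2 ^ b) :
    ∃ (P : CliqueProtocol n b (Fin n → BitVec L × BitVec L) (List Pt))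
      (mem : Fin n → P.State → Mem n),
      ∀ inp : Fin n → Fin n → BitVec L × BitVec L, DistinctPoints (points val inp) →
        CarriesOut P mem (6 * L + 16 * Nat.size n + 33) inp (points val inp) ∧
        HoldsConvexHull (pointSet (points val inp))
          (fun i => P.output i (P.exec inp (6 * L + 16 * Nat.size n + 33) i)) := by
  classical
  let Ω := {inp : Fin n → Fin n → BitVec L × BitVec L // DistinctPoints (points val inp)}
  let S : Ω → Fin n → Fin n → Pt := fun ω => points val ω.1
  let e : Fin (2 ^ L) × Fin (2 ^ L) → Pt := fun w => (val (.ofFin w.1), val (.ofFin w.2))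
  set T₀ : ℕ := 3 * (2 * L) + 12 * Nat.size n + 18 with hT₀
  have hU : (Finset.univ.image e).card ≤ 2 ^ (2 * L) := Finset.card_image_le.trans (by
    simp [two_mul, pow_add])
  obtain ⟨K, hK, hagree⟩ := reach_agree (b := b) (S := S) (U := Finset.univ.image e) hn
    (fun ω => ω.2) (fun ω i j => Finset.mem_image.2
      ⟨((ω.1 i j).1.toFin, (ω.1 i j).2.toFin), Finset.mem_univ _, rfl⟩) hU
    (le_trans (by gcongr) hb) (K := fun i x y => x.1 i = y.1 i) (fun i x y hxy => by
      funext j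
      simp only [S, points, hxy])
  obtain ⟨m, hm, rfl⟩ := Reach.exists_messages (inp := fun ω : Ω => ω.1) hK
  -- The collection of the knowledge takes `T₀` rounds; then the run is played, one step per round.
  have hview : ∀ t i (x y : Ω), viewAfter (fun ω : Ω => ω.1) m t i x y →
      (canonicalRun (S x) (t - T₀)).mem i = (canonicalRun (S y) (t - T₀)).mem i := by
    intro t i x y h
    rcases le_total t T₀ with ht | ht
    · have : S x i = S y i := by
        funext j
        simp only [S, points, h.1]
      rw [Nat.sub_eq_zero_of_le ht]
      simp only [canonicalRun, Config.initial, this]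
    · exact canonicalRun_eq_of_agree hn x.2 y.2
        (hagree i x y ⟨h.1, fun s hs => h.2 s (by omega)⟩) _
  let P := worldsProtocol (fun ω : Ω => ω.1) m
    fun t i ω => ((canonicalRun (S ω) (t - T₀)).mem i).output
  let mem : Fin n → P.State → Mem n := fun i (σ : ℕ × Set Ω) =>
    if h : σ.2.Nonempty then (canonicalRun (S h.some) (σ.1 - T₀)).mem i else {}
  refine ⟨P, mem, fun inp hinp => ?_⟩
  let ω : Ω := ⟨inp, hinp⟩
  have hne : ∀ t i, {x | viewAfter (fun ω : Ω => ω.1) m t i ω x}.Nonempty :=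
    fun t i => ⟨ω, rfl, fun _ _ _ => rfl⟩
  have hexec : ∀ t i, P.exec inp t i = (t, {x | viewAfter (fun ω : Ω => ω.1) m t i ω x}) :=
    worldsProtocol_exec _ hm ω
  have hmem : ∀ t i, mem i (P.exec inp t i) = (canonicalRun (S ω) (t - T₀)).mem i := by
    intro t i
    rw [hexec]
    simp only [mem]
    rw [dif_pos (hne t i)]
    exact (hview t i _ _ (hne t i).some_mem).symm
  have hout : ∀ t i, P.output i (P.exec inp t i) =
      ((canonicalRun (S ω) (t - T₀)).mem i).output := by
    intro t i
    rw [hexec]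
    simp only [P, worldsProtocol]
    rw [dif_pos (hne t i)]
    exact congrArg Mem.output (hview t i _ _ (hne t i).some_mem).symm
  obtain ⟨N, hN, hdone, hlt⟩ := exists_canonicalRun_done hn hinp
  have hrun := (canonicalRun_isRun hn hinp hlt).1
  have hN0 : N ≠ 0 := by
    rintro rfl
    simp [canonicalRun, Config.initial] at hdone
  have hlast : canonicalRun (S ω) (6 * L + 16 * Nat.size n + 33 - T₀) = canonicalRun (S ω) N :=
    canonicalRun_of_done hdone (by omega)
  refine ⟨⟨N, canonicalRun (S ω), fun k => if k = 0 then 0 else if k < N then T₀ + k else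
    6 * L + 16 * Nat.size n + 33, hrun, hdone, ?_, by simp, by simp [hN0], ?_⟩, ?_⟩
  · intro k k' hk
    dsimp only
    split_ifs <;> omega
  · intro k hk i
    rw [hmem]
    dsimp only
    split_ifs with h0 hlt
    · rw [h0, Nat.zero_sub]
    · rw [Nat.add_sub_cancel_left]
    · rw [hlast, le_antisymm hk (not_lt.1 hlt)]
  · have := RunInv.holdsConvexHull hn hinp (k := N) (M := (canonicalRun (S ω) N).mem) (by
      have := hrun.inv hn hinp N le_rfl
      rwa [hdone] at this)
    simpa only [hout, hlast] using this

end

/-- Here `Nat.log 2 n` is the integer part of the binary logarithm. The first part concerns the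
procedure itself: each of its executions consists of at most `C log n` steps, can be continued until
the procedure is done, and then outputs the convex hull. The second part concerns the congested
clique. -/
theorem theorem2 (c : ℕ) :
    ∃ B C : ℕ, ∀ n : ℕ, 2 ≤ n →
      (∀ S : Fin n → Fin n → Pt, DistinctPoints S →
        ∀ (K : ℕ) (conf : ℕ → Config n), IsRun S K conf →
          K ≤ C * Nat.log 2 n ∧
          ((conf K).stage ≠ Stage.done → ∃ next, Step (conf K) next) ∧
          ((conf K).stage = Stage.done →
            HoldsConvexHull (pointSet S) (fun i => ((conf K).mem i).output))) ∧
      (∀ L : ℕ, L ≤ c * Nat.log 2 n → ∀ val : BitVec L → ℝ,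
        ∃ (P : CliqueProtocol n (B * Nat.log 2 n) (Fin n → BitVec L × BitVec L) (List Pt))
          (mem : Fin n → P.State → Mem n) (T : ℕ),
          T ≤ C * Nat.log 2 n ∧
          ∀ inp : Fin n → Fin n → BitVec L × BitVec L, DistinctPoints (points val inp) →
            CarriesOut P mem T inp (points val inp) ∧
            HoldsConvexHull (pointSet (points val inp))
              (fun i => P.output i (P.exec inp T i))) := by
  -- Points are pairs of strings of `L ≤ c * log n` bits, so there are at most `2 ^ (2 * L)` of them;
  -- every message fits into four points, two numbers of nodes and two bits.
  refine ⟨8 * c + 10, 6 * c + 65, fun n hn => ?_⟩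
  have hlog : 1 ≤ Nat.log 2 n := Nat.log_pos one_lt_two hn
  have hlt : n < 2 ^ (Nat.log 2 n + 1) := Nat.lt_pow_succ_log_self one_lt_two n
  have hsize : Nat.size n ≤ Nat.log 2 n + 1 := Nat.size_le.2 hlt
  refine ⟨fun S hS K conf hrun => ?_, fun L hL val => ?_⟩
  · have hinv := hrun.inv hn hS K le_rfl
    refine ⟨?_, fun hne => ?_, fun hdone => ?_⟩
    · have := hinv.le
      nlinarith
    · obtain ⟨d, hd, -⟩ := hinv.exists_step hS hne
      exact ⟨d, hd⟩
    · rw [hdone] at hinv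
      exact hinv.holdsConvexHull hn hS
  · obtain ⟨P, mem, h⟩ := exists_protocol (b := (8 * c + 10) * Nat.log 2 n) hn val (by
      have h1 : 2 ^ (2 * L) + 1 ≤ 2 ^ (2 * L + 1) := by
        have := Nat.one_le_two_pow (n := 2 * L)
        rw [pow_succ]
        omega
      calc 4 * (n + 1) ^ 2 * (2 ^ (2 * L) + 1) ^ 4
          ≤ 2 ^ 2 * (2 ^ (Nat.log 2 n + 1)) ^ 2 * (2 ^ (2 * L + 1)) ^ 4 := by gcongr <;> omega
        _ = 2 ^ (2 + (Nat.log 2 n + 1) * 2 + (2 * L + 1) * 4) := by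
          rw [← pow_mul, ← pow_mul, ← pow_add, ← pow_add]
        _ ≤ _ := Nat.pow_le_pow_right two_pos (by nlinarith))
    exact ⟨P, mem, _, by nlinarith, h⟩
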